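/- Let $(M, g_M)$ be a nonempty closed (compact, without boundary) smooth Riemannian manifold, and let $(N, g_N) = \mathbb{S}^1 \times (M, g_M)$ be its Riemannian product with the unit circle $\mathbb{S}^1 \subset \mathbb{C}$. Let $W \in C^\infty(\mathbb{R}; \mathbb{R})$ be a double-well potential, i.e. $W \ge 0$ with equality exactly at $\pm 1$; $W(x) = W(-x)$ for all $x$; $W''(\pm 1) > 0$; and $W'(x)/x$ is (weakly) increasing on $(0,1)$ and (weakly) decreasing on $(-1,0)$. Let $\varepsilon_i > 0$ with $\varepsilon_i \to 0$, and for each $i$ let $u_i : N \to [-1,1]$ be a double-well phase transition with parameter $\varepsilon_i$, i.e. a smooth critical point of $$E_{\varepsilon_i}(u) = \int_N \Big( \tfrac12 \varepsilon_i |\nabla u|^2 + \varepsilon_i^{-1} W(u) \Big)\, d\mu_{g_N}.$$ Suppose that for some $\theta_1, \theta_2 \in \mathbb{S}^1$, not assumed distinct, the nodal sets $\{u_i = 0\}$ converge to $\Sigma := \{\theta_1, \theta_2\} \times M$ in the Hausdorff sense, as $i \to \infty$, with respect to the Riemannian distance of $N$. Then: (a) $\theta_2 = -\theta_1$; in particular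 $\theta_1 \ne \theta_2$. (b) Up to signs, $u_i \to \pm 1$ locally uniformly on $N \setminus \Sigma$, with the sign alternating across each component of $\Sigma$. Precisely, there are locally constant functions $s_i : M \to \{1, -1\}$ (constants if $M$ is connected) such that, as $i \to \infty$, $s_i(x)\, u_i(z, x) \to \operatorname{sign}(\operatorname{Im}(z/\theta_1))$ locally uniformly in $(z, x) \in N \setminus \Sigma$; that is, the limit is $+1$ on one of the two open arcs of $\mathbb{S}^1 \setminus \{\theta_1, \theta_2\}$ times $M$ and $-1$ on the other one times $M$. -/

import Mathlib

open Set Filter Topology Bundle MeasureTheory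
open scoped Manifold ContDiff ENNReal

namespace PhaseTransition
noncomputable section

section Pullback
variable {E : Type*} [NormedAddCommGroup E] [NormedSpace ℝ E]
  {H : Type*} [TopologicalSpace H] {I : ModelWithCorners ℝ E H}
  {N : Type*} [TopologicalSpace N] [ChartedSpace H N]
  {E' : Type*} [NormedAddCommGroup E'] [NormedSpace ℝ E']
  {H' : Type*} [TopologicalSpace H'] {I' : ModelWithCorners ℝ E' H'}
  {N' : Type*} [TopologicalSpace N'] [ChartedSpace H' N']

/-- The pullback `(v, w) ↦ B (A v) (A w)` of a bilinear form `B` under a linear map `A`. -/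
def pullbackForm (A : E →L[ℝ] E') (B : E' →L[ℝ] E' →L[ℝ] ℝ) : E →L[ℝ] E →L[ℝ] ℝ :=
  B.bilinearComp A A

theorem pullbackForm_apply (A : E →L[ℝ] E') (B : E' →L[ℝ] E' →L[ℝ] ℝ) (v w : E) :
    pullbackForm A B v w = B (A v) (A w) := rfl

theorem contDiff_pullbackForm : ContDiff ℝ ∞
    (fun x : (E →L[ℝ] E') × (E' →L[ℝ] E' →L[ℝ] ℝ) ↦ pullbackForm x.1 x.2) := by
  have h1 : ContDiff ℝ ∞ (fun x : (E →L[ℝ] E') × (E' →L[ℝ] E' →L[ℝ] ℝ) ↦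
      (ContinuousLinearMap.compL ℝ E E' ℝ).flip x.1) :=
    (ContinuousLinearMap.contDiff _).comp contDiff_fst
  exact h1.clm_comp (contDiff_snd.clm_comp contDiff_fst)

theorem contMDiffAt_pullbackForm {A : N → E →L[ℝ] E'} {B : N → E' →L[ℝ] E' →L[ℝ] ℝ} {p : N}
    (hA : ContMDiffAt I 𝓘(ℝ, E →L[ℝ] E') ∞ A p)
    (hB : ContMDiffAt I 𝓘(ℝ, E' →L[ℝ] E' →L[ℝ] ℝ) ∞ B p) :
    ContMDiffAt I 𝓘(ℝ, E →L[ℝ] E →L[ℝ] ℝ) ∞ (fun q ↦ pullbackForm (A q) (B q)) p :=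
  ContDiffAt.comp_contMDiffAt (f := fun q ↦ (A q, B q)) (x := p)
    (contDiff_pullbackForm (E := E) (E' := E')).contDiffAt (hA.prodMk_space hB)

variable (I I') in
/-- The pullback `(f^* g)_p (v, w) = g_{f p} (df_p v, df_p w)` of a covariant 2-tensor field. -/
def pullbackTensor (f : N → N')
    (g : ∀ q : N', TangentSpace I' q →L[ℝ] TangentSpace I' q →L[ℝ] ℝ) (p : N) :
    TangentSpace I p →L[ℝ] TangentSpace I p →L[ℝ] ℝ :=
  pullbackForm (E := E) (E' := E') (mfderiv I I' f p) (g (f p))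

theorem pullbackTensor_apply (f : N → N')
    (g : ∀ q : N', TangentSpace I' q →L[ℝ] TangentSpace I' q →L[ℝ] ℝ) (p : N)
    (v w : TangentSpace I p) :
    pullbackTensor I I' f g p v w = g (f p) (mfderiv I I' f p v) (mfderiv I I' f p w) := rfl

theorem contMDiff_pullbackTensor [IsManifold I ∞ N] [IsManifold I' ∞ N'] {f : N → N'}
    (hf : ContMDiff I I' ∞ f)
    {g : ∀ q : N', TangentSpace I' q →L[ℝ] TangentSpace I' q →L[ℝ] ℝ}
    (hg : ContMDiff I' (I'.prod 𝓘(ℝ, E' →L[ℝ] E' →L[ℝ] ℝ)) ∞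
      (fun q ↦ TotalSpace.mk' (E' →L[ℝ] E' →L[ℝ] ℝ) q (g q))) :
    ContMDiff I (I.prod 𝓘(ℝ, E →L[ℝ] E →L[ℝ] ℝ)) ∞
      (fun p ↦ TotalSpace.mk' (E →L[ℝ] E →L[ℝ] ℝ) p (pullbackTensor I I' f g p)) := by
  intro p₀
  rw [contMDiffAt_hom_bundle]
  refine ⟨contMDiffAt_id, ?_⟩
  have hA := (hf p₀).mfderiv_const (m := ∞) (by simp)
  have hB := ((contMDiffAt_hom_bundle _).1 (hg (f p₀))).2
  have hB' := ContMDiffAt.comp p₀ hB (hf p₀)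
  have hS : ContMDiffAt I 𝓘(ℝ, E →L[ℝ] E →L[ℝ] ℝ) ∞ (fun p ↦ pullbackForm
      (inTangentCoordinates I I' id f (mfderiv I I' f) p₀ p)
      (ContinuousLinearMap.inCoordinates E' (TangentSpace I') (E' →L[ℝ] ℝ)
        (fun q ↦ TangentSpace I' q →L[ℝ] ℝ) (f p₀) (f p) (f p₀) (f p) (g (f p)))) p₀ := by
    exact contMDiffAt_pullbackForm hA hB'
  refine hS.congr_of_eventuallyEq ?_
  have h1 : ∀ᶠ p in 𝓝 p₀, p ∈ (trivializationAt E (TangentSpace I) p₀).baseSet :=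
    (trivializationAt E (TangentSpace I) p₀).open_baseSet.mem_nhds
      (FiberBundle.mem_baseSet_trivializationAt' p₀)
  have h2 : ∀ᶠ p in 𝓝 p₀, f p ∈ (trivializationAt E' (TangentSpace I') (f p₀)).baseSet :=
    hf.continuous.continuousAt.eventually
      ((trivializationAt E' (TangentSpace I') (f p₀)).open_baseSet.mem_nhds
      (FiberBundle.mem_baseSet_trivializationAt' (f p₀)))
  filter_upwards [h1, h2] with p hp hfp
  ext v w
  rw [pullbackForm_apply, inCoordinates_apply_eq₂ hfp hfp (mem_univ _),
    inCoordinates_apply_eq₂ hp hp (mem_univ _), pullbackTensor_apply]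
  have key : ∀ v : E, (trivializationAt E' (TangentSpace I') (f p₀)).symm (f p)
      (inTangentCoordinates I I' id f (mfderiv I I' f) p₀ p v)
      = mfderiv I I' f p ((trivializationAt E (TangentSpace I) p₀).symm p v) := by
    intro v
    have e := ContinuousLinearMap.inCoordinates_eq (F := E) (E := TangentSpace I) (F' := E')
      (E' := TangentSpace I') (ϕ := mfderiv I I' f p) hp hfp
    change (trivializationAt E' (TangentSpace I') (f p₀)).symm (f p)
      (ContinuousLinearMap.inCoordinates E (TangentSpace I) E' (TangentSpace I') p₀ p (f p₀) (f p)
        (mfderiv I I' f p) v) = _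
    rw [e]
    simp [Trivialization.symm_apply_apply_mk _ hfp]
  rw [key, key]
  rfl

end Pullback

theorem isVonNBounded_of_pos {E : Type*} [NormedAddCommGroup E] [NormedSpace ℝ E]
    [FiniteDimensional ℝ E] (B : E →L[ℝ] E →L[ℝ] ℝ) (hB : ∀ v, v ≠ 0 → 0 < B v v) :
    Bornology.IsVonNBounded ℝ {v : E | B v v < 1} := by
  have hc : IsCompact (Metric.sphere (0 : E) 1) := isCompact_sphere 0 1
  have hcont : Continuous fun v : E ↦ B v v := by fun_prop
  obtain ⟨c, hc0, hcB⟩ : ∃ c > 0, ∀ v ∈ Metric.sphere (0 : E) 1, c ≤ B v v := by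
    rcases (Metric.sphere (0 : E) 1).eq_empty_or_nonempty with h | h
    · exact ⟨1, one_pos, by simp [h]⟩
    · obtain ⟨v, hv, hmin⟩ := hc.exists_isMinOn h hcont.continuousOn
      refine ⟨B v v, hB v ?_, fun w hw ↦ hmin hw⟩
      rintro rfl
      simp at hv
  rw [NormedSpace.isVonNBounded_iff']
  refine ⟨√(1 / c), fun v hv ↦ Real.le_sqrt_of_sq_le ?_⟩
  rw [le_div_iff₀ hc0]
  rcases eq_or_ne v 0 with rfl | hv0
  · simp
  have hn : 0 < ‖v‖ := norm_pos_iff.2 hv0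
  have h := hcB (‖v‖⁻¹ • v) (by simp [norm_smul, hn.ne'])
  simp only [map_smul, smul_eq_mul, smul_apply] at h
  have hv' : B v v < 1 := hv
  have : ‖v‖ ^ 2 * c ≤ ‖v‖ ^ 2 * (‖v‖⁻¹ * (‖v‖⁻¹ * B v v)) := by gcongr
  have e : ‖v‖ ^ 2 * (‖v‖⁻¹ * (‖v‖⁻¹ * B v v)) = B v v := by field_simp
  linarith


section Product
variable {E₁ : Type*} [NormedAddCommGroup E₁] [NormedSpace ℝ E₁]
  {H₁ : Type*} [TopologicalSpace H₁] {I₁ : ModelWithCorners ℝ E₁ H₁}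
  {M₁ : Type*} [TopologicalSpace M₁] [ChartedSpace H₁ M₁] [IsManifold I₁ ∞ M₁]
  {E₂ : Type*} [NormedAddCommGroup E₂] [NormedSpace ℝ E₂]
  {H₂ : Type*} [TopologicalSpace H₂] {I₂ : ModelWithCorners ℝ E₂ H₂}
  {M₂ : Type*} [TopologicalSpace M₂] [ChartedSpace H₂ M₂] [IsManifold I₂ ∞ M₂]

theorem add_pullback_pos
    (g₁ : ContMDiffRiemannianMetric I₁ ∞ E₁ (fun x : M₁ ↦ TangentSpace I₁ x))
    (g₂ : ContMDiffRiemannianMetric I₂ ∞ E₂ (fun x : M₂ ↦ TangentSpace I₂ x))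
    (p : M₁ × M₂) (v : TangentSpace (I₁.prod I₂) p) (hv : v ≠ 0) :
    0 < (pullbackTensor (I₁.prod I₂) I₁ Prod.fst g₁.inner p
      + pullbackTensor (I₁.prod I₂) I₂ Prod.snd g₂.inner p) v v := by
  rw [add_apply, add_apply, pullbackTensor_apply, pullbackTensor_apply,
    mfderiv_fst, mfderiv_snd]
  have n1 : ∀ w : TangentSpace I₁ p.1, 0 ≤ g₁.inner p.1 w w := fun w ↦ by
    rcases eq_or_ne w 0 with rfl | hw
    · simp
    · exact (g₁.pos _ _ hw).le
  have n2 : ∀ w : TangentSpace I₂ p.2, 0 ≤ g₂.inner p.2 w w := fun w ↦ by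
    rcases eq_or_ne w 0 with rfl | hw
    · simp
    · exact (g₂.pos _ _ hw).le
  by_cases h1 : (show E₁ × E₂ from v).1 = 0
  · have h2 : (show E₁ × E₂ from v).2 ≠ 0 := fun h2 ↦ hv (Prod.ext h1 h2)
    exact add_pos_of_nonneg_of_pos (n1 _) (g₂.pos p.2 _ h2)
  · exact add_pos_of_pos_of_nonneg (g₁.pos p.1 _ h1) (n2 _)

/-- The Riemannian product metric on `M₁ × M₂`. -/
def productMetric [FiniteDimensional ℝ E₁] [FiniteDimensional ℝ E₂]
    (g₁ : ContMDiffRiemannianMetric I₁ ∞ E₁ (fun x : M₁ ↦ TangentSpace I₁ x))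
    (g₂ : ContMDiffRiemannianMetric I₂ ∞ E₂ (fun x : M₂ ↦ TangentSpace I₂ x)) :
    ContMDiffRiemannianMetric (I₁.prod I₂) ∞ (E₁ × E₂)
      (fun x : M₁ × M₂ ↦ TangentSpace (I₁.prod I₂) x) where
  inner p := pullbackTensor (I₁.prod I₂) I₁ Prod.fst g₁.inner p
      + pullbackTensor (I₁.prod I₂) I₂ Prod.snd g₂.inner p
  symm p v w := by
    rw [add_apply, add_apply, add_apply, add_apply]
    simp only [pullbackTensor_apply]
    rw [g₁.symm, g₂.symm]
  pos p v hv := add_pullback_pos g₁ g₂ p v hv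
  isVonNBounded p := isVonNBounded_of_pos (E := E₁ × E₂) _ (add_pullback_pos g₁ g₂ p)
  contMDiff := by
    have : ∀ x : M₁ × M₂, ContinuousAdd (TangentSpace (I₁.prod I₂) x →L[ℝ] ℝ) :=
      fun x ↦ inferInstanceAs (ContinuousAdd ((E₁ × E₂) →L[ℝ] ℝ))
    exact (contMDiff_pullbackTensor contMDiff_fst g₁.contMDiff).add_section
      (contMDiff_pullbackTensor contMDiff_snd g₂.contMDiff)

theorem productMetric_inner_apply [FiniteDimensional ℝ E₁] [FiniteDimensional ℝ E₂]
    (g₁ : ContMDiffRiemannianMetric I₁ ∞ E₁ (fun x : M₁ ↦ TangentSpace I₁ x))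
    (g₂ : ContMDiffRiemannianMetric I₂ ∞ E₂ (fun x : M₂ ↦ TangentSpace I₂ x))
    (p : M₁ × M₂) (v w : TangentSpace (I₁.prod I₂) p) :
    (productMetric g₁ g₂).inner p v w
      = g₁.inner p.1 (show E₁ × E₂ from v).1 (show E₁ × E₂ from w).1
        + g₂.inner p.2 (show E₁ × E₂ from v).2 (show E₁ × E₂ from w).2 := by
  change (pullbackTensor (I₁.prod I₂) I₁ Prod.fst g₁.inner p
      + pullbackTensor (I₁.prod I₂) I₂ Prod.snd g₂.inner p) v w = _
  rw [add_apply, add_apply, pullbackTensor_apply, pullbackTensor_apply,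
    mfderiv_fst, mfderiv_snd]
  rfl

end Product

section Circle

theorem contMDiff_circle_coe : ContMDiff (𝓡 1) 𝓘(ℝ, ℂ) ∞ (fun z : Circle ↦ (z : ℂ)) :=
  have := finrank_real_complex_fact'
  contMDiff_coe_sphere (n := 1) (E := ℂ)

theorem mfderiv_circle_coe_injective (z : Circle) :
    Function.Injective (mfderiv (𝓡 1) 𝓘(ℝ, ℂ) (fun z : Circle ↦ (z : ℂ)) z) :=
  have := finrank_real_complex_fact'
  injective_mvfderiv_subtypeVal_sphere (n := 1) (E := ℂ) z

theorem circle_pos (z : Circle) (v : TangentSpace (𝓡 1) z) (hv : v ≠ 0) :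
    0 < pullbackTensor (𝓡 1) 𝓘(ℝ, ℂ) (fun z : Circle ↦ (z : ℂ))
      (riemannianMetricVectorSpace ℂ).inner z v v := by
  rw [pullbackTensor_apply]
  refine (riemannianMetricVectorSpace ℂ).pos _ _ fun h ↦ hv ?_
  exact mfderiv_circle_coe_injective z (h.trans (map_zero _).symm)

/-- The metric of the unit circle `S¹ ⊆ ℂ`, induced from the Euclidean metric of `ℂ`. -/
def circleMetric :
    ContMDiffRiemannianMetric (𝓡 1) ∞ (EuclideanSpace ℝ (Fin 1))
      (fun z : Circle ↦ TangentSpace (𝓡 1) z) where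
  inner := pullbackTensor (𝓡 1) 𝓘(ℝ, ℂ) (fun z : Circle ↦ (z : ℂ))
      (riemannianMetricVectorSpace ℂ).inner
  symm z v w := by
    rw [pullbackTensor_apply, pullbackTensor_apply]
    exact (riemannianMetricVectorSpace ℂ).symm _ _ _
  pos := circle_pos
  isVonNBounded z := isVonNBounded_of_pos (E := EuclideanSpace ℝ (Fin 1)) _ (circle_pos z)
  contMDiff := contMDiff_pullbackTensor contMDiff_circle_coe
    ((riemannianMetricVectorSpace ℂ).contMDiff.of_le le_top)

end Circle

section Energy
variable {E : Type*} [NormedAddCommGroup E] [NormedSpace ℝ E] [FiniteDimensional ℝ E]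
  {H : Type*} [TopologicalSpace H] {I : ModelWithCorners ℝ E H}
  {N : Type*} [TopologicalSpace N] [ChartedSpace H N] [IsManifold I ∞ N]

theorem flat_bijective (B : E →L[ℝ] E →L[ℝ] ℝ) (hB : ∀ v, v ≠ 0 → 0 < B v v) :
    Function.Bijective B := by
  have hinj : Function.Injective B.toLinearMap := by
    rw [injective_iff_map_eq_zero]
    intro v hv
    by_contra h
    have h1 := hB v h
    have h2 : B v = 0 := hv
    rw [h2] at h1
    simp at h1
  have hdim : Module.finrank ℝ E = Module.finrank ℝ (E →L[ℝ] ℝ) := by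
    rw [← (LinearMap.toContinuousLinearMap (𝕜 := ℝ) (E := E) (F' := ℝ)).finrank_eq]
    exact (Subspace.dual_finrank_eq (K := ℝ) (V := E)).symm
  exact ⟨hinj, (LinearMap.injective_iff_surjective_of_finrank_eq_finrank hdim).1 hinj⟩

/-- The isomorphism `v ↦ g_p (v, ·)` from the tangent space at `p` to its dual. -/
def flat (g : ContMDiffRiemannianMetric I ∞ E (fun x : N ↦ TangentSpace I x)) (p : N) :
    TangentSpace I p ≃ₗ[ℝ] (TangentSpace I p →L[ℝ] ℝ) :=
  LinearEquiv.ofBijective (g.inner p).toLinearMap (flat_bijective (E := E) (g.inner p) (g.pos p))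

/-- The Riemannian gradient `∇u` at `p`: the vector with `g_p (∇u, v) = du_p v` for all `v`. -/
def riemannianGradient (g : ContMDiffRiemannianMetric I ∞ E (fun x : N ↦ TangentSpace I x))
    (u : N → ℝ) (p : N) : TangentSpace I p :=
  (flat g p).symm (mfderiv I 𝓘(ℝ, ℝ) u p)

theorem inner_riemannianGradient (g : ContMDiffRiemannianMetric I ∞ E (fun x : N ↦ TangentSpace I x))
    (u : N → ℝ) (p : N) (v : TangentSpace I p) :
    g.inner p (riemannianGradient g u p) v = mfderiv I 𝓘(ℝ, ℝ) u p v :=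
  DFunLike.congr_fun ((flat g p).apply_symm_apply (mfderiv I 𝓘(ℝ, ℝ) u p)) v

/-- The density `√(det (g_{ij}))` of the Riemannian volume in the preferred chart at `x₀`, at the
point `y` of the model space, with respect to a fixed basis `b` of the model space; here
`g_{ij} = g (∂ᵢ, ∂ⱼ)` and `∂ᵢ` is the image of `b i` under the differential of the inverse chart. -/
def volumeDensity (g : ContMDiffRiemannianMetric I ∞ E (fun x : N ↦ TangentSpace I x))
    (x₀ : N) (y : E) : ℝ :=
  √(Matrix.of fun i j ↦ g.inner ((extChartAt I x₀).symm y)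
      (mfderivWithin 𝓘(ℝ, E) I (extChartAt I x₀).symm (range I) y (Module.finBasis ℝ E i))
      (mfderivWithin 𝓘(ℝ, E) I (extChartAt I x₀).symm (range I) y (Module.finBasis ℝ E j))).det

variable [MeasurableSpace E] [BorelSpace E]

/-- The Riemannian volume on the domain of the preferred chart at `x₀`, extended by zero: the
image under the inverse chart of `√(det (g_{ij})) dy`, where `dy` is the Lebesgue measure that
gives mass one to the parallelepiped of the basis used for `g_{ij}`. -/
def chartVolume (g : ContMDiffRiemannianMetric I ∞ E (fun x : N ↦ TangentSpace I x))
    (x₀ : N) : @Measure N (borel N) :=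
  letI : MeasurableSpace N := borel N
  (((Module.finBasis ℝ E).addHaar.restrict (extChartAt I x₀).target).withDensity
    (fun y ↦ ENNReal.ofReal (volumeDensity g x₀ y))).map (extChartAt I x₀).symm

/-- The Riemannian volume measure. By the change of variables formula the measures
`chartVolume g x₀` agree on the overlaps of the chart domains, so that their supremum in the lattice
of measures is the measure that restricts to each of them on its chart domain. -/
def riemannianVolume (g : ContMDiffRiemannianMetric I ∞ E (fun x : N ↦ TangentSpace I x)) :
    @Measure N (borel N) :=
  letI : MeasurableSpace N := borel N
  ⨆ x₀ : N, chartVolume g x₀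

/-- The van der Waals--Cahn--Hilliard energy
`E_ε(u) = ∫_N (ε |∇u|² / 2 + ε⁻¹ W(u)) dμ_g`. -/
def energy (g : ContMDiffRiemannianMetric I ∞ E (fun x : N ↦ TangentSpace I x))
    (W : ℝ → ℝ) (ε : ℝ) (u : N → ℝ) : ℝ :=
  letI : MeasurableSpace N := borel N
  ∫ p, (1 / 2 * ε * g.inner p (riemannianGradient g u p) (riemannianGradient g u p) + ε⁻¹ * W (u p))
    ∂(riemannianVolume g)

/-- A double-well phase transition with potential `W` and parameter `ε` on a closed Riemannian
manifold `(N, g)`: a smooth function with values in `[-1, 1]` that is a critical point of `E_ε`,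
that is, whose first variation vanishes in the direction of every smooth function. -/
structure IsPhaseTransition (g : ContMDiffRiemannianMetric I ∞ E (fun x : N ↦ TangentSpace I x))
    (W : ℝ → ℝ) (ε : ℝ) (u : N → ℝ) : Prop where
  smooth : ContMDiff I 𝓘(ℝ, ℝ) ∞ u
  mem_Icc : ∀ p, u p ∈ Icc (-1 : ℝ) 1
  critical : ∀ φ : N → ℝ, ContMDiff I 𝓘(ℝ, ℝ) ∞ φ →
    HasDerivAt (fun t : ℝ ↦ energy g W ε (fun p ↦ u p + t * φ p)) 0 0

end Energy

section Distance
variable {E : Type*} [NormedAddCommGroup E] [NormedSpace ℝ E]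
  {H : Type*} [TopologicalSpace H] {I : ModelWithCorners ℝ E H}
  {N : Type*} [TopologicalSpace N] [ChartedSpace H N] [IsManifold I ∞ N] [T3Space N]

/-- The Hausdorff distance of two subsets of `N`, for the Riemannian distance of `g` (the infimum
of the lengths of paths). It is infinite if exactly one of the two sets is empty. -/
def riemannianHausdorffEDist
    (g : ContMDiffRiemannianMetric I ∞ E (fun x : N ↦ TangentSpace I x)) (A B : Set N) : ℝ≥0∞ :=
  letI : RiemannianBundle (fun x : N ↦ TangentSpace I x) :=
    ⟨g.toContinuousRiemannianMetric.toRiemannianMetric⟩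
  letI : EMetricSpace N := EMetricSpace.ofRiemannianMetric I N
  Metric.hausdorffEDist A B

end Distance

/-- Double-well potentials. Monotonicity of `W'(x) / x` is meant in the weak sense, which includes
the case of strict monotonicity. -/
structure IsDoubleWell (W : ℝ → ℝ) : Prop where
  smooth : ContDiff ℝ ∞ W
  nonneg : ∀ x, 0 ≤ W x
  eq_zero_iff : ∀ x, W x = 0 ↔ x = 1 ∨ x = -1
  even : ∀ x, W x = W (-x)
  deriv_two_pos : 0 < iteratedDeriv 2 W 1 ∧ 0 < iteratedDeriv 2 W (-1)
  monotoneOn : MonotoneOn (fun x ↦ deriv W x / x) (Ioo 0 1)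
  antitoneOn : AntitoneOn (fun x ↦ deriv W x / x) (Ioo (-1) 0)

end
end PhaseTransition

open PhaseTransition

/-!
The argument uses the equation `Δu = ε⁻² W'(u)` only in its weak form `∫ g(∇u, ∇φ) = -ε⁻² ∫ W'(u) φ`
(`IsPhaseTransition.weakLaplacian`), and only one tool, a weak maximum principle
(`WeakLaplacian.exists_frontier_le`): a function whose weak Laplacian is negative at its interior
minimum points attains its minimum on the boundary. All comparison functions depend on the angle
`t ∈ S¹` alone; their weak Laplacian is their second derivative (`weakLaplacian_comp_fst`), because
the volume is invariant under rotations. That invariance, the finiteness and the positivity on open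
sets of the Riemannian volume come from the change of variables formula
(`volumeDensity_comp`, `chartVolume_preimage_le`).

*Reflection.* Suppose that, over a clopen part `M₀` of `M`, `u` is positive on an arc of angles
`(0, l]` with `l < π`, is positive at the angle `-l`, and has a zero at the angle `0`. Let
`z(t) = u(t) + u(-t)`. If `z` were negative somewhere, a multiple `λ u` with `λ > 1` would touch
`-u(-t)` from above; since `W'(x) / x` is increasing, `λ u` is a supersolution, and the strong
maximum principle forbids this (`IsPhaseTransition.add_reflect_nonneg`; it is applied to the
reflections at small positive angles and then passes to the limit). So `z ≥ 0`, and `Δz ≤ C z` as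
`W'` is Lipschitz. By the Hopf lemma the derivative of `z` at its zero is positive, but `z` is even
in `t` (`IsPhaseTransition.ne_zero_of_reflect`). The strong maximum principle and the Hopf lemma
take the form of one barrier estimate, `WeakLaplacian.exists_barrier_le`. It is here that `l < π`
matters: `sin (t - l / 2)` has no critical point on `[0, l]`.

*Position of the nodal slices.* If the slices over `θ₁` and `θ₂` were at an angle `a < π`
(possibly `a = 0`), then on the long arc, of length `2π - a`, the sign of `u` over each component
of `M` is constant. The reflection across a zero near one end of this arc, with
`l = (a + π) / 2`, stays inside it on both sides, which is a contradiction
(`IsPhaseTransition.false_of_nodalNear`). So `θ₂ = -θ₁`. If `u` had the same sign on both arcs over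
some component, the reflection with `l = π / 2` would again give a contradiction; hence the signs
alternate (`IsPhaseTransition.neg_of_pos`).

*Convergence.* Where `u` is positive on a slab of fixed width and `ε` is small, `u` is close to `1` in
the middle of the slab, by comparison with multiples of `cos (k t)`
(`IsPhaseTransition.le_of_pos_slab`). Together with the alternation of the signs this is the
claimed limit.
-/

namespace PhaseTransition
noncomputable section

/-! ### Volume densities in charts -/

section Gram
variable {E : Type*} [NormedAddCommGroup E] [NormedSpace ℝ E] [FiniteDimensional ℝ E]

/-- The Gram determinant of `B` in the basis `b`. -/
def gramDet {ι : Type*} [Fintype ι] [DecidableEq ι] (b : ι → E) (B : E →L[ℝ] E →L[ℝ] ℝ) : ℝ :=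
  (Matrix.of fun i j ↦ B (b i) (b j)).det

omit [FiniteDimensional ℝ E] in
theorem gramDet_pullbackForm {ι : Type*} [Fintype ι] [DecidableEq ι] (b : Module.Basis ι ℝ E)
    (B : E →L[ℝ] E →L[ℝ] ℝ) (A : E →L[ℝ] E) :
    gramDet b (pullbackForm A B) = A.det ^ 2 * gramDet b B := by
  let B' : LinearMap.BilinForm ℝ E := LinearMap.mk₂ ℝ (fun v w ↦ B v w) (by simp) (by simp)
    (by simp) (by simp)
  have h := LinearMap.BilinForm.toMatrix_comp (R₁ := ℝ) b b B' (A : E →ₗ[ℝ] E) (A : E →ₗ[ℝ] E)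
  have h1 : (Matrix.of fun i j ↦ pullbackForm A B (b i) (b j))
      = LinearMap.BilinForm.toMatrix b (B'.comp (A : E →ₗ[ℝ] E) (A : E →ₗ[ℝ] E)) := by
    ext i j
    simp [B', pullbackForm_apply, LinearMap.BilinForm.toMatrix_apply]
  have h2 : (Matrix.of fun i j ↦ B (b i) (b j)) = LinearMap.BilinForm.toMatrix b B' := by
    ext i j
    simp [B', LinearMap.BilinForm.toMatrix_apply]
  rw [gramDet, gramDet, h1, h2, h, Matrix.det_mul, Matrix.det_mul, Matrix.det_transpose,
    LinearMap.det_toMatrix]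
  change LinearMap.det (A : E →ₗ[ℝ] E) * _ * LinearMap.det (A : E →ₗ[ℝ] E)
    = LinearMap.det (A : E →ₗ[ℝ] E) ^ 2 * _
  ring

omit [FiniteDimensional ℝ E] in
theorem gramDet_pos {ι : Type*} [Fintype ι] [DecidableEq ι] (b : Module.Basis ι ℝ E)
    (B : E →L[ℝ] E →L[ℝ] ℝ) (hs : ∀ v w, B v w = B w v) (hB : ∀ v, v ≠ 0 → 0 < B v v) :
    0 < gramDet b B := by
  have : (Matrix.of fun i j ↦ B (b i) (b j)).PosDef := by
    refine Matrix.PosDef.of_dotProduct_mulVec_pos ?_ ?_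
    · ext i j
      simp [hs (b i)]
    · intro x hx
      have h0 : ∑ i, x i • b i ≠ 0 := by
        intro h
        apply hx
        ext i
        have := congrArg (fun v ↦ b.repr v i) h
        rw [b.repr_sum_self] at this
        simpa using this
      have := hB _ h0
      simp only [map_sum, map_smul, sum_apply, smul_apply, smul_eq_mul] at this
      simp only [Finset.mul_sum] at this
      rw [Finset.sum_comm] at this
      simpa [dotProduct, Matrix.mulVec, Finset.mul_sum, mul_comm, mul_left_comm] using this
  exact this.det_pos

end Gram

section Volume
variable {E : Type*} [NormedAddCommGroup E] [NormedSpace ℝ E] [FiniteDimensional ℝ E]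
  {H : Type*} [TopologicalSpace H] {I : ModelWithCorners ℝ E H}
  {N : Type*} [TopologicalSpace N] [ChartedSpace H N] [IsManifold I ∞ N]

/-- The metric `g` at `p` in the preferred chart at `x₀`, as a bilinear form on the model space: the
pullback of `g` by the trivialization of the tangent bundle. On the chart domain that is the
differential of the inverse chart. -/
def coordMetric (g : ContMDiffRiemannianMetric I ∞ E (fun x : N ↦ TangentSpace I x))
    (x₀ : N) (p : N) : E →L[ℝ] E →L[ℝ] ℝ :=
  pullbackForm (E := E) (E' := E) ((trivializationAt E (TangentSpace I) x₀).symmL ℝ p) (g.inner p)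

omit [FiniteDimensional ℝ E] in
theorem coordMetric_apply (g : ContMDiffRiemannianMetric I ∞ E (fun x : N ↦ TangentSpace I x))
    (x₀ p : N) (v w : E) :
    coordMetric g x₀ p v w = g.inner p ((trivializationAt E (TangentSpace I) x₀).symmL ℝ p v)
      ((trivializationAt E (TangentSpace I) x₀).symmL ℝ p w) := rfl

omit [FiniteDimensional ℝ E] in
theorem continuousAt_coordMetric
    (g : ContMDiffRiemannianMetric I ∞ E (fun x : N ↦ TangentSpace I x)) (x₀ : N) :
    ContinuousAt (coordMetric g x₀) x₀ := by
  have h := ((contMDiffAt_hom_bundle _).1 (g.contMDiff x₀)).2.continuousAt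
  refine h.congr ?_
  have h1 : ∀ᶠ p in 𝓝 x₀, p ∈ (trivializationAt E (TangentSpace I) x₀).baseSet :=
    (trivializationAt E (TangentSpace I) x₀).open_baseSet.mem_nhds
      (FiberBundle.mem_baseSet_trivializationAt' x₀)
  filter_upwards [h1] with p hp
  ext v w
  rw [inCoordinates_apply_eq₂ hp hp (mem_univ _)]
  change (Bundle.Trivial.trivialization N ℝ).linearMapAt ℝ p _ = _
  rw [Bundle.Trivial.linearMapAt_trivialization, coordMetric_apply,
    Trivialization.symmL_apply _ hp, Trivialization.symmL_apply _ hp]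
  rfl

variable [I.Boundaryless]

omit [FiniteDimensional ℝ E] in
theorem hasMFDerivAt_extChartAt_symm {x₀ : N} {y : E} (hy : y ∈ (extChartAt I x₀).target) :
    HasMFDerivAt 𝓘(ℝ, E) I (extChartAt I x₀).symm y
      (mfderivWithin 𝓘(ℝ, E) I (extChartAt I x₀).symm (range I) y) := by
  have : IsManifold I 1 N := IsManifold.of_le (n := ∞) (by simp)
  have h := (mdifferentiableWithinAt_extChartAt_symm (I := I) hy).hasMFDerivWithinAt
  rw [I.range_eq_univ] at h ⊢
  exact h.hasMFDerivAt univ_mem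

omit [I.Boundaryless] in
theorem volumeDensity_eq (g : ContMDiffRiemannianMetric I ∞ E (fun x : N ↦ TangentSpace I x))
    {x₀ : N} {y : E} (hy : y ∈ (extChartAt I x₀).target) :
    volumeDensity g x₀ y
      = √(gramDet (Module.finBasis ℝ E) (coordMetric g x₀ ((extChartAt I x₀).symm y))) := by
  have : IsManifold I 1 N := IsManifold.of_le (n := ∞) (by simp)
  have hx : (extChartAt I x₀).symm y ∈ (chartAt H x₀).source := by
    have := (extChartAt I x₀).map_target hy
    rwa [extChartAt_source] at this
  have h := TangentBundle.symmL_trivializationAt (𝕜 := ℝ) (I := I) hx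
  rw [(extChartAt I x₀).right_inv hy] at h
  unfold volumeDensity gramDet coordMetric
  congr 3
  ext i j
  have h' (v : E) := DFunLike.congr_fun h.symm v
  exact congr_arg₂ (fun v w : E ↦ g.inner ((extChartAt I x₀).symm y) v w) (h' _) (h' _)

/-- The density of the volume in the chart at `x₀` is continuous at the centre of that chart. -/
theorem continuousAt_volumeDensity
    (g : ContMDiffRiemannianMetric I ∞ E (fun x : N ↦ TangentSpace I x)) (x₀ : N) :
    ContinuousAt (volumeDensity g x₀) (extChartAt I x₀ x₀) := by
  have hT : ∀ᶠ y in 𝓝 (extChartAt I x₀ x₀), y ∈ (extChartAt I x₀).target :=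
    extChartAt_target_mem_nhds x₀
  have h1 : ContinuousAt (fun B : E →L[ℝ] E →L[ℝ] ℝ ↦ √(gramDet (Module.finBasis ℝ E) B))
      (coordMetric g x₀ x₀) := by
    refine Continuous.continuousAt (Real.continuous_sqrt.comp ?_)
    unfold gramDet
    refine Continuous.matrix_det (continuous_matrix fun i j ↦ ?_)
    simp only [Matrix.of_apply]
    fun_prop
  have h2 : ContinuousAt (fun y ↦ coordMetric g x₀ ((extChartAt I x₀).symm y))
      (extChartAt I x₀ x₀) := by
    exact ContinuousAt.comp_of_eq (g := coordMetric g x₀) (continuousAt_coordMetric g x₀)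
      (continuousAt_extChartAt_symm x₀) (by simp)
  have h3 := ContinuousAt.comp_of_eq h1 h2 (by simp)
  refine h3.congr ?_
  filter_upwards [hT] with y hy
  exact (volumeDensity_eq g hy).symm

/-- The differential of the inverse chart, as an endomorphism of the model space. -/
def chartFrame (I : ModelWithCorners ℝ E H) (x₀ : N) (y : E) : E →L[ℝ] E :=
  mfderivWithin 𝓘(ℝ, E) I (extChartAt I x₀).symm (range I) y

omit [I.Boundaryless] in
theorem volumeDensity_def (g : ContMDiffRiemannianMetric I ∞ E (fun x : N ↦ TangentSpace I x))
    (x₀ : N) (y : E) :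
    volumeDensity g x₀ y = √(gramDet (Module.finBasis ℝ E)
      (pullbackForm (chartFrame I x₀ y) (g.inner ((extChartAt I x₀).symm y)))) := rfl

omit [I.Boundaryless] in
theorem volumeDensity_pos (g : ContMDiffRiemannianMetric I ∞ E (fun x : N ↦ TangentSpace I x))
    {x₀ : N} {y : E} (hy : y ∈ (extChartAt I x₀).target) : 0 < volumeDensity g x₀ y := by
  have : IsManifold I 1 N := IsManifold.of_le (n := ∞) (by simp)
  have hD : Function.Injective (chartFrame I x₀ y) :=
    (isInvertible_mfderivWithin_extChartAt_symm hy).injective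
  rw [volumeDensity_def]
  refine Real.sqrt_pos.2 (gramDet_pos (Module.finBasis ℝ E)
    (pullbackForm (chartFrame I x₀ y) (g.inner ((extChartAt I x₀).symm y))) (fun v w ↦ ?_)
    fun v hv ↦ ?_)
  · exact g.symm ((extChartAt I x₀).symm y) (chartFrame I x₀ y v) (chartFrame I x₀ y w)
  · exact g.pos ((extChartAt I x₀).symm y) (chartFrame I x₀ y v)
      fun h ↦ hv (hD (h.trans (map_zero _).symm))

/-- Change of variables: an isometry `Φ` multiplies the density by the Jacobian of its coordinate
expression. -/
theorem volumeDensity_comp (g : ContMDiffRiemannianMetric I ∞ E (fun x : N ↦ TangentSpace I x))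
    {Φ : N → N} (hΦ : MDifferentiable I I Φ)
    (hiso : ∀ p v w, g.inner (Φ p) (mfderiv I I Φ p v) (mfderiv I I Φ p w) = g.inner p v w)
    {x₀ x₁ : N} {y : E} (hy : y ∈ (extChartAt I x₀).target)
    (hy' : Φ ((extChartAt I x₀).symm y) ∈ (extChartAt I x₁).source) :
    ∃ A : E →L[ℝ] E, HasFDerivAt (extChartAt I x₁ ∘ Φ ∘ (extChartAt I x₀).symm) A y ∧
      volumeDensity g x₀ y
        = |A.det| * volumeDensity g x₁ (extChartAt I x₁ (Φ ((extChartAt I x₀).symm y))) := by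
  have : IsManifold I 1 N := IsManifold.of_le (n := ∞) (by simp)
  have h0 := hasMFDerivAt_extChartAt_symm hy
  have h1 := (hΦ ((extChartAt I x₀).symm y)).hasMFDerivAt
  have h2 : HasMFDerivAt I 𝓘(ℝ, E) (extChartAt I x₁) (Φ ((extChartAt I x₀).symm y))
      (mfderiv I 𝓘(ℝ, E) (extChartAt I x₁) (Φ ((extChartAt I x₀).symm y))) :=
    (mdifferentiableAt_extChartAt (by rwa [extChartAt_source] at hy')).hasMFDerivAt
  have h3 := h2.comp y (h1.comp y h0)
  have h4 := mfderivWithin_extChartAt_symm_comp_mfderiv_extChartAt' hy'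
  obtain ⟨A, hA, hAv⟩ : ∃ A : E →L[ℝ] E,
      HasFDerivAt (extChartAt I x₁ ∘ Φ ∘ (extChartAt I x₀).symm) A y ∧
      ∀ v : E, chartFrame I x₁ (extChartAt I x₁ (Φ ((extChartAt I x₀).symm y))) (A v)
        = mfderiv I I Φ ((extChartAt I x₀).symm y) (chartFrame I x₀ y v) :=
    ⟨_, h3.hasFDerivAt, fun v ↦ DFunLike.congr_fun h4
      (mfderiv I I Φ ((extChartAt I x₀).symm y) (chartFrame I x₀ y v))⟩
  refine ⟨A, hA, ?_⟩
  have h5 := (extChartAt I x₁).left_inv hy'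
  have key : pullbackForm (chartFrame I x₀ y) (g.inner ((extChartAt I x₀).symm y))
      = pullbackForm A (pullbackForm
        (chartFrame I x₁ (extChartAt I x₁ (Φ ((extChartAt I x₀).symm y))))
        (g.inner ((extChartAt I x₁).symm (extChartAt I x₁ (Φ ((extChartAt I x₀).symm y)))))) := by
    rw [h5]
    ext v w
    refine (hiso ((extChartAt I x₀).symm y) (chartFrame I x₀ y v)
      (chartFrame I x₀ y w)).symm.trans ?_
    exact congr_arg₂ (fun v w : E ↦ g.inner (Φ ((extChartAt I x₀).symm y)) v w)
      (hAv v).symm (hAv w).symm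
  rw [volumeDensity_def, key, gramDet_pullbackForm, Real.sqrt_mul (sq_nonneg _),
    Real.sqrt_sq_eq_abs, ← volumeDensity_def]

end Volume

/-! ### The Riemannian volume -/

section Measure
variable {E : Type*} [NormedAddCommGroup E] [NormedSpace ℝ E] [FiniteDimensional ℝ E]
  {H : Type*} [TopologicalSpace H] {I : ModelWithCorners ℝ E H} [I.Boundaryless]
  {N : Type*} [TopologicalSpace N] [ChartedSpace H N] [IsManifold I ∞ N]
  [MeasurableSpace E] [BorelSpace E]

omit [FiniteDimensional ℝ E] [IsManifold I ∞ N] in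
theorem measurableSet_chart_preimage (x₀ : N) {A : Set N} (hA : MeasurableSet[borel N] A) :
    MeasurableSet ((extChartAt I x₀).target ∩ (extChartAt I x₀).symm ⁻¹' A) := by
  let _ : MeasurableSpace N := borel N
  have _ : BorelSpace N := ⟨rfl⟩
  have hc := continuousOn_extChartAt_symm (I := I) x₀
  have h := (isOpen_extChartAt_target (I := I) x₀).measurableSet.subtype_image
    (hc.domRestrict.measurable hA)
  rwa [domRestrict_eq, preimage_comp, Subtype.image_preimage_coe] at h

theorem chartVolume_apply (g : ContMDiffRiemannianMetric I ∞ E (fun x : N ↦ TangentSpace I x))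
    (x₀ : N) {A : Set N} (hA : MeasurableSet[borel N] A) :
    chartVolume g x₀ A = ∫⁻ y in (extChartAt I x₀).target ∩ (extChartAt I x₀).symm ⁻¹' A,
      ENNReal.ofReal (volumeDensity g x₀ y) ∂(Module.finBasis ℝ E).addHaar := by
  let _ : MeasurableSpace N := borel N
  have _ : BorelSpace N := ⟨rfl⟩
  have hT : MeasurableSet (extChartAt I x₀).target := (isOpen_extChartAt_target x₀).measurableSet
  have hm : AEMeasurable (extChartAt I x₀).symm
      (((Module.finBasis ℝ E).addHaar.restrict (extChartAt I x₀).target).withDensity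
      (fun y ↦ ENNReal.ofReal (volumeDensity g x₀ y))) :=
    ((continuousOn_extChartAt_symm x₀).aemeasurable hT).mono_ac (withDensity_absolutelyContinuous _ _)
  have hTA := measurableSet_chart_preimage (I := I) x₀ hA
  have h0 : (((Module.finBasis ℝ E).addHaar.restrict (extChartAt I x₀).target).withDensity
      (fun y ↦ ENNReal.ofReal (volumeDensity g x₀ y))) (extChartAt I x₀).targetᶜ = 0 := by
    refine withDensity_absolutelyContinuous _ _ ?_
    rw [Measure.restrict_apply hT.compl, compl_inter_self, measure_empty]
  rw [chartVolume, Measure.map_apply_of_aemeasurable hm hA,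
    ← measure_inter_add_sdiff _ hT,
    measure_mono_null (fun x (hx : x ∈ _ \ (extChartAt I x₀).target) ↦ hx.2) h0, add_zero, inter_comm,
    withDensity_apply _ hTA, Measure.restrict_restrict hTA, inter_right_comm, inter_self]

/-- The image of one chart measure under an isometry is bounded by another chart measure on the
domain of the latter; for the identity map this says that the chart measures agree on overlaps. -/
theorem chartVolume_preimage_le
    (g : ContMDiffRiemannianMetric I ∞ E (fun x : N ↦ TangentSpace I x))
    {Φ : N → N} (hΦ : MDifferentiable I I Φ) (hinj : Function.Injective Φ)
    (hiso : ∀ p v w, g.inner (Φ p) (mfderiv I I Φ p v) (mfderiv I I Φ p w) = g.inner p v w)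
    (x₀ x₁ : N) {A : Set N} (hA : MeasurableSet[borel N] A) (hA1 : A ⊆ (extChartAt I x₁).source) :
    chartVolume g x₀ (Φ ⁻¹' A) ≤ chartVolume g x₁ A := by
  let _ : MeasurableSpace N := borel N
  have _ : BorelSpace N := ⟨rfl⟩
  have hA' : MeasurableSet (Φ ⁻¹' A) := hΦ.continuous.measurable hA
  rw [chartVolume_apply g x₀ hA', chartVolume_apply g x₁ hA]
  set S := (extChartAt I x₀).target ∩ (extChartAt I x₀).symm ⁻¹' (Φ ⁻¹' A) with hS
  have hSm : MeasurableSet S := measurableSet_chart_preimage x₀ hA'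
  set ψ := extChartAt I x₁ ∘ Φ ∘ (extChartAt I x₀).symm with hψ
  have hex : ∀ y ∈ S, ∃ A : E →L[ℝ] E, HasFDerivAt ψ A y ∧
      volumeDensity g x₀ y = |A.det| * volumeDensity g x₁ (ψ y) := fun y hy ↦
    volumeDensity_comp g hΦ hiso hy.1 (hA1 hy.2)
  choose! D hD hdens using hex
  have hψinj : InjOn ψ S := by
    intro y hy z hz h
    have h1 := hinj ((extChartAt I x₁).injOn (hA1 hy.2) (hA1 hz.2) h)
    exact (extChartAt I x₀).symm.injOn hy.1 hz.1 h1
  have hmap : ψ '' S ⊆ (extChartAt I x₁).target ∩ (extChartAt I x₁).symm ⁻¹' A := by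
    rintro _ ⟨y, hy, rfl⟩
    refine ⟨(extChartAt I x₁).map_source (hA1 hy.2), ?_⟩
    have : (extChartAt I x₁).symm (ψ y) = Φ ((extChartAt I x₀).symm y) :=
      (extChartAt I x₁).left_inv (hA1 hy.2)
    rw [mem_preimage, this]
    exact hy.2
  calc ∫⁻ y in S, ENNReal.ofReal (volumeDensity g x₀ y) ∂(Module.finBasis ℝ E).addHaar
      = ∫⁻ y in S, ENNReal.ofReal |(D y).det| * ENNReal.ofReal (volumeDensity g x₁ (ψ y))
          ∂(Module.finBasis ℝ E).addHaar :=
        setLIntegral_congr_fun hSm fun y hy ↦ by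
          rw [hdens y hy, ENNReal.ofReal_mul (abs_nonneg _)]
    _ = ∫⁻ y in ψ '' S, ENNReal.ofReal (volumeDensity g x₁ y) ∂(Module.finBasis ℝ E).addHaar :=
        (lintegral_image_eq_lintegral_abs_det_fderiv_mul _ hSm
          (fun y hy ↦ (hD y hy).hasFDerivWithinAt) hψinj
          (fun y ↦ ENNReal.ofReal (volumeDensity g x₁ y))).symm
    _ ≤ _ := lintegral_mono_set hmap

theorem chartVolume_le (g : ContMDiffRiemannianMetric I ∞ E (fun x : N ↦ TangentSpace I x))
    (x₀ x₁ : N) {A : Set N} (hA : MeasurableSet[borel N] A) (hA1 : A ⊆ (extChartAt I x₁).source) :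
    chartVolume g x₀ A ≤ chartVolume g x₁ A :=
  chartVolume_preimage_le g (Φ := id) mdifferentiable_id Function.injective_id
    (fun p v w ↦ by simp [mfderiv_id]) x₀ x₁ hA hA1

/-- The volume restricts to the chart measures on the chart domains. -/
theorem riemannianVolume_apply_of_subset
    (g : ContMDiffRiemannianMetric I ∞ E (fun x : N ↦ TangentSpace I x))
    (x₁ : N) {A : Set N} (hA : MeasurableSet[borel N] A) (hA1 : A ⊆ (extChartAt I x₁).source) :
    riemannianVolume g A = chartVolume g x₁ A := by
  let _ : MeasurableSpace N := borel N
  have _ : BorelSpace N := ⟨rfl⟩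
  refine le_antisymm ?_ ((le_iSup (fun x ↦ chartVolume g x) x₁) A)
  -- a measure that dominates all chart measures and agrees with the given one on its chart domain
  set U := (extChartAt I x₁).source with hU
  have hUm : MeasurableSet U := (isOpen_extChartAt_source x₁).measurableSet
  let ν : Measure N := chartVolume g x₁ + (⊤ : ℝ≥0∞) • Measure.count.restrict Uᶜ
  have hν : riemannianVolume g ≤ ν := by
    refine iSup_le fun x ↦ Measure.le_iff.2 fun B hB ↦ ?_
    rw [← measure_inter_add_sdiff B hUm]
    have hνB : ν B = chartVolume g x₁ B + ⊤ * Measure.count (B ∩ Uᶜ) := by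
      simp only [ν, Measure.coe_add, Pi.add_apply, Measure.smul_apply, smul_eq_mul]
      rw [Measure.restrict_apply hB]
    rw [hνB]
    refine add_le_add ((chartVolume_le g x x₁ (hB.inter hUm) inter_subset_right).trans
      (measure_mono inter_subset_left)) ?_
    rw [sdiff_eq]
    rcases (B ∩ Uᶜ).eq_empty_or_nonempty with h | h
    · simp [h]
    · have : Measure.count (B ∩ Uᶜ) ≠ 0 := by
        rw [Ne, Measure.count_eq_zero_iff]
        exact h.ne_empty
      rw [ENNReal.top_mul this]
      exact le_top
  refine (hν A).trans_eq ?_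
  simp only [ν, Measure.coe_add, Pi.add_apply, Measure.smul_apply, smul_eq_mul]
  rw [Measure.restrict_apply hA, (disjoint_compl_right_iff_subset.2 hA1).inter_eq]
  simp

theorem riemannianVolume_isOpenPosMeasure
    (g : ContMDiffRiemannianMetric I ∞ E (fun x : N ↦ TangentSpace I x)) {V : Set N}
    (hV : IsOpen V) (hne : V.Nonempty) : 0 < riemannianVolume g V := by
  let _ : MeasurableSpace N := borel N
  have _ : BorelSpace N := ⟨rfl⟩
  obtain ⟨x₀, hx₀⟩ := hne
  refine lt_of_lt_of_le ?_ ((le_iSup (fun x ↦ chartVolume g x) x₀) V)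
  rw [chartVolume_apply g x₀ hV.measurableSet]
  set y₀ := extChartAt I x₀ x₀
  have hT : ∀ᶠ y in 𝓝 y₀, y ∈ (extChartAt I x₀).target := extChartAt_target_mem_nhds x₀
  have hVn : ∀ᶠ y in 𝓝 y₀, (extChartAt I x₀).symm y ∈ V :=
    (continuousAt_extChartAt_symm x₀).eventually (hV.mem_nhds (by simpa [y₀] using hx₀))
  have hpos : 0 < volumeDensity g x₀ y₀ := volumeDensity_pos g (mem_extChartAt_target x₀)
  have hJ : ∀ᶠ y in 𝓝 y₀, volumeDensity g x₀ y₀ / 2 < volumeDensity g x₀ y :=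
    (continuousAt_volumeDensity g x₀).eventually (lt_mem_nhds (half_lt_self hpos))
  obtain ⟨B, hB, hBo, hyB⟩ := eventually_nhds_iff.1 (hT.and (hVn.and hJ))
  have hsub : B ⊆ (extChartAt I x₀).target ∩ (extChartAt I x₀).symm ⁻¹' V :=
    fun y hy ↦ ⟨(hB y hy).1, (hB y hy).2.1⟩
  calc (0 : ℝ≥0∞)
      < ENNReal.ofReal (volumeDensity g x₀ y₀ / 2) * (Module.finBasis ℝ E).addHaar B :=
        ENNReal.mul_pos (ENNReal.ofReal_pos.2 (half_pos hpos)).ne'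
          (hBo.measure_pos _ ⟨y₀, hyB⟩).ne'
    _ = ∫⁻ _ in B, ENNReal.ofReal (volumeDensity g x₀ y₀ / 2)
          ∂(Module.finBasis ℝ E).addHaar := by rw [setLIntegral_const]
    _ ≤ ∫⁻ y in B, ENNReal.ofReal (volumeDensity g x₀ y) ∂(Module.finBasis ℝ E).addHaar :=
        setLIntegral_mono' hBo.measurableSet fun y hy ↦ ENNReal.ofReal_le_ofReal (hB y hy).2.2.le
    _ ≤ _ := lintegral_mono_set hsub

/-- Every point has an open neighbourhood of finite volume. -/
theorem exists_isOpen_riemannianVolume_lt_top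
    (g : ContMDiffRiemannianMetric I ∞ E (fun x : N ↦ TangentSpace I x)) (x₀ : N) :
    ∃ V : Set N, IsOpen V ∧ x₀ ∈ V ∧ riemannianVolume g V < ⊤ := by
  let _ : MeasurableSpace N := borel N
  have _ : BorelSpace N := ⟨rfl⟩
  set y₀ := extChartAt I x₀ x₀ with hy₀
  have hJ : ∀ᶠ y in 𝓝 y₀, volumeDensity g x₀ y < volumeDensity g x₀ y₀ + 1 :=
    (continuousAt_volumeDensity g x₀).eventually (gt_mem_nhds (lt_add_one _))
  have hball : ∀ᶠ y in 𝓝 y₀, y ∈ Metric.ball y₀ 1 := Metric.ball_mem_nhds _ one_pos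
  obtain ⟨B, hB, hBo, hyB⟩ := eventually_nhds_iff.1 (hJ.and hball)
  have hVo : IsOpen ((extChartAt I x₀).source ∩ extChartAt I x₀ ⁻¹' B) :=
    isOpen_extChartAt_preimage' x₀ hBo
  refine ⟨(extChartAt I x₀).source ∩ extChartAt I x₀ ⁻¹' B, hVo,
    ⟨mem_extChartAt_source x₀, hyB⟩, ?_⟩
  rw [riemannianVolume_apply_of_subset g x₀ hVo.measurableSet inter_subset_left,
    chartVolume_apply g x₀ hVo.measurableSet]
  have hsub : (extChartAt I x₀).target ∩ (extChartAt I x₀).symm ⁻¹'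
      ((extChartAt I x₀).source ∩ extChartAt I x₀ ⁻¹' B) ⊆ B := by
    rintro y ⟨hy, hy'⟩
    have hyB' : extChartAt I x₀ ((extChartAt I x₀).symm y) ∈ B := hy'.2
    rwa [(extChartAt I x₀).right_inv hy] at hyB'
  calc _ ≤ ∫⁻ y in B, ENNReal.ofReal (volumeDensity g x₀ y) ∂(Module.finBasis ℝ E).addHaar :=
        lintegral_mono_set hsub
    _ ≤ ∫⁻ _ in B, ENNReal.ofReal (volumeDensity g x₀ y₀ + 1) ∂(Module.finBasis ℝ E).addHaar :=
        setLIntegral_mono' hBo.measurableSet fun y hy ↦ ENNReal.ofReal_le_ofReal (hB y hy).1.le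
    _ = ENNReal.ofReal (volumeDensity g x₀ y₀ + 1) * (Module.finBasis ℝ E).addHaar B := by
        rw [setLIntegral_const]
    _ < ⊤ := ENNReal.mul_lt_top ENNReal.ofReal_lt_top
        ((measure_mono fun y hy ↦ (hB y hy).2).trans_lt measure_ball_lt_top)

theorem riemannianVolume_univ_lt_top [CompactSpace N]
    (g : ContMDiffRiemannianMetric I ∞ E (fun x : N ↦ TangentSpace I x)) :
    riemannianVolume g univ < ⊤ := by
  let _ : MeasurableSpace N := borel N
  have _ : BorelSpace N := ⟨rfl⟩
  refine isCompact_univ.measure_lt_top_of_nhdsWithin fun x _ ↦ ?_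
  obtain ⟨V, hVo, hxV, hV⟩ := exists_isOpen_riemannianVolume_lt_top g x
  exact ⟨V, mem_nhdsWithin_of_mem_nhds (hVo.mem_nhds hxV), hV⟩

omit [I.Boundaryless] in
/-- A measure that is bounded by the volume on each chart domain is bounded by the volume. -/
theorem le_riemannianVolume [CompactSpace N]
    (g : ContMDiffRiemannianMetric I ∞ E (fun x : N ↦ TangentSpace I x))
    (ν : @Measure N (borel N))
    (hν : ∀ x (A : Set N), MeasurableSet[borel N] A → A ⊆ (extChartAt I x).source →
      ν A ≤ riemannianVolume g A) : ν ≤ riemannianVolume g := by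
  let _ : MeasurableSpace N := borel N
  have _ : BorelSpace N := ⟨rfl⟩
  obtain ⟨t, ht⟩ := isCompact_univ.elim_finite_subcover (fun x : N ↦ (extChartAt I x).source)
    (fun x ↦ isOpen_extChartAt_source x) (fun x _ ↦ mem_iUnion.2 ⟨x, mem_extChartAt_source x⟩)
  have key : ∀ (t : Finset N) (A : Set N), MeasurableSet A → A ⊆ ⋃ x ∈ t, (extChartAt I x).source →
      ν A ≤ riemannianVolume g A := by
    intro t
    classical
    induction t using Finset.induction_on with
    | empty => intro A _ h; simp [subset_empty_iff.1 (h.trans (by simp))]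
    | insert x t _ ih =>
      intro A hA h
      have hU : MeasurableSet (extChartAt I x).source := (isOpen_extChartAt_source x).measurableSet
      rw [← measure_inter_add_sdiff A hU, ← measure_inter_add_sdiff (μ := riemannianVolume g) A hU]
      refine add_le_add (hν x _ (hA.inter hU) inter_subset_right) (ih _ (hA.diff hU) ?_)
      rintro y ⟨hyA, hy⟩
      have := h hyA
      rw [Finset.set_biUnion_insert] at this
      exact this.resolve_left hy
  exact Measure.le_iff.2 fun A hA ↦ key t A hA ((subset_univ A).trans ht)

/-- Isometries preserve the volume. -/
theorem map_riemannianVolume [CompactSpace N]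
    (g : ContMDiffRiemannianMetric I ∞ E (fun x : N ↦ TangentSpace I x))
    {Φ Ψ : N → N} (hΦ : MDifferentiable I I Φ) (hΨ : MDifferentiable I I Ψ)
    (hΨΦ : Function.LeftInverse Ψ Φ) (hΦΨ : Function.LeftInverse Φ Ψ)
    (hΦg : ∀ p v w, g.inner (Φ p) (mfderiv I I Φ p v) (mfderiv I I Φ p w) = g.inner p v w)
    (hΨg : ∀ p v w, g.inner (Ψ p) (mfderiv I I Ψ p v) (mfderiv I I Ψ p w) = g.inner p v w) :
    @Measure.map N N (borel N) (borel N) Φ (riemannianVolume g) = riemannianVolume g := by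
  let _ : MeasurableSpace N := borel N
  have _ : BorelSpace N := ⟨rfl⟩
  have key : ∀ {Φ Ψ : N → N}, MDifferentiable I I Φ → MDifferentiable I I Ψ →
      Function.LeftInverse Ψ Φ → Function.LeftInverse Φ Ψ →
      (∀ p v w, g.inner (Φ p) (mfderiv I I Φ p v) (mfderiv I I Φ p w) = g.inner p v w) →
      riemannianVolume g ≤ (riemannianVolume g).map Ψ := by
    intro Φ Ψ hΦ hΨ hΨΦ hΦΨ hΦg
    have h1 : ∀ x₀, (chartVolume g x₀).map Φ ≤ riemannianVolume g := by
      intro x₀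
      refine le_riemannianVolume g _ fun x A hA hAx ↦ ?_
      rw [Measure.map_apply hΦ.continuous.measurable hA,
        riemannianVolume_apply_of_subset g x hA hAx]
      exact chartVolume_preimage_le g hΦ hΨΦ.injective hΦg x₀ x hA hAx
    refine iSup_le fun x₀ ↦ ?_
    have h2 := Measure.map_mono (h1 x₀) hΨ.continuous.measurable
    rwa [Measure.map_map hΨ.continuous.measurable hΦ.continuous.measurable, hΨΦ.comp_eq_id,
      Measure.map_id] at h2
  refine le_antisymm ?_ (key hΨ hΦ hΦΨ hΨΦ hΨg)
  have h := Measure.map_mono (key hΦ hΨ hΨΦ hΦΨ hΦg) hΦ.continuous.measurable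
  rwa [Measure.map_map hΦ.continuous.measurable hΨ.continuous.measurable, hΦΨ.comp_eq_id,
    Measure.map_id] at h

end Measure

/-! ### Integrals and gradients -/

section Integral
variable {E : Type*} [NormedAddCommGroup E] [NormedSpace ℝ E] [FiniteDimensional ℝ E]
  {H : Type*} [TopologicalSpace H] {I : ModelWithCorners ℝ E H} [I.Boundaryless]
  {N : Type*} [TopologicalSpace N] [ChartedSpace H N] [IsManifold I ∞ N] [CompactSpace N]
  [MeasurableSpace E] [BorelSpace E]

/-- The integral of `f` with respect to the Riemannian volume. -/
def vint (g : ContMDiffRiemannianMetric I ∞ E (fun x : N ↦ TangentSpace I x)) (f : N → ℝ) : ℝ :=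
  letI : MeasurableSpace N := borel N
  ∫ p, f p ∂(riemannianVolume g)

theorem integrable_of_continuous
    (g : ContMDiffRiemannianMetric I ∞ E (fun x : N ↦ TangentSpace I x)) {f : N → ℝ}
    (hf : Continuous f) : letI : MeasurableSpace N := borel N
    Integrable f (riemannianVolume g) := by
  let _ : MeasurableSpace N := borel N
  have _ : BorelSpace N := ⟨rfl⟩
  have _ : IsFiniteMeasure (riemannianVolume g) := ⟨riemannianVolume_univ_lt_top g⟩
  have hb : BddAbove (range fun p ↦ ‖f p‖) := (isCompact_range hf.norm).bddAbove
  obtain ⟨C, hC⟩ := hb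
  exact Integrable.of_bound (C := C) hf.aestronglyMeasurable
    (Eventually.of_forall fun p ↦ hC ⟨p, rfl⟩)

variable (g : ContMDiffRiemannianMetric I ∞ E (fun x : N ↦ TangentSpace I x))

theorem vint_add {f h : N → ℝ} (hf : Continuous f) (hh : Continuous h) :
    vint g (fun p ↦ f p + h p) = vint g f + vint g h :=
  @integral_add _ _ _ _ (borel N) _ _ _ (integrable_of_continuous g hf)
    (integrable_of_continuous g hh)

omit [I.Boundaryless] [CompactSpace N] in
theorem vint_const_mul (c : ℝ) (f : N → ℝ) : vint g (fun p ↦ c * f p) = c * vint g f :=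
  @integral_const_mul _ (borel N) _ _ _ _ _

omit [I.Boundaryless] [CompactSpace N] in
theorem vint_nonpos {f : N → ℝ} (hf : ∀ p, f p ≤ 0) : vint g f ≤ 0 := by
  let _ : MeasurableSpace N := borel N
  exact integral_nonpos hf

theorem vint_pos {f : N → ℝ} (hc : Continuous f) (hf : ∀ p, 0 ≤ f p) {p : N} (hp : 0 < f p) :
    0 < vint g f := by
  let _ : MeasurableSpace N := borel N
  have _ : BorelSpace N := ⟨rfl⟩
  refine (integral_pos_iff_support_of_nonneg hf (integrable_of_continuous g hc)).2 ?_
  exact riemannianVolume_isOpenPosMeasure g (hc.isOpen_support) ⟨p, hp.ne'⟩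

theorem vint_comp {Φ Ψ : N → N} (hΦ : MDifferentiable I I Φ) (hΨ : MDifferentiable I I Ψ)
    (hΨΦ : Function.LeftInverse Ψ Φ) (hΦΨ : Function.LeftInverse Φ Ψ)
    (hΦg : ∀ p v w, g.inner (Φ p) (mfderiv I I Φ p v) (mfderiv I I Φ p w) = g.inner p v w)
    (hΨg : ∀ p v w, g.inner (Ψ p) (mfderiv I I Ψ p v) (mfderiv I I Ψ p w) = g.inner p v w)
    {f : N → ℝ} (hf : Continuous f) : vint g (fun p ↦ f (Φ p)) = vint g f := by
  let _ : MeasurableSpace N := borel N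
  have _ : BorelSpace N := ⟨rfl⟩
  have h := map_riemannianVolume g hΦ hΨ hΨΦ hΦΨ hΦg hΨg
  have h2 := integral_map (μ := riemannianVolume g) hΦ.continuous.measurable.aemeasurable
    (f := f) hf.aestronglyMeasurable
  rw [h] at h2
  exact h2.symm

/-- Differentiation under the integral sign, for a family that is jointly continuous together with
its derivative. -/
theorem hasDerivAt_vint {F F' : ℝ → N → ℝ} (hF : ∀ t, Continuous (F t))
    (hF' : Continuous (Function.uncurry F')) (hd : ∀ t p, HasDerivAt (fun t ↦ F t p) (F' t p) t)
    (t₀ : ℝ) : HasDerivAt (fun t ↦ vint g (F t)) (vint g (F' t₀)) t₀ := by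
  let _ : MeasurableSpace N := borel N
  have _ : BorelSpace N := ⟨rfl⟩
  have _ : IsFiniteMeasure (riemannianVolume g) := ⟨riemannianVolume_univ_lt_top g⟩
  have hK : IsCompact (Metric.closedBall t₀ 1 ×ˢ (univ : Set N)) :=
    (isCompact_closedBall t₀ 1).prod isCompact_univ
  obtain ⟨C, hC⟩ := hK.exists_bound_of_continuousOn hF'.continuousOn
  refine (hasDerivAt_integral_of_dominated_loc_of_deriv_le (μ := riemannianVolume g)
    (bound := fun _ ↦ C) (Metric.closedBall_mem_nhds t₀ one_pos)
    (Eventually.of_forall fun t ↦ (hF t).aestronglyMeasurable) (integrable_of_continuous g (hF t₀))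
    (Continuous.aestronglyMeasurable (by fun_prop)) (Eventually.of_forall fun p t ht ↦ ?_)
    (integrable_const C) (Eventually.of_forall fun p t _ ↦ hd t p)).2
  exact hC (t, p) ⟨ht, mem_univ _⟩

end Integral

section Gradient
variable {E : Type*} [NormedAddCommGroup E] [NormedSpace ℝ E] [FiniteDimensional ℝ E]
  {H : Type*} [TopologicalSpace H] {I : ModelWithCorners ℝ E H}
  {N : Type*} [TopologicalSpace N] [ChartedSpace H N] [IsManifold I ∞ N]
  (g : ContMDiffRiemannianMetric I ∞ E (fun x : N ↦ TangentSpace I x))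

/-- The inner product `g (∇f, ∇h)` of the gradients of two functions. -/
def gradInner (f h : N → ℝ) (p : N) : ℝ :=
  g.inner p (riemannianGradient g f p) (riemannianGradient g h p)

theorem gradInner_eq_mvfderiv (f h : N → ℝ) (p : N) :
    gradInner g f h p = mvfderiv I f p (riemannianGradient g h p) :=
  inner_riemannianGradient g f p _

theorem gradInner_comm (f h : N → ℝ) (p : N) : gradInner g f h p = gradInner g h f p :=
  g.symm p _ _

theorem gradInner_self_nonneg (f : N → ℝ) (p : N) : 0 ≤ gradInner g f f p := by
  unfold gradInner
  rcases eq_or_ne (riemannianGradient g f p) 0 with h | h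
  · simp [h]
  · exact (g.pos p _ h).le

/-- The gradient is characterized by its inner products. -/
theorem riemannianGradient_eq {f : N → ℝ} {p : N} {v : TangentSpace I p}
    (h : ∀ w, g.inner p v w = mvfderiv I f p w) : riemannianGradient g f p = v := by
  apply (flat g p).injective
  ext w
  exact (inner_riemannianGradient g f p w).trans (h w).symm

theorem continuous_gradInner {f h : N → ℝ} (hf : ContMDiff I 𝓘(ℝ, ℝ) ∞ f)
    (hh : ContMDiff I 𝓘(ℝ, ℝ) ∞ h) : Continuous (gradInner g f h) := by
  have : IsManifold I 1 N := IsManifold.of_le (n := ∞) (by simp)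
  refine continuous_iff_continuousAt.2 fun x₀ ↦ ?_
  -- the differentials in the trivialization of the tangent bundle at `x₀`
  have hcoord : ∀ {f : N → ℝ}, ContMDiff I 𝓘(ℝ, ℝ) ∞ f → ∃ a : N → E →L[ℝ] ℝ, ContinuousAt a x₀ ∧
      ∀ᶠ p in 𝓝 x₀, ∀ v : E, a p v
        = mvfderiv I f p ((trivializationAt E (TangentSpace I) x₀).symmL ℝ p v) := by
    intro f hf
    refine ⟨_, ((hf x₀).mfderiv_const (m := ∞) (by simp)).continuousAt, ?_⟩
    filter_upwards [(chartAt H x₀).open_source.mem_nhds (mem_chart_source H x₀)] with p hp v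
    rw [inTangentCoordinates_eq_mfderiv_comp (I := I) (I' := 𝓘(ℝ, ℝ)) (f := id) (g := f) hp
      (mem_univ _)]
    have h1 := TangentBundle.symmL_trivializationAt (𝕜 := ℝ) (I := I) hp
    have h2 : mfderiv 𝓘(ℝ, ℝ) 𝓘(ℝ, ℝ) (extChartAt 𝓘(ℝ, ℝ) (f x₀)) (f p)
        = ContinuousLinearMap.id ℝ ℝ := by
      rw [extChartAt_model_space_eq_id]
      exact mfderiv_id
    rw [h1]
    exact DFunLike.congr_fun h2 _
  obtain ⟨a, ha, hae⟩ := hcoord hf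
  obtain ⟨b, hb, hbe⟩ := hcoord hh
  have hbase : ∀ᶠ p in 𝓝 x₀, p ∈ (trivializationAt E (TangentSpace I) x₀).baseSet :=
    (trivializationAt E (TangentSpace I) x₀).open_baseSet.mem_nhds
      (FiberBundle.mem_baseSet_trivializationAt' x₀)
  -- the metric in coordinates is invertible
  have hinv : ∀ p ∈ (trivializationAt E (TangentSpace I) x₀).baseSet,
      (coordMetric g x₀ p).IsInvertible := by
    intro p hp
    have hbij : Function.Bijective (coordMetric g x₀ p) := by
      refine flat_bijective _ fun v hv ↦ ?_
      rw [coordMetric_apply]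
      refine g.pos _ _ fun h ↦ hv ?_
      have h' := (trivializationAt E (TangentSpace I) x₀).continuousLinearMapAt_symmL (R := ℝ) hp v
      rw [h, map_zero] at h'
      exact h'.symm
    exact ⟨(LinearEquiv.ofBijective (coordMetric g x₀ p).toLinearMap
      hbij).toContinuousLinearEquiv, rfl⟩
  have h0 : ContinuousAt (fun p ↦ (coordMetric g x₀ p).inverse) x₀ :=
    ContinuousAt.comp (g := ContinuousLinearMap.inverse)
      ((hinv x₀ (FiberBundle.mem_baseSet_trivializationAt' x₀)).contDiffAt_map_inverse
        (n := 0)).continuousAt (continuousAt_coordMetric g x₀)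
  refine ContinuousAt.congr (f := fun p ↦ a p ((coordMetric g x₀ p).inverse (b p)))
    (ha.clm_apply (h0.clm_apply hb)) ?_
  filter_upwards [hae, hbe, hbase] with p hap hbp hp
  rw [gradInner_eq_mvfderiv, hap]
  congr 1
  refine (riemannianGradient_eq g fun w ↦ ?_).symm
  set e := trivializationAt E (TangentSpace I) x₀ with he
  have hw : e.symmL ℝ p (e.continuousLinearMapAt ℝ p w) = w :=
    e.symmL_continuousLinearMapAt hp w
  rw [← hw, ← hbp, ← coordMetric_apply]
  congr 1
  exact (hinv p hp).self_apply_inverse _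

end Gradient

/-! ### The weak Laplacian and the maximum principle -/

section WeakLaplacian
variable {E : Type*} [NormedAddCommGroup E] [NormedSpace ℝ E] [FiniteDimensional ℝ E]
  {H : Type*} [TopologicalSpace H] {I : ModelWithCorners ℝ E H}
  {N : Type*} [TopologicalSpace N] [ChartedSpace H N] [IsManifold I ∞ N]
  {g : ContMDiffRiemannianMetric I ∞ E (fun x : N ↦ TangentSpace I x)}

theorem gradInner_add_const_mul {f h : N → ℝ} (hf : MDifferentiable I 𝓘(ℝ, ℝ) f)
    (hh : MDifferentiable I 𝓘(ℝ, ℝ) h) (c : ℝ) (φ : N → ℝ) (p : N) :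
    gradInner g (fun q ↦ f q + c * h q) φ p = gradInner g f φ p + c * gradInner g h φ p := by
  have h1 : mvfderiv I (fun q ↦ f q + c * h q) p = mvfderiv I f p + c • mvfderiv I h p := by
    have hc : MDifferentiableAt I 𝓘(ℝ, ℝ) (fun _ : N ↦ c) p := mdifferentiableAt_const
    have h2 := mvfderiv_mul hc (hh p)
    rw [mvfderiv_const, smul_zero, add_zero] at h2
    rw [← h2]
    exact mvfderiv_add (hf p) ((hc.smul (hh p)))
  rw [gradInner_eq_mvfderiv, gradInner_eq_mvfderiv, gradInner_eq_mvfderiv, h1]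
  rfl

theorem gradInner_add_const_mul_self {f h : N → ℝ} (hf : MDifferentiable I 𝓘(ℝ, ℝ) f)
    (hh : MDifferentiable I 𝓘(ℝ, ℝ) h) (c : ℝ) (p : N) :
    gradInner g (fun q ↦ f q + c * h q) (fun q ↦ f q + c * h q) p
      = gradInner g f f p + 2 * c * gradInner g f h p + c ^ 2 * gradInner g h h p := by
  rw [gradInner_add_const_mul hf hh, gradInner_comm g f, gradInner_comm g h,
    gradInner_add_const_mul hf hh, gradInner_add_const_mul hf hh, gradInner_comm g h f]
  ring

/-- If `ψ` is differentiable with `ψ' ≤ 0`, then `g (∇f, ∇(ψ ∘ f)) ≤ 0`. -/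
theorem gradInner_comp_nonpos {f φ : N → ℝ} {p : N} (hf : MDifferentiableAt I 𝓘(ℝ, ℝ) f p)
    {ψ : ℝ → ℝ} {c : ℝ} (hψ : HasDerivAt ψ c (f p)) (hc : c ≤ 0) (hφ : φ =ᶠ[𝓝 p] ψ ∘ f) :
    gradInner g f φ p ≤ 0 := by
  have h1 := hψ.hasFDerivAt.hasMFDerivAt.comp p hf.hasMFDerivAt
  have h2 : ∀ v, mvfderiv I φ p v = mvfderiv I f p v * c := fun v ↦
    DFunLike.congr_fun (h1.congr_of_eventuallyEq hφ).mfderiv v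
  rw [gradInner_comm, gradInner_eq_mvfderiv, h2, ← gradInner_eq_mvfderiv]
  exact mul_nonpos_of_nonneg_of_nonpos (gradInner_self_nonneg g f p) hc

/-- An isometry transports inner products of gradients. -/
theorem gradInner_comp {Φ : N → N} (hΦ : MDifferentiable I I Φ)
    (hΦg : ∀ p v w, g.inner (Φ p) (mfderiv I I Φ p v) (mfderiv I I Φ p w) = g.inner p v w)
    {f h : N → ℝ} (hf : MDifferentiable I 𝓘(ℝ, ℝ) f) (hh : MDifferentiable I 𝓘(ℝ, ℝ) h) (p : N) :
    gradInner g (f ∘ Φ) (h ∘ Φ) p = gradInner g f h (Φ p) := by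
  have hinj : Function.Injective (mfderiv I I Φ p) := by
    refine (injective_iff_map_eq_zero _).2 fun v hv ↦ ?_
    by_contra hne
    have h1 := g.pos p v hne
    rw [← hΦg, hv] at h1
    simp at h1
  have hsurj : Function.Surjective (mfderiv I I Φ p) := by
    let D : E →L[ℝ] E := mfderiv I I Φ p
    exact LinearMap.surjective_of_injective (f := (D : E →ₗ[ℝ] E)) hinj
  have hgrad : ∀ {f : N → ℝ}, MDifferentiable I 𝓘(ℝ, ℝ) f →
      riemannianGradient g f (Φ p) = mfderiv I I Φ p (riemannianGradient g (f ∘ Φ) p) := by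
    intro f hf
    refine riemannianGradient_eq g fun w ↦ ?_
    obtain ⟨w, rfl⟩ := hsurj w
    rw [hΦg, inner_riemannianGradient]
    exact mvfderiv_comp_apply p (hf (Φ p)) (hΦ p) w
  rw [gradInner, gradInner, hgrad hf, hgrad hh, hΦg]

variable [I.Boundaryless] [CompactSpace N] [MeasurableSpace E] [BorelSpace E]

variable (g) in
/-- The equation `Δf = L` in the weak sense: `∫ g (∇f, ∇φ) = -∫ L φ` for all smooth `φ`. -/
def WeakLaplacian (f L : N → ℝ) : Prop :=
  ∀ φ : N → ℝ, ContMDiff I 𝓘(ℝ, ℝ) ∞ φ → vint g (gradInner g f φ) = -vint g (fun p ↦ L p * φ p)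

theorem WeakLaplacian.add_const_mul {f h L K : N → ℝ} (hf : ContMDiff I 𝓘(ℝ, ℝ) ∞ f)
    (hh : ContMDiff I 𝓘(ℝ, ℝ) ∞ h) (hL : Continuous L) (hK : Continuous K)
    (hfL : WeakLaplacian g f L) (hhK : WeakLaplacian g h K) (c : ℝ) :
    WeakLaplacian g (fun p ↦ f p + c * h p) (fun p ↦ L p + c * K p) := by
  intro φ hφ
  have h1 : gradInner g (fun p ↦ f p + c * h p) φ
      = fun p ↦ gradInner g f φ p + c * gradInner g h φ p :=
    funext (gradInner_add_const_mul (hf.mdifferentiable (by simp))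
      (hh.mdifferentiable (by simp)) c φ)
  have h2 : (fun p ↦ (L p + c * K p) * φ p) = fun p ↦ L p * φ p + c * (K p * φ p) := by
    ext p; ring
  have cf := continuous_gradInner g hf hφ
  have ch := continuous_gradInner g hh hφ
  have cφ := hφ.continuous
  rw [h1, h2, vint_add g cf (by fun_prop), vint_add g (by fun_prop) (by fun_prop),
    vint_const_mul, vint_const_mul, hfL φ hφ, hhK φ hφ]
  ring

theorem WeakLaplacian.comp {Φ Ψ : N → N} (hΦ : ContMDiff I I ∞ Φ) (hΨ : ContMDiff I I ∞ Ψ)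
    (hΨΦ : Function.LeftInverse Ψ Φ) (hΦΨ : Function.LeftInverse Φ Ψ)
    (hΦg : ∀ p v w, g.inner (Φ p) (mfderiv I I Φ p v) (mfderiv I I Φ p w) = g.inner p v w)
    (hΨg : ∀ p v w, g.inner (Ψ p) (mfderiv I I Ψ p v) (mfderiv I I Ψ p w) = g.inner p v w)
    {f L : N → ℝ} (hf : ContMDiff I 𝓘(ℝ, ℝ) ∞ f) (hL : Continuous L) (h : WeakLaplacian g f L) :
    WeakLaplacian g (f ∘ Φ) (L ∘ Φ) := by
  intro φ hφ
  have hφΨ : ContMDiff I 𝓘(ℝ, ℝ) ∞ (φ ∘ Ψ) := hφ.comp hΨ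
  have e : φ = (φ ∘ Ψ) ∘ Φ := by
    ext p; simp [hΨΦ p]
  have dΦ := hΦ.mdifferentiable (n := ∞) (by simp)
  have dΨ := hΨ.mdifferentiable (n := ∞) (by simp)
  have h1 : gradInner g (f ∘ Φ) φ = fun p ↦ gradInner g f (φ ∘ Ψ) (Φ p) := by
    ext p
    conv_lhs => rw [e]
    exact gradInner_comp dΦ hΦg (hf.mdifferentiable (by simp)) (hφΨ.mdifferentiable (by simp)) p
  have h2 : (fun p ↦ (L ∘ Φ) p * φ p) = fun p ↦ (fun q ↦ L q * (φ ∘ Ψ) q) (Φ p) := by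
    ext p; simp [hΨΦ p]
  rw [h1, h2, vint_comp g dΦ dΨ hΨΦ hΦΨ hΦg hΨg (continuous_gradInner g hf hφΨ),
    vint_comp g dΦ dΨ hΨΦ hΦΨ hΦg hΨg (f := fun q ↦ L q * (φ ∘ Ψ) q) (hL.mul hφΨ.continuous),
    h _ hφΨ]

/-- The Euler--Lagrange equation `Δu = ε⁻² W'(u)` of a phase transition. -/
theorem IsPhaseTransition.weakLaplacian {W : ℝ → ℝ} (hW : ContDiff ℝ ∞ W) {ε : ℝ} (hε : 0 < ε)
    {u : N → ℝ} (hu : IsPhaseTransition g W ε u) :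
    WeakLaplacian g u (fun p ↦ (ε ^ 2)⁻¹ * deriv W (u p)) := by
  intro φ hφ
  have hus := hu.smooth
  have hW' : Continuous (deriv W) := hW.continuous_deriv (by simp)
  have cu := hus.continuous
  have cφ := hφ.continuous
  have c1 := continuous_gradInner g hus hus
  have c2 := continuous_gradInner g hus hφ
  have c3 := continuous_gradInner g hφ hφ
  have cW := hW.continuous
  let F : ℝ → N → ℝ := fun t p ↦ 1 / 2 * ε * (gradInner g u u p + 2 * t * gradInner g u φ p
    + t ^ 2 * gradInner g φ φ p) + ε⁻¹ * W (u p + t * φ p)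
  let F' : ℝ → N → ℝ := fun t p ↦ ε * (gradInner g u φ p + t * gradInner g φ φ p)
    + ε⁻¹ * (deriv W (u p + t * φ p) * φ p)
  have hF : ∀ t, energy g W ε (fun p ↦ u p + t * φ p) = vint g (F t) := by
    intro t
    change vint g _ = _
    congr 1
    ext p
    have := gradInner_add_const_mul_self (g := g) (hus.mdifferentiable (n := ∞) (by simp))
      (hφ.mdifferentiable (n := ∞) (by simp)) t p
    simp only [F, ← this]
    rfl
  have hd : ∀ t p, HasDerivAt (fun t ↦ F t p) (F' t p) t := by
    intro t p
    have hWd : HasDerivAt W (deriv W (u p + t * φ p)) (u p + t * φ p) :=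
      (hW.differentiable (by simp) _).hasDerivAt
    have hlin : HasDerivAt (fun t : ℝ ↦ u p + t * φ p) (φ p) t := by
      simpa using ((hasDerivAt_id t).mul_const (φ p)).const_add (u p)
    have h1 := (hWd.comp t hlin).const_mul ε⁻¹
    have h2 : HasDerivAt (fun t : ℝ ↦ 1 / 2 * ε * (gradInner g u u p + 2 * t * gradInner g u φ p
        + t ^ 2 * gradInner g φ φ p)) (ε * (gradInner g u φ p + t * gradInner g φ φ p)) t := by
      have h3 : HasDerivAt (fun t : ℝ ↦ gradInner g u u p + 2 * t * gradInner g u φ p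
        + t ^ 2 * gradInner g φ φ p) (2 * 1 * gradInner g u φ p
          + (2 * t ^ 1 * 1) * gradInner g φ φ p) t :=
        ((((hasDerivAt_id t).const_mul 2).mul_const _).const_add _).add
          (((hasDerivAt_id t).pow 2).mul_const _)
      exact (h3.const_mul (1 / 2 * ε)).congr_deriv (by ring)
    exact h2.add h1
  have h := hasDerivAt_vint g (F := F) (F' := F') (fun t ↦ by fun_prop)
    (by simp only [Function.uncurry_def, F']; fun_prop) hd 0
  have hcrit := hu.critical φ hφ
  simp only [hF] at hcrit
  have h0 := h.unique hcrit
  have h1 : F' 0 = fun p ↦ ε * gradInner g u φ p + ε⁻¹ * (deriv W (u p) * φ p) := by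
    ext p; simp [F']
  rw [h1, vint_add g (by fun_prop) (by fun_prop), vint_const_mul, vint_const_mul] at h0
  have h2 : (fun p ↦ (ε ^ 2)⁻¹ * deriv W (u p) * φ p)
      = fun p ↦ (ε ^ 2)⁻¹ * (deriv W (u p) * φ p) := by ext p; ring
  rw [h2, vint_const_mul]
  field_simp at h0 ⊢
  linarith

/-- The weak maximum principle: if `Δf < 0` at every interior point of `O` where `f` attains its
minimum over the closure of `O`, then this minimum is attained on the boundary. For the proof,
test the equation with a nonnegative function `ψ ∘ f`, where `ψ` is nonincreasing, that is
supported near the set of minimum points. -/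
theorem WeakLaplacian.exists_frontier_le {f L : N → ℝ} (hf : ContMDiff I 𝓘(ℝ, ℝ) ∞ f)
    (hL : Continuous L) (hfL : WeakLaplacian g f L) {O : Set N} (hO : IsOpen O)
    (hneg : ∀ p ∈ O, (∀ q ∈ closure O, f p ≤ f q) → L p < 0) {p : N} (hp : p ∈ closure O) :
    ∃ q ∈ frontier O, f q ≤ f p := by
  by_contra! hcon
  have cf := hf.continuous
  have hcomp : IsCompact (closure O) := isClosed_closure.isCompact
  obtain ⟨p₀, hp₀, hmin⟩ := hcomp.exists_isMinOn ⟨p, hp⟩ cf.continuousOn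
  have hmin' : ∀ q ∈ closure O, f p₀ ≤ f q := fun q hq ↦ hmin hq
  have hfr : ∀ q ∈ frontier O, f p₀ < f q := fun q hq ↦ (hmin' p hp).trans_lt (hcon q hq)
  have hmem : ∀ q ∈ closure O, f q = f p₀ → q ∈ O := by
    intro q hq hqe
    by_contra hqO
    have : q ∈ frontier O := by rw [hO.frontier_eq]; exact ⟨hq, hqO⟩
    exact (hfr q this).ne' hqe
  obtain ⟨κ, hκ, hκO⟩ : ∃ κ > 0, ∀ q ∈ closure O, f q < f p₀ + κ → q ∈ O ∧ L q < 0 := by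
    have hKo : IsOpen (O ∩ {q | L q < 0}) := hO.inter (isOpen_lt hL continuous_const)
    have hKc : IsCompact (closure O \ (O ∩ {q | L q < 0})) := hcomp.diff hKo
    rcases (closure O \ (O ∩ {q | L q < 0})).eq_empty_or_nonempty with h | h
    · exact ⟨1, one_pos, fun q hq _ ↦ (sdiff_eq_empty.1 h) hq⟩
    · obtain ⟨q₁, hq₁, hmin₁⟩ := hKc.exists_isMinOn h cf.continuousOn
      refine ⟨f q₁ - f p₀, ?_, fun q hq hlt ↦ ?_⟩
      · rw [gt_iff_lt, sub_pos]
        refine lt_of_le_of_ne (hmin' q₁ hq₁.1) fun heq ↦ hq₁.2 ?_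
        have hq₁O := hmem q₁ hq₁.1 heq.symm
        exact ⟨hq₁O, hneg q₁ hq₁O (heq ▸ hmin')⟩
      · by_contra hcon'
        have : f q₁ ≤ f q := hmin₁ ⟨hq, hcon'⟩
        linarith
  set ψ : ℝ → ℝ := fun x ↦ expNegInvGlue (f p₀ + κ / 2 - x) with hψ
  have hψs : ContDiff ℝ ∞ ψ := expNegInvGlue.contDiff.comp (contDiff_const.sub contDiff_id)
  have hψanti : Antitone ψ := fun x y hxy ↦ expNegInvGlue.monotone (by linarith)
  classical
  set φ : N → ℝ := fun q ↦ if q ∈ O then ψ (f q) else 0 with hφdef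
  have hφO : ∀ q ∈ O, φ =ᶠ[𝓝 q] ψ ∘ f := fun q hq ↦ by
    filter_upwards [hO.mem_nhds hq] with r hr
    simp [φ, hr]
  have hφ0 : ∀ q ∉ O, φ =ᶠ[𝓝 q] fun _ ↦ 0 := by
    intro q hq
    by_cases hqc : q ∈ closure O
    · have hfq : f p₀ + κ / 2 < f q := by
        by_contra hle
        exact hq (hκO q hqc (by linarith)).1
      filter_upwards [cf.continuousAt.eventually (lt_mem_nhds hfq)] with r hr
      simp only [φ, ψ]
      split_ifs
      · exact expNegInvGlue.zero_of_nonpos (by linarith)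
      · rfl
    · filter_upwards [isClosed_closure.isOpen_compl.mem_nhds hqc] with r hr
      have : r ∉ O := fun h ↦ hr (subset_closure h)
      simp [φ, this]
  have hφs : ContMDiff I 𝓘(ℝ, ℝ) ∞ φ := by
    intro q
    by_cases hq : q ∈ O
    · exact (hψs.contMDiff.comp hf q).congr_of_eventuallyEq (hφO q hq)
    · exact contMDiffAt_const.congr_of_eventuallyEq (hφ0 q hq)
  have hfd : MDifferentiable I 𝓘(ℝ, ℝ) f := hf.mdifferentiable (by simp)
  have hneg1 : ∀ q, gradInner g f φ q ≤ 0 := by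
    intro q
    by_cases hq : q ∈ O
    · exact gradInner_comp_nonpos (hfd q) (hψs.differentiable (by simp) _).hasDerivAt
        hψanti.deriv_nonpos (hφO q hq)
    · exact gradInner_comp_nonpos (ψ := fun _ ↦ 0) (hfd q) (hasDerivAt_const _ _) le_rfl (hφ0 q hq)
  have hφnn : ∀ q, 0 ≤ φ q := fun q ↦ by
    simp only [φ]
    split_ifs
    exacts [expNegInvGlue.nonneg _, le_rfl]
  have hpos : 0 < vint g (fun q ↦ -1 * (L q * φ q)) := by
    refine vint_pos g (by have := hφs.continuous; fun_prop) (fun q ↦ ?_) (p := p₀) ?_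
    · rcases eq_or_ne (φ q) 0 with h | h
      · simp [h]
      · have hqO : q ∈ O := by
          by_contra hqO
          exact h (by simp [φ, hqO])
        have hψq : f q < f p₀ + κ / 2 := by
          by_contra hle
          exact h (by simp only [φ, hqO, if_true]; exact expNegInvGlue.zero_of_nonpos (by linarith))
        have := (hκO q (subset_closure hqO) (by linarith)).2
        nlinarith [mul_nonneg (neg_pos.2 this).le (hφnn q)]
    · have h1 := hκO p₀ hp₀ (by linarith)
      have h2 : 0 < φ p₀ := by
        simp only [φ, h1.1, if_true]
        exact expNegInvGlue.pos_of_pos (by linarith)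
      nlinarith [mul_pos (neg_pos.2 h1.2) h2]
  rw [vint_const_mul] at hpos
  have := hfL φ hφs
  have := vint_nonpos g hneg1
  linarith

end WeakLaplacian

/-! ### Isometries of the product and functions of the angle -/

section CircleIsometries

theorem circleMetric_inner_apply (z : Circle) (v w : TangentSpace (𝓡 1) z) :
    circleMetric.inner z v w = inner ℝ (mvfderiv (𝓡 1) (fun z : Circle ↦ (z : ℂ)) z v)
      (mvfderiv (𝓡 1) (fun z : Circle ↦ (z : ℂ)) z w) := rfl

theorem mdifferentiable_circle_coe :
    MDifferentiable (𝓡 1) 𝓘(ℝ, ℂ) (fun z : Circle ↦ (z : ℂ)) :=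
  contMDiff_circle_coe.mdifferentiable (by simp)

/-- A map of the circle that is the restriction of a linear isometry of `ℂ` is an isometry. -/
theorem circleMetric_inner_mfderiv {R : Circle → Circle} (hR : MDifferentiable (𝓡 1) (𝓡 1) R)
    (Λ : ℂ →ₗᵢ[ℝ] ℂ) (hΛ : ∀ z : Circle, (R z : ℂ) = Λ z) (z : Circle)
    (v w : TangentSpace (𝓡 1) z) :
    circleMetric.inner (R z) (mfderiv (𝓡 1) (𝓡 1) R z v) (mfderiv (𝓡 1) (𝓡 1) R z w)
      = circleMetric.inner z v w := by
  have key : ∀ v : TangentSpace (𝓡 1) z,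
      mvfderiv (𝓡 1) (fun z : Circle ↦ (z : ℂ)) (R z) (mfderiv (𝓡 1) (𝓡 1) R z v)
        = Λ (mvfderiv (𝓡 1) (fun z : Circle ↦ (z : ℂ)) z v) := by
    intro v
    have h1 := (mdifferentiable_circle_coe (R z)).hasMFDerivAt.comp z (hR z).hasMFDerivAt
    have h2 := (Λ.toContinuousLinearMap.hasFDerivAt (x := (z : ℂ))).hasMFDerivAt.comp z
      (mdifferentiable_circle_coe z).hasMFDerivAt
    have h3 : (fun z : Circle ↦ (z : ℂ)) ∘ R = Λ.toContinuousLinearMap ∘ fun z : Circle ↦ (z : ℂ) :=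
      funext hΛ
    rw [h3] at h1
    exact DFunLike.congr_fun (hasMFDerivAt_unique h1 h2) v
  rw [circleMetric_inner_apply, circleMetric_inner_apply, key, key, LinearIsometry.inner_map_map]

end CircleIsometries

section ProductIsometries
variable {d : ℕ} {M : Type*} [TopologicalSpace M] [ChartedSpace (EuclideanSpace ℝ (Fin d)) M]
  [IsManifold (𝓡 d) ∞ M]
  (gM : ContMDiffRiemannianMetric (𝓡 d) ∞ (EuclideanSpace ℝ (Fin d))
      (fun x : M ↦ TangentSpace (𝓡 d) x))

/-- The action on `S¹ × M` of a map of the circle. -/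
def circleAct (R : Circle → Circle) (p : Circle × M) : Circle × M := (R p.1, p.2)

omit [IsManifold (𝓡 d) ∞ M] in
theorem contMDiff_circleAct {R : Circle → Circle} (hR : ContMDiff (𝓡 1) (𝓡 1) ∞ R) :
    ContMDiff ((𝓡 1).prod (𝓡 d)) ((𝓡 1).prod (𝓡 d)) ∞ (circleAct R : Circle × M → Circle × M) :=
  (hR.comp contMDiff_fst).prodMk contMDiff_snd

theorem productMetric_inner_circleAct {R : Circle → Circle}
    (hR : ContMDiff (𝓡 1) (𝓡 1) ∞ R) (Λ : ℂ →ₗᵢ[ℝ] ℂ) (hΛ : ∀ z : Circle, (R z : ℂ) = Λ z)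
    (p : Circle × M) (v w : TangentSpace ((𝓡 1).prod (𝓡 d)) p) :
    (productMetric circleMetric gM).inner (circleAct R p)
        (mfderiv ((𝓡 1).prod (𝓡 d)) ((𝓡 1).prod (𝓡 d)) (circleAct R) p v)
        (mfderiv ((𝓡 1).prod (𝓡 d)) ((𝓡 1).prod (𝓡 d)) (circleAct R) p w)
      = (productMetric circleMetric gM).inner p v w := by
  have hRd : MDifferentiable (𝓡 1) (𝓡 1) R := hR.mdifferentiable (by simp)
  have h1 := (((hRd p.1).hasMFDerivAt).comp p (hasMFDerivAt_fst (I' := 𝓡 d) p)).prodMk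
    (hasMFDerivAt_snd (I := 𝓡 1) (I' := 𝓡 d) p)
  have h2 : ∀ v : TangentSpace ((𝓡 1).prod (𝓡 d)) p,
      mfderiv ((𝓡 1).prod (𝓡 d)) ((𝓡 1).prod (𝓡 d)) (circleAct R) p v
      = ((mfderiv (𝓡 1) (𝓡 1) R p.1
          (show EuclideanSpace ℝ (Fin 1) × EuclideanSpace ℝ (Fin d) from v).1,
        (show EuclideanSpace ℝ (Fin 1) × EuclideanSpace ℝ (Fin d) from v).2) :
          EuclideanSpace ℝ (Fin 1) × EuclideanSpace ℝ (Fin d)) := fun v ↦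
    DFunLike.congr_fun h1.mfderiv v
  rw [productMetric_inner_apply, productMetric_inner_apply, h2, h2]
  exact congr_arg₂ (· + ·) (circleMetric_inner_mfderiv hRd Λ hΛ p.1 _ _) rfl

theorem contMDiff_circle_mul (c : Circle) : ContMDiff (𝓡 1) (𝓡 1) ∞ (fun z : Circle ↦ c * z) :=
  contMDiff_mul_left

theorem contMDiff_circle_reflect (c : Circle) :
    ContMDiff (𝓡 1) (𝓡 1) ∞ (fun z : Circle ↦ c * z⁻¹) :=
  (contMDiff_circle_mul c).comp (contMDiff_inv (𝓡 1) ∞)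

/-- Multiplication by `c`, as an isometry of `ℂ`. -/
def rotationIsometry (c : Circle) : ℂ →ₗᵢ[ℝ] ℂ := (rotation c).toLinearIsometry

/-- The reflection `z ↦ c * conj z`, as an isometry of `ℂ`. -/
def reflectionIsometry (c : Circle) : ℂ →ₗᵢ[ℝ] ℂ :=
  (rotation c).toLinearIsometry.comp Complex.conjLIE.toLinearIsometry

theorem rotationIsometry_apply (c z : Circle) :
    ((c * z : Circle) : ℂ) = rotationIsometry c z := by
  simp [rotationIsometry]

theorem reflectionIsometry_apply (c z : Circle) :
    ((c * z⁻¹ : Circle) : ℂ) = reflectionIsometry c z := by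
  rw [Circle.coe_mul, Circle.coe_inv_eq_conj]
  simp [reflectionIsometry]

variable [CompactSpace M]

theorem vint_rotate (c : Circle) {f : Circle × M → ℝ} (hf : Continuous f) :
    vint (productMetric circleMetric gM) (fun p ↦ f (c * p.1, p.2))
      = vint (productMetric circleMetric gM) f := by
  have h1 := contMDiff_circle_mul c
  have h2 := contMDiff_circle_mul c⁻¹
  exact vint_comp _ (Φ := circleAct fun z ↦ c * z) (Ψ := circleAct fun z ↦ c⁻¹ * z)
    ((contMDiff_circleAct h1).mdifferentiable (by simp))
    ((contMDiff_circleAct h2).mdifferentiable (by simp))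
    (fun p ↦ by simp [circleAct]) (fun p ↦ by simp [circleAct])
    (productMetric_inner_circleAct gM h1 _ (rotationIsometry_apply c))
    (productMetric_inner_circleAct gM h2 _ (rotationIsometry_apply c⁻¹)) hf

theorem WeakLaplacian.reflect {f L : Circle × M → ℝ}
    (hf : ContMDiff ((𝓡 1).prod (𝓡 d)) 𝓘(ℝ, ℝ) ∞ f) (hL : Continuous L)
    (h : WeakLaplacian (productMetric circleMetric gM) f L) (c : Circle) :
    WeakLaplacian (productMetric circleMetric gM) (fun p ↦ f (c * p.1⁻¹, p.2))
      (fun p ↦ L (c * p.1⁻¹, p.2)) := by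
  have h1 := contMDiff_circle_reflect c
  exact WeakLaplacian.comp (Φ := circleAct fun z ↦ c * z⁻¹) (Ψ := circleAct fun z ↦ c * z⁻¹)
    (contMDiff_circleAct h1) (contMDiff_circleAct h1)
    (fun p ↦ by simp [circleAct]) (fun p ↦ by simp [circleAct])
    (productMetric_inner_circleAct gM h1 _ (reflectionIsometry_apply c))
    (productMetric_inner_circleAct gM h1 _ (reflectionIsometry_apply c)) hf hL h

end ProductIsometries

section AngularDerivative

/-- The unit tangent field of the circle, the velocity of `t ↦ exp (i t) z` at `t = 0`. -/
def circleField (z : Circle) : TangentSpace (𝓡 1) z :=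
  mfderiv 𝓘(ℝ, ℝ) (𝓡 1) (fun t : ℝ ↦ Circle.exp t * z) 0 (1 : ℝ)

theorem contMDiff_circle_orbit (z : Circle) :
    ContMDiff 𝓘(ℝ, ℝ) (𝓡 1) ∞ (fun t : ℝ ↦ Circle.exp t * z) :=
  contMDiff_mul_right.comp contMDiff_circleExp

theorem mvfderiv_circleField {h : Circle → ℝ} (hh : MDifferentiable (𝓡 1) 𝓘(ℝ, ℝ) h) (z : Circle) :
    HasDerivAt (fun t : ℝ ↦ h (Circle.exp t * z)) (mvfderiv (𝓡 1) h z (circleField z)) 0 := by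
  have h0 : Circle.exp 0 * z = z := by simp
  have h1 := ((contMDiff_circle_orbit z).mdifferentiable (by simp) 0).hasMFDerivAt
  have h2 : HasMFDerivAt (𝓡 1) 𝓘(ℝ, ℝ) h (Circle.exp 0 * z) (mfderiv (𝓡 1) 𝓘(ℝ, ℝ) h z) := by
    rw [h0]
    exact (hh z).hasMFDerivAt
  let D : ℝ →L[ℝ] ℝ := (mfderiv (𝓡 1) 𝓘(ℝ, ℝ) h z).comp
    (mfderiv 𝓘(ℝ, ℝ) (𝓡 1) (fun t : ℝ ↦ Circle.exp t * z) 0)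
  have h3 : HasFDerivAt (fun t : ℝ ↦ h (Circle.exp t * z)) D 0 := (h2.comp 0 h1).hasFDerivAt
  exact h3.hasDerivAt

theorem hasDerivAt_circle_exp (z : Circle) :
    HasDerivAt (fun t : ℝ ↦ ((Circle.exp t * z : Circle) : ℂ)) (Complex.I * z) 0 := by
  have h5 : HasDerivAt (fun t : ℝ ↦ Complex.exp (t * Complex.I)) Complex.I 0 := by
    have h6 := ((hasDerivAt_id (0 : ℝ)).ofReal_comp.mul_const Complex.I).cexp
    simpa using h6
  simpa using h5.mul_const (z : ℂ)

theorem circleMetric_circleField (z : Circle) :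
    circleMetric.inner z (circleField z) (circleField z) = 1 := by
  have h0 : Circle.exp 0 * z = z := by simp
  have h1 := ((contMDiff_circle_orbit z).mdifferentiable (by simp) 0).hasMFDerivAt
  have h2 : HasMFDerivAt (𝓡 1) 𝓘(ℝ, ℂ) (fun z : Circle ↦ (z : ℂ)) (Circle.exp 0 * z)
      (mfderiv (𝓡 1) 𝓘(ℝ, ℂ) (fun z : Circle ↦ (z : ℂ)) z) := by
    rw [h0]
    exact (mdifferentiable_circle_coe z).hasMFDerivAt
  let D : ℝ →L[ℝ] ℂ := (mfderiv (𝓡 1) 𝓘(ℝ, ℂ) (fun z : Circle ↦ (z : ℂ)) z).comp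
    (mfderiv 𝓘(ℝ, ℝ) (𝓡 1) (fun t : ℝ ↦ Circle.exp t * z) 0)
  have h3 : HasFDerivAt (fun t : ℝ ↦ ((Circle.exp t * z : Circle) : ℂ)) D 0 :=
    (h2.comp 0 h1).hasFDerivAt
  have h7 : mvfderiv (𝓡 1) (fun z : Circle ↦ (z : ℂ)) z (circleField z) = Complex.I * z :=
    h3.hasDerivAt.unique (hasDerivAt_circle_exp z)
  rw [circleMetric_inner_apply, h7, real_inner_self_eq_norm_sq, norm_mul, Complex.norm_I,
    Circle.norm_coe]
  norm_num

theorem exists_smul_circleField (z : Circle) (v : TangentSpace (𝓡 1) z) :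
    ∃ c : ℝ, c • circleField z = v := by
  have hne : circleField z ≠ 0 := by
    intro h
    have := circleMetric_circleField z
    rw [h] at this
    simp at this
  have key : ∀ X Y : EuclideanSpace ℝ (Fin 1), X ≠ 0 → ∃ c : ℝ, c • X = Y := fun X Y hX ↦
    (finrank_eq_one_iff_of_nonzero' X hX).1 (by simp) Y
  exact key (circleField z) v hne

variable {d : ℕ} {M : Type*} [TopologicalSpace M] [ChartedSpace (EuclideanSpace ℝ (Fin d)) M]
  [IsManifold (𝓡 d) ∞ M]
  (gM : ContMDiffRiemannianMetric (𝓡 d) ∞ (EuclideanSpace ℝ (Fin d))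
      (fun x : M ↦ TangentSpace (𝓡 d) x))

/-- The horizontal lift of the unit tangent field of the circle to `S¹ × M`. -/
def liftedField (p : Circle × M) : TangentSpace ((𝓡 1).prod (𝓡 d)) p :=
  ((circleField p.1, 0) : EuclideanSpace ℝ (Fin 1) × EuclideanSpace ℝ (Fin d))

theorem hasDerivAt_of_comp_prod {E₁ E₂ : Type*} [NormedAddCommGroup E₁] [NormedSpace ℝ E₁]
    [NormedAddCommGroup E₂] [NormedSpace ℝ E₂] {f : ℝ → ℝ} {t : ℝ} (D₁ : ℝ →L[ℝ] E₁)
    (D₂ : E₁ × E₂ →L[ℝ] ℝ) (h : HasFDerivAt f (D₂.comp (D₁.prod 0)) t) :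
    HasDerivAt f (D₂ (D₁ 1, 0)) t :=
  h.hasDerivAt

omit [IsManifold (𝓡 d) ∞ M] in
theorem hasDerivAt_liftedField {φ : Circle × M → ℝ}
    (hφ : MDifferentiable ((𝓡 1).prod (𝓡 d)) 𝓘(ℝ, ℝ) φ) (p : Circle × M) :
    HasDerivAt (fun t : ℝ ↦ φ (Circle.exp t * p.1, p.2))
      (mvfderiv ((𝓡 1).prod (𝓡 d)) φ p (liftedField p)) 0 := by
  have h0 : (Circle.exp 0 * p.1, p.2) = p := by simp
  have h1 := (((contMDiff_circle_orbit p.1).mdifferentiable (by simp) 0).hasMFDerivAt).prodMk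
    (hasMFDerivAt_const (I := 𝓘(ℝ, ℝ)) (I' := 𝓡 d) p.2 (0 : ℝ))
  have h2 : HasMFDerivAt ((𝓡 1).prod (𝓡 d)) 𝓘(ℝ, ℝ) φ (Circle.exp 0 * p.1, p.2)
      (mfderiv ((𝓡 1).prod (𝓡 d)) 𝓘(ℝ, ℝ) φ p) := by
    rw [h0]
    exact (hφ p).hasMFDerivAt
  exact hasDerivAt_of_comp_prod (E₁ := EuclideanSpace ℝ (Fin 1)) (E₂ := EuclideanSpace ℝ (Fin d))
    (mfderiv 𝓘(ℝ, ℝ) (𝓡 1) (fun t : ℝ ↦ Circle.exp t * p.1) 0)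
    (mfderiv ((𝓡 1).prod (𝓡 d)) 𝓘(ℝ, ℝ) φ p) (h2.comp 0 h1).hasFDerivAt

theorem hasDerivAt_exp_mul {X : Type*} {f f' : Circle × X → ℝ}
    (h : ∀ p, HasDerivAt (fun t : ℝ ↦ f (Circle.exp t * p.1, p.2)) (f' p) 0)
    (p : Circle × X) (t : ℝ) :
    HasDerivAt (fun t : ℝ ↦ f (Circle.exp t * p.1, p.2)) (f' (Circle.exp t * p.1, p.2)) t := by
  have h1 := h (Circle.exp t * p.1, p.2)
  have h2 : HasDerivAt (fun s : ℝ ↦ s - t) 1 t := (hasDerivAt_id t).sub_const t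
  have h3 := HasDerivAt.comp (h₂ := fun s : ℝ ↦ f (Circle.exp s * (Circle.exp t * p.1), p.2)) t
    (by rw [sub_self]; exact h1) h2
  rw [mul_one] at h3
  refine h3.congr_of_eventuallyEq (Eventually.of_forall fun s ↦ ?_)
  simp only [Function.comp_apply]
  rw [← mul_assoc, ← Circle.exp_add, sub_add_cancel]

/-- The gradient of a function of the circle variable is a multiple of the angular field. -/
theorem gradInner_comp_fst {h h₁ : Circle → ℝ} (hh : ContMDiff (𝓡 1) 𝓘(ℝ, ℝ) ∞ h)
    (hd : ∀ z, HasDerivAt (fun t : ℝ ↦ h (Circle.exp t * z)) (h₁ z) 0)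
    (φ : Circle × M → ℝ) (p : Circle × M) :
    gradInner (productMetric circleMetric gM) (fun p ↦ h p.1) φ p
      = h₁ p.1 * mvfderiv ((𝓡 1).prod (𝓡 d)) φ p (liftedField p) := by
  have hhd := hh.mdifferentiable (n := ∞) (by simp)
  have hX : mvfderiv (𝓡 1) h p.1 (circleField p.1) = h₁ p.1 :=
    (mvfderiv_circleField hhd p.1).unique (hd p.1)
  have hgrad : riemannianGradient (productMetric circleMetric gM) (fun p ↦ h p.1) p
      = h₁ p.1 • liftedField p := by
    refine riemannianGradient_eq _ fun w ↦ ?_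
    obtain ⟨c, hc⟩ := exists_smul_circleField p.1
      (show EuclideanSpace ℝ (Fin 1) × EuclideanSpace ℝ (Fin d) from w).1
    have h1 : mvfderiv ((𝓡 1).prod (𝓡 d)) (fun p : Circle × M ↦ h p.1) p w
        = mvfderiv (𝓡 1) h p.1
          (show EuclideanSpace ℝ (Fin 1) × EuclideanSpace ℝ (Fin d) from w).1 :=
      DFunLike.congr_fun ((hhd p.1).hasMFDerivAt.comp p (hasMFDerivAt_fst (I' := 𝓡 d) p)).mfderiv w
    have h2 : circleMetric.inner p.1 (circleField p.1) (c • circleField p.1) = c := by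
      rw [map_smul, circleMetric_circleField]
      simp
    have h3 : (productMetric circleMetric gM).inner p (liftedField p) w = c := by
      rw [productMetric_inner_apply, ← hc]
      refine (congr_arg₂ (· + ·) h2 ?_).trans (add_zero c)
      have h4 : gM.inner p.2 0 = 0 := map_zero _
      exact DFunLike.congr_fun h4 _
    rw [h1, ← hc, map_smul, map_smul, smul_apply, h3, hX, smul_eq_mul, smul_eq_mul, mul_comm]
  rw [gradInner_comm, gradInner_eq_mvfderiv, hgrad, map_smul, smul_eq_mul]

variable [CompactSpace M]

/-- The weak Laplacian of a function of the circle variable is its second derivative in the angle,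
by integration by parts: the integral of an angular derivative vanishes, as the volume is invariant
under rotations. -/
theorem weakLaplacian_comp_fst {h h₁ h₂ : Circle → ℝ} (hh : ContMDiff (𝓡 1) 𝓘(ℝ, ℝ) ∞ h)
    (hh₁ : ContMDiff (𝓡 1) 𝓘(ℝ, ℝ) ∞ h₁) (hh₂ : Continuous h₂)
    (hd : ∀ z, HasDerivAt (fun t : ℝ ↦ h (Circle.exp t * z)) (h₁ z) 0)
    (hd₁ : ∀ z, HasDerivAt (fun t : ℝ ↦ h₁ (Circle.exp t * z)) (h₂ z) 0) :
    WeakLaplacian (productMetric circleMetric gM) (fun p ↦ h p.1) (fun p ↦ h₂ p.1) := by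
  intro φ hφ
  set g := productMetric circleMetric gM
  set G := gradInner g (fun p ↦ h p.1) φ with hG
  have hhN : ContMDiff ((𝓡 1).prod (𝓡 d)) 𝓘(ℝ, ℝ) ∞ (fun p : Circle × M ↦ h p.1) :=
    hh.comp contMDiff_fst
  have cG : Continuous G := continuous_gradInner g hhN hφ
  have cφ := hφ.continuous
  have ch₁ := hh₁.continuous
  have hder : ∀ p : Circle × M, HasDerivAt (fun t : ℝ ↦ (fun q : Circle × M ↦ h₁ q.1 * φ q)
      (Circle.exp t * p.1, p.2)) ((fun q : Circle × M ↦ h₂ q.1 * φ q + G q) p) 0 := by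
    intro p
    have h1 := HasDerivAt.fun_mul (hd₁ p.1) (hasDerivAt_liftedField (hφ.mdifferentiable (by simp)) p)
    simp only [hG, g, gradInner_comp_fst gM hh hd φ p]
    simpa using h1
  have hcirc : Continuous fun t : ℝ ↦ Circle.exp t := Circle.exp.continuous
  have h := hasDerivAt_vint g (F := fun t p ↦ (fun q : Circle × M ↦ h₁ q.1 * φ q)
      (Circle.exp t * p.1, p.2)) (F' := fun t p ↦ (fun q : Circle × M ↦ h₂ q.1 * φ q + G q)
      (Circle.exp t * p.1, p.2)) (fun t ↦ by fun_prop)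
      (by simp only [Function.uncurry_def]; fun_prop) (fun t p ↦ hasDerivAt_exp_mul
        (f := fun q : Circle × M ↦ h₁ q.1 * φ q) (f' := fun q ↦ h₂ q.1 * φ q + G q) hder p t) 0
  have hconst : ∀ t : ℝ, vint g (fun p ↦ (fun q : Circle × M ↦ h₁ q.1 * φ q)
      (Circle.exp t * p.1, p.2)) = vint g (fun q : Circle × M ↦ h₁ q.1 * φ q) :=
    fun t ↦ vint_rotate gM (Circle.exp t) (f := fun q : Circle × M ↦ h₁ q.1 * φ q) (by fun_prop)
  simp only [hconst] at h
  have h0 := h.unique (hasDerivAt_const _ _)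
  simp only [Circle.exp_zero, one_mul, Prod.mk.eta] at h0
  rw [vint_add g (by fun_prop) cG] at h0
  linarith

end AngularDerivative

/-! ### Double-well potentials and slabs -/

section DoubleWell
variable {W : ℝ → ℝ}

theorem IsDoubleWell.deriv_neg (hW : IsDoubleWell W) (x : ℝ) : deriv W (-x) = -deriv W x := by
  have h : W = fun x ↦ W (-x) := funext hW.even
  conv_rhs => rw [h, deriv_comp_neg]
  simp

theorem IsDoubleWell.deriv_one (hW : IsDoubleWell W) : deriv W 1 = 0 := by
  have h1 : W 1 = 0 := (hW.eq_zero_iff 1).2 (Or.inl rfl)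
  refine IsLocalMin.deriv_eq_zero (Eventually.of_forall fun x ↦ ?_)
  rw [h1]
  exact hW.nonneg x

theorem IsDoubleWell.sign_deriv (hW : IsDoubleWell W) :
    ∀ᶠ x in 𝓝 (1 : ℝ), SignType.sign (deriv W x) = SignType.sign (x - 1) := by
  refine eventually_nhdsWithin_sign_eq_of_deriv_pos ?_ hW.deriv_one
  have := hW.deriv_two_pos.1
  rwa [iteratedDeriv_succ, iteratedDeriv_one] at this

theorem IsDoubleWell.exists_deriv_nonneg (hW : IsDoubleWell W) :
    ∃ κ ∈ Ioc (0 : ℝ) 1, ∀ x ∈ Icc 1 (1 + κ), 0 ≤ deriv W x := by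
  obtain ⟨r, hr, h⟩ := Metric.eventually_nhds_iff.1 hW.sign_deriv
  refine ⟨min (r / 2) 1, ⟨by positivity, min_le_right _ _⟩, fun x hx ↦ ?_⟩
  have h1 : dist x 1 < r := by
    rw [Real.dist_eq, abs_of_nonneg (by linarith [hx.1])]
    have := min_le_left (r / 2) 1
    linarith [hx.2]
  have h2 := h h1
  rw [← sign_nonneg_iff, h2, sign_nonneg_iff]
  linarith [hx.1]

/-- Below `1 - η` the quotient `W' (x) / x` is bounded away from zero. -/
theorem IsDoubleWell.exists_deriv_le (hW : IsDoubleWell W) {η : ℝ} (hη : 0 < η) :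
    ∃ c > 0, ∀ x ∈ Ioc 0 (1 - η), deriv W x ≤ -c * x := by
  obtain ⟨r, hr, h⟩ := Metric.eventually_nhds_iff.1 hW.sign_deriv
  set y := 1 - min (min (r / 2) η) (1 / 2) with hy
  have hm : 0 < min (min (r / 2) η) (1 / 2) := by positivity
  have hm1 : min (min (r / 2) η) (1 / 2) ≤ r / 2 := (min_le_left _ _).trans (min_le_left _ _)
  have hm2 : min (min (r / 2) η) (1 / 2) ≤ η := (min_le_left _ _).trans (min_le_right _ _)
  have hm3 : min (min (r / 2) η) (1 / 2) ≤ 1 / 2 := min_le_right _ _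
  have hy0 : 0 < y := by linarith
  have hy1 : y < 1 := by linarith
  have hWy : deriv W y < 0 := by
    rw [← sign_eq_neg_one_iff, h, sign_eq_neg_one_iff]
    · linarith
    · rw [Real.dist_eq, abs_of_neg (by linarith)]
      linarith
  refine ⟨-(deriv W y / y), neg_pos.2 (div_neg_of_neg_of_pos hWy hy0), fun x hx ↦ ?_⟩
  have hmono := hW.monotoneOn (a := x) (b := y) ⟨hx.1, by linarith [hx.2]⟩ ⟨hy0, hy1⟩
    (by linarith [hx.2])
  simp only at hmono
  rw [div_le_iff₀ hx.1] at hmono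
  linarith

theorem IsDoubleWell.deriv_nonpos (hW : IsDoubleWell W) {x : ℝ} (hx : x ∈ Ioc 0 1) :
    deriv W x ≤ 0 := by
  rcases hx.2.eq_or_lt with rfl | hx1
  · exact hW.deriv_one.le
  · obtain ⟨c, hc, h⟩ := hW.exists_deriv_le (sub_pos.2 hx1)
    have := h x ⟨hx.1, by linarith⟩
    nlinarith [mul_pos hc hx.1]

/-- Multiples of positive solutions are supersolutions: `λ W' (x) ≤ W' (λ x)` for `1 ≤ λ`. -/
theorem IsDoubleWell.mul_deriv_le (hW : IsDoubleWell W) {κ : ℝ}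
    (hκ : ∀ x ∈ Icc 1 (1 + κ), 0 ≤ deriv W x) {l x : ℝ} (hl : 1 ≤ l) (hx : x ∈ Ioc 0 1)
    (hlx : l * x ≤ 1 + κ) : l * deriv W x ≤ deriv W (l * x) := by
  have hl0 : 0 < l := one_pos.trans_le hl
  have hle : x ≤ l * x := le_mul_of_one_le_left hx.1.le hl
  rcases lt_or_ge (l * x) 1 with h | h
  · have hmono := hW.monotoneOn (a := x) (b := l * x) ⟨hx.1, hle.trans_lt h⟩
      ⟨mul_pos hl0 hx.1, h⟩ hle
    simp only at hmono
    rw [div_le_div_iff₀ hx.1 (mul_pos hl0 hx.1)] at hmono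
    have := hx.1
    nlinarith
  · exact (mul_nonpos_of_nonneg_of_nonpos hl0.le (hW.deriv_nonpos hx)).trans (hκ _ ⟨h, hlx⟩)

theorem IsDoubleWell.exists_lipschitz (hW : IsDoubleWell W) :
    ∃ C > 0, ∀ a ∈ Icc (-2 : ℝ) 2, ∀ b ∈ Icc (-2 : ℝ) 2, b ≤ a →
      deriv W a - deriv W b ≤ C * (a - b) := by
  have hd : ContDiff ℝ 1 (deriv W) := (contDiff_infty_iff_deriv.1 hW.smooth).2.of_le (by simp)
  obtain ⟨C, hC⟩ := (isCompact_Icc (a := (-2 : ℝ)) (b := 2)).exists_bound_of_continuousOn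
    (hd.continuous_deriv le_rfl).continuousOn
  refine ⟨max C 1, by positivity, fun a ha b hb hab ↦ ?_⟩
  have h := (convex_Icc (-2 : ℝ) 2).norm_image_sub_le_of_norm_deriv_le
    (fun x _ ↦ hd.differentiable (by simp) x) hC hb ha
  rw [Real.norm_eq_abs, Real.norm_eq_abs, abs_of_nonneg (sub_nonneg.2 hab)] at h
  calc _ ≤ _ := (le_abs_self _).trans h
    _ ≤ _ := by gcongr; exacts [le_max_left _ _]

end DoubleWell

section Slab
variable {M : Type*} [TopologicalSpace M]

/-- The point of `S¹ × M` over `x` whose first component is `ζ` rotated by the angle `t`. -/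
def arcPoint (ζ : Circle) (t : ℝ) (x : M) : Circle × M := (Circle.exp t * ζ, x)

omit [TopologicalSpace M] in
@[simp] theorem arcPoint_zero (ζ : Circle) (x : M) : arcPoint ζ 0 x = (ζ, x) := by
  simp [arcPoint]

omit [TopologicalSpace M] in
theorem arcPoint_exp_mul (ζ : Circle) (s t : ℝ) (x : M) :
    arcPoint (Circle.exp s * ζ) t x = arcPoint ζ (t + s) x := by
  simp [arcPoint, Circle.exp_add, mul_assoc]

theorem continuous_arcPoint (ζ : Circle) :
    Continuous fun q : ℝ × M ↦ arcPoint ζ q.1 q.2 := by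
  have hc : Continuous fun t : ℝ ↦ Circle.exp t := Circle.exp.continuous
  unfold arcPoint
  fun_prop

/-- The part of `S¹ × M` over a set `T` of angles and a subset `M₀` of `M`. -/
def slab (ζ : Circle) (T : Set ℝ) (M₀ : Set M) : Set (Circle × M) :=
  (fun q : ℝ × M ↦ arcPoint ζ q.1 q.2) '' (T ×ˢ M₀)

theorem isOpen_slab (ζ : Circle) {T : Set ℝ} {M₀ : Set M} (hT : IsOpen T) (hM : IsOpen M₀) :
    IsOpen (slab ζ T M₀) := by
  have h1 : IsOpenMap fun t : ℝ ↦ Circle.exp t * ζ :=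
    (Homeomorph.mulRight ζ).isOpenMap.comp isLocalHomeomorph_circleExp.isOpenMap
  have h2 : IsOpenMap fun q : ℝ × M ↦ arcPoint ζ q.1 q.2 := h1.prodMap IsOpenMap.id
  exact h2 _ (hT.prod hM)

theorem isCompact_slab (ζ : Circle) {T : Set ℝ} {M₀ : Set M} (hT : IsCompact T)
    (hM : IsCompact M₀) : IsCompact (slab ζ T M₀) :=
  (hT.prod hM).image (continuous_arcPoint ζ)

omit [TopologicalSpace M] in
theorem slab_mem {ζ : Circle} {T : Set ℝ} {M₀ : Set M} {t : ℝ} {x : M} (ht : t ∈ T) (hx : x ∈ M₀) :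
    arcPoint ζ t x ∈ slab ζ T M₀ := ⟨(t, x), ⟨ht, hx⟩, rfl⟩

theorem closure_slab [T2Space M] [CompactSpace M] (ζ : Circle) {a b : ℝ} (hab : a < b) {M₀ : Set M}
    (hM : IsClopen M₀) : closure (slab ζ (Ioo a b) M₀) = slab ζ (Icc a b) M₀ := by
  refine subset_antisymm ?_ ?_
  · refine closure_minimal (image_mono (prod_mono Ioo_subset_Icc_self subset_rfl)) ?_
    exact (isCompact_slab ζ isCompact_Icc hM.isClosed.isCompact).isClosed
  · have h := image_closure_subset_closure_image (continuous_arcPoint (M := M) ζ)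
      (s := Ioo a b ×ˢ M₀)
    rwa [closure_prod_eq, closure_Ioo hab.ne, hM.isClosed.closure_eq] at h

theorem frontier_slab_subset [T2Space M] [CompactSpace M] (ζ : Circle) {a b : ℝ} (hab : a < b)
    {M₀ : Set M} (hM : IsClopen M₀) : frontier (slab ζ (Ioo a b) M₀) ⊆ slab ζ {a, b} M₀ := by
  rw [(isOpen_slab ζ isOpen_Ioo hM.isOpen).frontier_eq, closure_slab ζ hab hM]
  rintro _ ⟨⟨⟨t, x⟩, ⟨ht, hx⟩, rfl⟩, hn⟩
  refine slab_mem ?_ hx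
  by_contra h
  simp only [mem_insert_iff, mem_singleton_iff, not_or] at h
  exact hn (slab_mem ⟨lt_of_le_of_ne ht.1 (Ne.symm h.1), lt_of_le_of_ne ht.2 h.2⟩ hx)

end Slab

section MaximumPrinciple
variable {d : ℕ} {M : Type*} [TopologicalSpace M] [T2Space M] [CompactSpace M]
  [ChartedSpace (EuclideanSpace ℝ (Fin d)) M] [IsManifold (𝓡 d) ∞ M]
  {gM : ContMDiffRiemannianMetric (𝓡 d) ∞ (EuclideanSpace ℝ (Fin d))
      (fun x : M ↦ TangentSpace (𝓡 d) x)}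

/-- The maximum principle on a slab, in coordinates. -/
theorem WeakLaplacian.exists_endpoint_le {f L : Circle × M → ℝ}
    (hf : ContMDiff ((𝓡 1).prod (𝓡 d)) 𝓘(ℝ, ℝ) ∞ f) (hL : Continuous L)
    (hfL : WeakLaplacian (productMetric circleMetric gM) f L) (ζ : Circle) {a b : ℝ} (hab : a < b)
    {M₀ : Set M} (hM : IsClopen M₀)
    (hneg : ∀ t ∈ Ioo a b, ∀ x ∈ M₀,
      (∀ s ∈ Icc a b, ∀ y ∈ M₀, f (arcPoint ζ t x) ≤ f (arcPoint ζ s y)) → L (arcPoint ζ t x) < 0)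
    {t : ℝ} (ht : t ∈ Icc a b) {x : M} (hx : x ∈ M₀) :
    ∃ y ∈ M₀, f (arcPoint ζ a y) ≤ f (arcPoint ζ t x) ∨ f (arcPoint ζ b y) ≤ f (arcPoint ζ t x) := by
  obtain ⟨q, hq, hle⟩ := WeakLaplacian.exists_frontier_le hf hL hfL
    (isOpen_slab ζ isOpen_Ioo hM.isOpen) (O := slab ζ (Ioo a b) M₀) (p := arcPoint ζ t x) (by
      rintro _ ⟨⟨s, y⟩, ⟨hs, hy⟩, rfl⟩ hmin
      refine hneg s hs y hy fun s' hs' y' hy' ↦ hmin _ ?_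
      rw [closure_slab ζ hab hM]
      exact slab_mem hs' hy') (by rw [closure_slab ζ hab hM]; exact slab_mem ht hx)
  obtain ⟨⟨s, y⟩, ⟨hs, hy⟩, rfl⟩ := frontier_slab_subset ζ hab hM hq
  rcases hs with rfl | rfl
  exacts [⟨y, hy, Or.inl hle⟩, ⟨y, hy, Or.inr hle⟩]

end MaximumPrinciple

/-! ### Comparison functions of the angle -/

section Trigonometric
variable {d : ℕ} {M : Type*} [TopologicalSpace M] [CompactSpace M]
  [ChartedSpace (EuclideanSpace ℝ (Fin d)) M] [IsManifold (𝓡 d) ∞ M]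
  (gM : ContMDiffRiemannianMetric (𝓡 d) ∞ (EuclideanSpace ℝ (Fin d))
      (fun x : M ↦ TangentSpace (𝓡 d) x))

theorem hasDerivAt_circle_pow_div (ζ z : Circle) (k : ℕ) :
    HasDerivAt (fun t : ℝ ↦ (((Circle.exp t * z / ζ : Circle) : ℂ)) ^ k)
      (k * Complex.I * ((z / ζ : Circle) : ℂ) ^ k) 0 := by
  have h := ((hasDerivAt_circle_exp (z / ζ)).pow k)
  simp only [Circle.exp_zero, one_mul, ← mul_div_assoc] at h
  refine h.congr_deriv ?_
  rcases k with _ | k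
  · simp
  · simp only [Nat.add_sub_cancel, pow_succ]
    ring

theorem hasDerivAt_re_circle_pow_div (ζ z : Circle) (k : ℕ) :
    HasDerivAt (fun t : ℝ ↦ ((((Circle.exp t * z / ζ : Circle) : ℂ)) ^ k).re)
      (-k * (((z / ζ : Circle) : ℂ) ^ k).im) 0 := by
  have h := Complex.reCLM.hasFDerivAt.comp_hasDerivAt (0 : ℝ) (hasDerivAt_circle_pow_div ζ z k)
  refine h.congr_deriv ?_
  simp [mul_assoc]

theorem hasDerivAt_im_circle_pow_div (ζ z : Circle) (k : ℕ) :
    HasDerivAt (fun t : ℝ ↦ ((((Circle.exp t * z / ζ : Circle) : ℂ)) ^ k).im)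
      (k * (((z / ζ : Circle) : ℂ) ^ k).re) 0 := by
  have h := Complex.imCLM.hasFDerivAt.comp_hasDerivAt (0 : ℝ) (hasDerivAt_circle_pow_div ζ z k)
  refine h.congr_deriv ?_
  simp [mul_assoc]

theorem contMDiff_circle_pow_div (ζ : Circle) (k : ℕ) :
    ContMDiff (𝓡 1) 𝓘(ℝ, ℂ) ∞ (fun z : Circle ↦ ((z / ζ : Circle) : ℂ) ^ k) := by
  have h1 : ContMDiff (𝓡 1) 𝓘(ℝ, ℂ) ∞ (fun z : Circle ↦ ((z / ζ : Circle) : ℂ)) := by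
    simp only [div_eq_mul_inv]
    exact contMDiff_circle_coe.comp contMDiff_mul_right
  exact (contDiff_id.pow k).contMDiff.comp h1

theorem contMDiff_re_circle_pow_div (ζ : Circle) (k : ℕ) :
    ContMDiff (𝓡 1) 𝓘(ℝ, ℝ) ∞ (fun z : Circle ↦ (((z / ζ : Circle) : ℂ) ^ k).re) :=
  Complex.reCLM.contDiff.contMDiff.comp (contMDiff_circle_pow_div ζ k)

theorem contMDiff_im_circle_pow_div (ζ : Circle) (k : ℕ) :
    ContMDiff (𝓡 1) 𝓘(ℝ, ℝ) ∞ (fun z : Circle ↦ (((z / ζ : Circle) : ℂ) ^ k).im) :=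
  Complex.imCLM.contDiff.contMDiff.comp (contMDiff_circle_pow_div ζ k)

omit [TopologicalSpace M] [CompactSpace M] in
theorem re_arcPoint_pow (ζ : Circle) (k : ℕ) (t : ℝ) (x : M) :
    ((((arcPoint ζ t x).1 / ζ : Circle) : ℂ) ^ k).re = Real.cos (k * t) := by
  have : (((arcPoint ζ t x).1 / ζ : Circle) : ℂ) ^ k = Complex.exp ((k * t : ℝ) * Complex.I) := by
    simp only [arcPoint, mul_div_assoc, div_self', mul_one, Circle.coe_exp, ← Complex.exp_nat_mul]
    push_cast
    ring_nf
  rw [this, Complex.exp_ofReal_mul_I_re]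

/-- The function `cos (k t)` of the angle `t` from `ζ`. -/
theorem weakLaplacian_cos (ζ : Circle) (k : ℕ) :
    WeakLaplacian (productMetric circleMetric gM)
      (fun p ↦ (((p.1 / ζ : Circle) : ℂ) ^ k).re)
      (fun p ↦ -(k : ℝ) * (k * (((p.1 / ζ : Circle) : ℂ) ^ k).re)) := by
  refine weakLaplacian_comp_fst gM (h := fun z ↦ (((z / ζ : Circle) : ℂ) ^ k).re)
    (h₁ := fun z ↦ -(k : ℝ) * (((z / ζ : Circle) : ℂ) ^ k).im)
    (h₂ := fun z ↦ -(k : ℝ) * (k * (((z / ζ : Circle) : ℂ) ^ k).re))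
    (contMDiff_re_circle_pow_div ζ k) (contMDiff_const.mul (contMDiff_im_circle_pow_div ζ k))
    ?_ (fun z ↦ hasDerivAt_re_circle_pow_div ζ z k)
    (fun z ↦ (hasDerivAt_im_circle_pow_div ζ z k).const_mul _)
  have := (contMDiff_re_circle_pow_div ζ k).continuous
  fun_prop

section Exponential
variable {x y : Circle → ℝ}

theorem contMDiff_exp_mul (cy : ContMDiff (𝓡 1) 𝓘(ℝ, ℝ) ∞ y) (K : ℝ) :
    ContMDiff (𝓡 1) 𝓘(ℝ, ℝ) ∞ fun z ↦ Real.exp (K * y z) :=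
  Real.contDiff_exp.contMDiff.comp (contMDiff_const.mul cy)

theorem hasDerivAt_exp_mul_circle
    (dy : ∀ z, HasDerivAt (fun t : ℝ ↦ y (Circle.exp t * z)) (x z) 0) (K : ℝ) (z : Circle) :
    HasDerivAt (fun t : ℝ ↦ Real.exp (K * y (Circle.exp t * z))) (K * x z * Real.exp (K * y z)) 0 :=
  (((dy z).const_mul K).exp).congr_deriv (by simp only [Circle.exp_zero, one_mul]; ring)

theorem weakLaplacian_exp_mul (cx : ContMDiff (𝓡 1) 𝓘(ℝ, ℝ) ∞ x)
    (cy : ContMDiff (𝓡 1) 𝓘(ℝ, ℝ) ∞ y)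
    (dx : ∀ z, HasDerivAt (fun t : ℝ ↦ x (Circle.exp t * z)) (-y z) 0)
    (dy : ∀ z, HasDerivAt (fun t : ℝ ↦ y (Circle.exp t * z)) (x z) 0) (K : ℝ) :
    WeakLaplacian (productMetric circleMetric gM) (fun p ↦ Real.exp (K * y p.1))
      (fun p ↦ (K ^ 2 * x p.1 ^ 2 - K * y p.1) * Real.exp (K * y p.1)) := by
  refine weakLaplacian_comp_fst gM (h := fun z ↦ Real.exp (K * y z))
    (h₁ := fun z ↦ K * x z * Real.exp (K * y z))
    (h₂ := fun z ↦ (K ^ 2 * x z ^ 2 - K * y z) * Real.exp (K * y z))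
    (contMDiff_exp_mul cy K) ((contMDiff_const.mul cx).mul (contMDiff_exp_mul cy K)) ?_
    (hasDerivAt_exp_mul_circle dy K) fun z ↦ ?_
  · have := cx.continuous
    have := cy.continuous
    fun_prop
  · refine (((dx z).const_mul K).fun_mul (hasDerivAt_exp_mul_circle dy K z)).congr_deriv ?_
    simp only [Circle.exp_zero, one_mul]
    ring

end Exponential

/-- A positive function of the angle that grows along an arc of length less than `π` and has a
large second derivative there, namely `exp (K sin (t - l / 2))` for large `K`. -/
theorem exists_barrier (ζ : Circle) {l : ℝ} (hl : l ∈ Ioo 0 Real.pi) {A : ℝ} (hA : 0 < A) :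
    ∃ h h₂ : Circle → ℝ, ContMDiff (𝓡 1) 𝓘(ℝ, ℝ) ∞ h ∧ Continuous h₂ ∧
      WeakLaplacian (productMetric circleMetric gM) (fun p ↦ h p.1) (fun p ↦ h₂ p.1) ∧
      (∀ z, 0 < h z) ∧
      (∀ t ∈ Icc 0 l, A * h (Circle.exp t * ζ) < h₂ (Circle.exp t * ζ)) ∧
      (∀ t ∈ Ioc 0 l, h ζ < h (Circle.exp t * ζ)) ∧
      ∃ e > 0, HasDerivAt (fun t : ℝ ↦ h (Circle.exp t * ζ)) e 0 := by
  set ξ := Circle.exp (l / 2) * ζ with hξ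
  set y : Circle → ℝ := fun z ↦ (((z / ξ : Circle) : ℂ) ^ 1).im with hy
  set x : Circle → ℝ := fun z ↦ (((z / ξ : Circle) : ℂ) ^ 1).re with hx
  have cy : ContMDiff (𝓡 1) 𝓘(ℝ, ℝ) ∞ y := contMDiff_im_circle_pow_div ξ 1
  have cx : ContMDiff (𝓡 1) 𝓘(ℝ, ℝ) ∞ x := contMDiff_re_circle_pow_div ξ 1
  have dy : ∀ z, HasDerivAt (fun t : ℝ ↦ y (Circle.exp t * z)) (x z) 0 := fun z ↦
    (hasDerivAt_im_circle_pow_div ξ z 1).congr_deriv (by simp [x])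
  have dx : ∀ z, HasDerivAt (fun t : ℝ ↦ x (Circle.exp t * z)) (-y z) 0 := fun z ↦
    (hasDerivAt_re_circle_pow_div ξ z 1).congr_deriv (by simp [y])
  have hlift : ∀ t : ℝ, (((Circle.exp t * ζ / ξ : Circle) : ℂ) ^ 1)
      = Complex.exp ((t - l / 2 : ℝ) * Complex.I) := by
    intro t
    rw [hξ, pow_one, mul_div_mul_right_eq_div, ← Circle.exp_sub, Circle.coe_exp]
  have hxt : ∀ t : ℝ, x (Circle.exp t * ζ) = Real.cos (t - l / 2) := fun t ↦ by
    simp only [x, hlift, Complex.exp_ofReal_mul_I_re]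
  have hyt : ∀ t : ℝ, y (Circle.exp t * ζ) = Real.sin (t - l / 2) := fun t ↦ by
    simp only [y, hlift, Complex.exp_ofReal_mul_I_im]
  set c := Real.cos (l / 2) with hc
  have hc0 : 0 < c := Real.cos_pos_of_mem_Ioo ⟨by linarith [hl.1, Real.pi_pos], by linarith [hl.2]⟩
  have hxc : ∀ t ∈ Icc 0 l, c ≤ x (Circle.exp t * ζ) := by
    intro t ht
    rw [hxt, hc, ← Real.cos_abs (t - l / 2)]
    refine Real.cos_le_cos_of_nonneg_of_le_pi (abs_nonneg _) (by linarith [hl.1, hl.2]) ?_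
    rw [abs_le]
    constructor <;> linarith [ht.1, ht.2]
  obtain ⟨K, hK0, hK⟩ : ∃ K > 0, A < K ^ 2 * c ^ 2 - K := by
    refine ⟨(A + 2) / c ^ 2, by positivity, ?_⟩
    have hc1 : c ^ 2 ≤ 1 := by
      have := Real.cos_sq_le_one (l / 2)
      exact this
    have h1 : A + 2 ≤ (A + 2) / c ^ 2 := le_div_self (by linarith) (by positivity) hc1
    have h2 : ((A + 2) / c ^ 2) ^ 2 * c ^ 2 = (A + 2) / c ^ 2 * (A + 2) := by
      field_simp
    rw [h2]
    nlinarith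
  refine ⟨fun z ↦ Real.exp (K * y z), fun z ↦ (K ^ 2 * x z ^ 2 - K * y z) * Real.exp (K * y z),
    contMDiff_exp_mul cy K, ?_, weakLaplacian_exp_mul gM cx cy dx dy K,
    fun z ↦ Real.exp_pos _, fun t ht ↦ ?_, fun t ht ↦ ?_, _, ?_, hasDerivAt_exp_mul_circle dy K ζ⟩
  · have := cx.continuous
    have := cy.continuous
    fun_prop
  · refine mul_lt_mul_of_pos_right (hK.trans_le ?_) (Real.exp_pos _)
    have h1 := hxc t ht
    have h2 : y (Circle.exp t * ζ) ≤ 1 := by rw [hyt]; exact Real.sin_le_one _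
    have h3 : c ^ 2 ≤ x (Circle.exp t * ζ) ^ 2 := by gcongr
    have h4 : K ^ 2 * c ^ 2 ≤ K ^ 2 * x (Circle.exp t * ζ) ^ 2 := by gcongr
    nlinarith
  · have h0 := hyt 0
    rw [Circle.exp_zero, one_mul] at h0
    rw [Real.exp_lt_exp, h0, hyt]
    refine mul_lt_mul_of_pos_left (Real.strictMonoOn_sin ?_ ?_ (by linarith [ht.1])) hK0 <;>
      constructor <;> linarith [ht.1, ht.2, hl.1, hl.2]
  · have h1 := hxc 0 ⟨le_rfl, hl.1.le⟩
    rw [Circle.exp_zero, one_mul] at h1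
    have := hc0.trans_le h1
    positivity

end Trigonometric

section Hump
variable {d : ℕ} {M : Type*} [TopologicalSpace M] [T2Space M] [CompactSpace M]
  [ChartedSpace (EuclideanSpace ℝ (Fin d)) M] [IsManifold (𝓡 d) ∞ M]
  {gM : ContMDiffRiemannianMetric (𝓡 d) ∞ (EuclideanSpace ℝ (Fin d))
      (fun x : M ↦ TangentSpace (𝓡 d) x)}

/-- If `u` is positive on a slab of width `π / k` and `ε` is small, then `u ≥ 1 - η` on the middle
slice: compare `u` with the subsolutions `τ (1 - η) cos (k t)`, where `0 ≤ τ ≤ 1`. -/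
theorem IsPhaseTransition.le_of_pos_slab {W : ℝ → ℝ} (hW : IsDoubleWell W) {ε : ℝ} (hε : 0 < ε)
    {u : Circle × M → ℝ} (hu : IsPhaseTransition (productMetric circleMetric gM) W ε u)
    {M₀ : Set M} (hM : IsClopen M₀) (ζ : Circle) {k : ℕ} (hk : 0 < k) {η c : ℝ}
    (hη1 : η < 1) (hc : ∀ x ∈ Ioc 0 (1 - η), deriv W x ≤ -c * x)
    (hεk : ε ^ 2 * k ^ 2 < c)
    (hpos : ∀ t ∈ Icc (-(Real.pi / (2 * k))) (Real.pi / (2 * k)), ∀ x ∈ M₀, 0 < u (arcPoint ζ t x))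
    {x : M} (hx : x ∈ M₀) : 1 - η ≤ u (ζ, x) := by
  by_contra! hcon
  have hk' : (0 : ℝ) < k := by exact_mod_cast hk
  set a := Real.pi / (2 * k) with ha
  have ha0 : 0 < a := by positivity
  have hka : k * a = Real.pi / 2 := by rw [ha]; field_simp
  set q : Circle × M → ℝ := fun p ↦ (((p.1 / ζ : Circle) : ℂ) ^ k).re with hq
  have hqs : ContMDiff ((𝓡 1).prod (𝓡 d)) 𝓘(ℝ, ℝ) ∞ q :=
    (contMDiff_re_circle_pow_div ζ k).comp contMDiff_fst
  have hus := hu.smooth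
  have cu := hus.continuous
  have cq := hqs.continuous
  have hqt : ∀ t y, q (arcPoint ζ t y) = Real.cos (k * t) := fun t y ↦ re_arcPoint_pow ζ k t y
  have hη0 : 0 < 1 - η := by linarith
  -- the largest quotient of the comparison function and `u`
  obtain ⟨_, ⟨⟨t₁, x₁⟩, ⟨ht₁, hx₁⟩, rfl⟩, hmax⟩ :=
    (isCompact_slab ζ (isCompact_Icc (a := -a) (b := a)) hM.isClosed.isCompact).exists_isMaxOn
      ⟨_, slab_mem (t := 0) ⟨by linarith, ha0.le⟩ hx⟩
      (f := fun p ↦ (1 - η) * q p / u p) (ContinuousOn.div (by fun_prop) (by fun_prop) (by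
        rintro _ ⟨⟨t, y⟩, ⟨ht, hy⟩, rfl⟩
        exact (hpos t ht y hy).ne'))
  set R := (1 - η) * q (arcPoint ζ t₁ x₁) / u (arcPoint ζ t₁ x₁) with hR
  have hmax' : ∀ t ∈ Icc (-a) a, ∀ y ∈ M₀,
      (1 - η) * q (arcPoint ζ t y) ≤ R * u (arcPoint ζ t y) := by
    intro t ht y hy
    have : (1 - η) * q (arcPoint ζ t y) / u (arcPoint ζ t y) ≤ R := hmax (slab_mem ht hy)
    rwa [div_le_iff₀ (hpos t ht y hy)] at this
  have hR1 : 1 < R := by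
    have h0 : (0 : ℝ) ∈ Icc (-a) a := ⟨by linarith, ha0.le⟩
    have h1 := hmax' 0 h0 x hx
    have h2 := hpos 0 h0 x hx
    rw [hqt, mul_zero, Real.cos_zero, mul_one] at h1
    rw [arcPoint_zero] at h1 h2
    by_contra hle
    push Not at hle
    nlinarith
  have hR0 : 0 < R := one_pos.trans hR1
  have hzero : u (arcPoint ζ t₁ x₁) + -((1 - η) / R) * q (arcPoint ζ t₁ x₁) = 0 := by
    have h1 := (hpos t₁ ht₁ x₁ hx₁).ne'
    have h2 : R * u (arcPoint ζ t₁ x₁) = (1 - η) * q (arcPoint ζ t₁ x₁) := by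
      rw [hR]; field_simp
    field_simp
    linarith
  have hnn : ∀ t ∈ Icc (-a) a, ∀ y ∈ M₀,
      0 ≤ u (arcPoint ζ t y) + -((1 - η) / R) * q (arcPoint ζ t y) := by
    intro t ht y hy
    have h1 := hmax' t ht y hy
    have h2 : (1 - η) / R * q (arcPoint ζ t y) ≤ u (arcPoint ζ t y) := by
      rw [div_mul_eq_mul_div, div_le_iff₀ hR0]
      linarith
    linarith
  have hW' : Continuous (deriv W) := hW.smooth.continuous_deriv (by simp)
  have hlap := (hu.weakLaplacian hW.smooth hε).add_const_mul hus hqs (by fun_prop) (by fun_prop)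
    (weakLaplacian_cos gM ζ k) (-((1 - η) / R))
  refine absurd (hlap.exists_endpoint_le (f := fun p ↦ u p + -((1 - η) / R) * q p)
    (hus.add (contMDiff_const.mul hqs)) (by fun_prop) ζ (by linarith : -a < a) hM
    (fun t ht y hy hmin ↦ ?_) ht₁ hx₁) ?_
  · have h0 : u (arcPoint ζ t y) + -((1 - η) / R) * q (arcPoint ζ t y) = 0 :=
      le_antisymm ((hmin t₁ ht₁ x₁ hx₁).trans_eq hzero)
        (hnn t (Ioo_subset_Icc_self ht) y hy)
    have hup := hpos t (Ioo_subset_Icc_self ht) y hy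
    set U := u (arcPoint ζ t y)
    set Q := q (arcPoint ζ t y) with hQ
    have hQ1 : Q ≤ 1 := by rw [hQ, hqt]; exact Real.cos_le_one _
    have hU : U = (1 - η) / R * Q := by linarith
    have hUle : U ≤ 1 - η := by
      have hQ0 : 0 < Q := by
        by_contra hQn
        push Not at hQn
        have : (1 - η) / R * Q ≤ 0 := mul_nonpos_of_nonneg_of_nonpos (by positivity) hQn
        linarith
      rw [hU, div_mul_eq_mul_div, div_le_iff₀ hR0]
      nlinarith
    have h1 := hc U ⟨hup, hUle⟩
    have h2 : (ε ^ 2)⁻¹ * deriv W U ≤ (ε ^ 2)⁻¹ * (-c * U) := by gcongr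
    have h3 : (ε ^ 2)⁻¹ * deriv W U + -((1 - η) / R) * (-(k : ℝ) * (k * Q))
        ≤ (ε ^ 2)⁻¹ * (-c * U) + (k : ℝ) ^ 2 * U := by
      rw [hU] at h2 ⊢
      nlinarith
    refine h3.trans_lt ?_
    have h4 : (ε ^ 2)⁻¹ * (-c * U) + (k : ℝ) ^ 2 * U = (ε ^ 2)⁻¹ * (ε ^ 2 * k ^ 2 - c) * U := by
      field_simp
      ring
    rw [h4]
    exact mul_neg_of_neg_of_pos (mul_neg_of_pos_of_neg (by positivity) (by linarith)) hup
  · rintro ⟨y, hy, hle⟩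
    have hcos : Real.cos (k * a) = 0 := by rw [hka, Real.cos_pi_div_two]
    have hcos' : Real.cos (k * -a) = 0 := by rw [mul_neg, Real.cos_neg, hcos]
    simp only [hzero] at hle
    rw [hqt, hqt, hcos, hcos', mul_zero, add_zero, add_zero] at hle
    rcases hle with hle | hle
    · exact hle.not_gt (hpos _ ⟨le_rfl, by linarith⟩ y hy)
    · exact hle.not_gt (hpos _ ⟨by linarith, le_rfl⟩ y hy)

end Hump

/-! ### The reflection argument -/

section Neg
variable {E : Type*} [NormedAddCommGroup E] [NormedSpace ℝ E] [FiniteDimensional ℝ E]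
  {H : Type*} [TopologicalSpace H] {I : ModelWithCorners ℝ E H}
  {N : Type*} [TopologicalSpace N] [ChartedSpace H N] [IsManifold I ∞ N]
  [MeasurableSpace E] [BorelSpace E]
  {g : ContMDiffRiemannianMetric I ∞ E (fun x : N ↦ TangentSpace I x)}

theorem energy_neg {W : ℝ → ℝ} (hW : IsDoubleWell W) (ε : ℝ) (u : N → ℝ) :
    energy g W ε (fun p ↦ -u p) = energy g W ε u := by
  have h : ∀ p, riemannianGradient g (fun p ↦ -u p) p = -riemannianGradient g u p := fun p ↦ by
    have h1 : mfderiv I 𝓘(ℝ, ℝ) (fun p ↦ -u p) p = -mfderiv I 𝓘(ℝ, ℝ) u p := mfderiv_neg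
    refine riemannianGradient_eq g fun w ↦ ?_
    have h2 := inner_riemannianGradient g u p w
    rw [map_neg]
    change -(g.inner p (riemannianGradient g u p) w) = mfderiv I 𝓘(ℝ, ℝ) (fun p ↦ -u p) p w
    rw [h1, h2]
    rfl
  unfold energy
  simp only [h, map_neg, ← hW.even, _root_.neg_apply, neg_neg]

theorem IsPhaseTransition.neg {W : ℝ → ℝ} (hW : IsDoubleWell W) {ε : ℝ} {u : N → ℝ}
    (hu : IsPhaseTransition g W ε u) : IsPhaseTransition g W ε (fun p ↦ -u p) where
  smooth := hu.smooth.neg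
  mem_Icc p := ⟨by linarith [(hu.mem_Icc p).2], by linarith [(hu.mem_Icc p).1]⟩
  critical φ hφ := by
    have h : ∀ t : ℝ, energy g W ε (fun p ↦ -u p + t * φ p)
        = energy g W ε (fun p ↦ u p + t * -φ p) := fun t ↦ by
      rw [← energy_neg hW]
      congr 1
      ext p
      ring
    simp only [h]
    exact hu.critical _ hφ.neg

end Neg

section Core
variable {d : ℕ} {M : Type*} [TopologicalSpace M] [T2Space M] [CompactSpace M]
  [ChartedSpace (EuclideanSpace ℝ (Fin d)) M] [IsManifold (𝓡 d) ∞ M]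
  {gM : ContMDiffRiemannianMetric (𝓡 d) ∞ (EuclideanSpace ℝ (Fin d))
      (fun x : M ↦ TangentSpace (𝓡 d) x)}

/-- The strong maximum principle together with the Hopf boundary lemma: on an arc of length less
than `π`, a nonnegative function with `Δz ≤ A z` where it is small, which is positive over one end
of the arc, lies above a function of the angle which grows at a positive rate from the other end. -/
theorem WeakLaplacian.exists_barrier_le {z L : Circle × M → ℝ}
    (hz : ContMDiff ((𝓡 1).prod (𝓡 d)) 𝓘(ℝ, ℝ) ∞ z) (hL : Continuous L)
    (hzL : WeakLaplacian (productMetric circleMetric gM) z L) (ζ : Circle) {l : ℝ}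
    (hl : l ∈ Ioo 0 Real.pi) {M₀ : Set M} (hM : IsClopen M₀) {A κ : ℝ} (hA : 0 < A) (hκ : 0 < κ)
    (hnn : ∀ t ∈ Icc 0 l, ∀ x ∈ M₀, 0 ≤ z (arcPoint ζ t x))
    (hend : ∀ x ∈ M₀, 0 < z (arcPoint ζ l x))
    (hle : ∀ t ∈ Ioo 0 l, ∀ x ∈ M₀, z (arcPoint ζ t x) < κ →
      L (arcPoint ζ t x) ≤ A * z (arcPoint ζ t x)) :
    ∃ b : ℝ → ℝ, b 0 = 0 ∧ (∀ t ∈ Ioc 0 l, 0 < b t) ∧ (∃ e > 0, HasDerivAt b e 0) ∧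
      ∀ t ∈ Icc 0 l, ∀ x ∈ M₀, b t ≤ z (arcPoint ζ t x) := by
  obtain ⟨h, h₂, hh, ch₂, hhL, hpos, hAh, hgrow, e, he, hder⟩ := exists_barrier gM ζ hl hA
  have cz := hz.continuous
  have ch := hh.continuous
  have cz' : Continuous fun x ↦ z (arcPoint ζ l x) :=
    cz.comp ((continuous_arcPoint ζ).comp (Continuous.prodMk_right l))
  obtain ⟨m, hm, hmle⟩ := hM.isClosed.isCompact.exists_forall_le' cz'.continuousOn hend
  obtain ⟨B, hB⟩ := (isCompact_univ (X := Circle)).exists_bound_of_continuousOn ch.continuousOn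
  have hB' : ∀ w, h w ≤ B := fun w ↦ (le_abs_self _).trans (hB w (mem_univ _))
  have hB0 : 0 < B := (hpos ζ).trans_le (hB' ζ)
  set r := min m κ with hr
  have hr0 : 0 < r := lt_min hm hκ
  set δ := r / (2 * B) with hδ
  have hδ0 : 0 < δ := by positivity
  have hδh : ∀ w, δ * h w < r := fun w ↦ by
    have : δ * h w ≤ δ * B := by gcongr; exact hB' w
    have h2 : δ * B = r / 2 := by rw [hδ]; field_simp
    linarith
  refine ⟨fun t ↦ δ * (h (Circle.exp t * ζ) - h ζ), by simp, fun t ht ↦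
    mul_pos hδ0 (sub_pos.2 (hgrow t ht)), ⟨δ * e, by positivity, (hder.sub_const _).const_mul δ⟩, ?_⟩
  intro t ht x hx
  by_contra! hcon
  have hlap := hzL.add_const_mul hz (hh.comp contMDiff_fst) hL (by fun_prop) hhL (-δ)
  refine absurd (hlap.exists_endpoint_le (f := fun p ↦ z p + -δ * h p.1)
    (hz.add (contMDiff_const.mul (hh.comp contMDiff_fst))) (by fun_prop) ζ hl.1 hM
    (fun s hs y hy hmin ↦ ?_) ht hx) ?_
  · have h1 : z (arcPoint ζ s y) + -δ * h (Circle.exp s * ζ)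
        ≤ z (arcPoint ζ t x) + -δ * h (Circle.exp t * ζ) := hmin t ht x hx
    have h2 : L (arcPoint ζ s y) ≤ A * z (arcPoint ζ s y) := by
      refine hle s hs y hy (lt_of_lt_of_le ?_ (min_le_right m κ))
      have := hδh (Circle.exp s * ζ)
      have := mul_pos hδ0 (hpos ζ)
      linarith
    have h3 := hAh s (Ioo_subset_Icc_self hs)
    have h4 : z (arcPoint ζ s y) ≤ δ * h (Circle.exp s * ζ) := by
      have := mul_pos hδ0 (hpos ζ)
      linarith
    change L (arcPoint ζ s y) + -δ * h₂ (Circle.exp s * ζ) < 0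
    calc _ ≤ A * (δ * h (Circle.exp s * ζ)) + -δ * h₂ (Circle.exp s * ζ) := by
          have := mul_le_mul_of_nonneg_left h4 hA.le
          linarith
      _ = δ * (A * h (Circle.exp s * ζ) - h₂ (Circle.exp s * ζ)) := by ring
      _ < 0 := mul_neg_of_pos_of_neg hδ0 (by linarith)
  · rintro ⟨y, hy, hy' | hy'⟩
    · have h1 : z (arcPoint ζ 0 y) + -δ * h (Circle.exp 0 * ζ)
        ≤ z (arcPoint ζ t x) + -δ * h (Circle.exp t * ζ) := hy'
      have h2 := hnn 0 ⟨le_rfl, hl.1.le⟩ y hy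
      rw [Circle.exp_zero, one_mul] at h1
      linarith
    · have h1 : z (arcPoint ζ l y) + -δ * h (Circle.exp l * ζ)
        ≤ z (arcPoint ζ t x) + -δ * h (Circle.exp t * ζ) := hy'
      have h2 := hmle y hy
      have h3 := (hδh (Circle.exp l * ζ)).trans_le (min_le_left m κ)
      have := mul_pos hδ0 (hpos ζ)
      linarith

variable {W : ℝ → ℝ} {ε : ℝ} {u : Circle × M → ℝ}

omit [T2Space M] in
/-- The reflection of a solution across the slice over `ζ` is a solution. -/
theorem IsPhaseTransition.exists_reflect (hW : IsDoubleWell W) (hε : 0 < ε)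
    (hu : IsPhaseTransition (productMetric circleMetric gM) W ε u) (ζ : Circle) :
    ∃ v : Circle × M → ℝ, ContMDiff ((𝓡 1).prod (𝓡 d)) 𝓘(ℝ, ℝ) ∞ v ∧
      (∀ t x, v (arcPoint ζ t x) = u (arcPoint ζ (-t) x)) ∧ (∀ p, v p ∈ Icc (-1 : ℝ) 1) ∧
      WeakLaplacian (productMetric circleMetric gM) v (fun p ↦ (ε ^ 2)⁻¹ * deriv W (v p)) := by
  have hus := hu.smooth
  have cu := hus.continuous
  have hW' : Continuous (deriv W) := hW.smooth.continuous_deriv (by simp)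
  refine ⟨fun p ↦ u (ζ ^ 2 * p.1⁻¹, p.2),
    hus.comp (contMDiff_circleAct (contMDiff_circle_reflect (ζ ^ 2))), fun t x ↦ congrArg u ?_,
    fun p ↦ hu.mem_Icc _, (hu.weakLaplacian hW.smooth hε).reflect gM hus (by fun_prop) (ζ ^ 2)⟩
  simp only [arcPoint, Circle.exp_neg, Prod.mk.injEq, and_true]
  rw [mul_inv, pow_two, mul_comm (Circle.exp t)⁻¹, ← mul_assoc, mul_assoc ζ, mul_inv_cancel, mul_one,
    mul_comm]

/-- A positive solution dominates the negative of its reflection. Otherwise some multiple `λ u`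
with `1 < λ` touches it from above, but `λ u` is a supersolution. -/
theorem IsPhaseTransition.add_reflect_nonneg (hW : IsDoubleWell W) (hε : 0 < ε)
    (hu : IsPhaseTransition (productMetric circleMetric gM) W ε u) (ζ : Circle) {l : ℝ}
    (hl : l ∈ Ioo 0 Real.pi) {M₀ : Set M} (hM : IsClopen M₀)
    (hpos : ∀ t ∈ Icc 0 l, ∀ x ∈ M₀, 0 < u (arcPoint ζ t x))
    (hneg : ∀ x ∈ M₀, 0 < u (arcPoint ζ (-l) x)) {t : ℝ} (ht : t ∈ Icc 0 l) {x : M} (hx : x ∈ M₀) :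
    0 ≤ u (arcPoint ζ t x) + u (arcPoint ζ (-t) x) := by
  by_contra! hcon
  obtain ⟨v, hvs, hvt, hv1, hvl⟩ := hu.exists_reflect hW hε ζ
  have hus := hu.smooth
  have cu := hus.continuous
  have cv := hvs.continuous
  obtain ⟨_, ⟨⟨t₁, x₁⟩, ⟨ht₁, hx₁⟩, rfl⟩, hmax⟩ :=
    (isCompact_slab ζ (isCompact_Icc (a := 0) (b := l)) hM.isClosed.isCompact).exists_isMaxOn
      ⟨_, slab_mem ht hx⟩
      (f := fun p ↦ -v p / u p) (ContinuousOn.div (by fun_prop) (by fun_prop) (by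
        rintro _ ⟨⟨t, y⟩, ⟨ht, hy⟩, rfl⟩
        exact (hpos t ht y hy).ne'))
  set R := -v (arcPoint ζ t₁ x₁) / u (arcPoint ζ t₁ x₁) with hR
  have hnn : ∀ t ∈ Icc 0 l, ∀ y ∈ M₀, 0 ≤ v (arcPoint ζ t y) + R * u (arcPoint ζ t y) := by
    intro t ht y hy
    have : -v (arcPoint ζ t y) / u (arcPoint ζ t y) ≤ R := hmax (slab_mem ht hy)
    rw [div_le_iff₀ (hpos t ht y hy)] at this
    linarith
  have hR1 : 1 < R := by
    have h1 := hnn t ht x hx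
    have h2 := hpos t ht x hx
    rw [hvt] at h1
    by_contra! hle
    nlinarith
  have hR0 : 0 < R := one_pos.trans hR1
  have hzero : v (arcPoint ζ t₁ x₁) + R * u (arcPoint ζ t₁ x₁) = 0 := by
    rw [hR, div_mul_cancel₀ _ (hpos t₁ ht₁ x₁ hx₁).ne', add_neg_cancel]
  have hW' : Continuous (deriv W) := hW.smooth.continuous_deriv (by simp)
  have hul := hu.weakLaplacian hW.smooth hε
  have hlap := hvl.add_const_mul hvs hus (by fun_prop) (by fun_prop) hul R
  obtain ⟨κ, ⟨hκ0, hκ1⟩, hκ⟩ := hW.exists_deriv_nonneg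
  obtain ⟨C, hC0, hC⟩ := hW.exists_lipschitz
  obtain ⟨b, -, hb, -, hble⟩ := hlap.exists_barrier_le (z := fun p ↦ v p + R * u p)
    (hvs.add (contMDiff_const.mul hus)) (by fun_prop) ζ hl hM
    (A := (ε ^ 2)⁻¹ * C) (by positivity) hκ0 hnn
    (fun y hy ↦ by
      have h1 := hpos l ⟨hl.1.le, le_rfl⟩ y hy
      have h2 := hneg y hy
      simp only [hvt]
      positivity)
    (fun s hs y hy hlt ↦ by
      have h0 := hnn s (Ioo_subset_Icc_self hs) y hy
      have h1 := hpos s (Ioo_subset_Icc_self hs) y hy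
      change (ε ^ 2)⁻¹ * deriv W (v (arcPoint ζ s y))
        + R * ((ε ^ 2)⁻¹ * deriv W (u (arcPoint ζ s y)))
        ≤ (ε ^ 2)⁻¹ * C * (v (arcPoint ζ s y) + R * u (arcPoint ζ s y))
      have hu1 := hu.mem_Icc (arcPoint ζ s y)
      have hv1 := hv1 (arcPoint ζ s y)
      generalize u (arcPoint ζ s y) = U at *
      generalize v (arcPoint ζ s y) = V at *
      have hRU := mul_pos hR0 h1
      have h2 := hW.mul_deriv_le hκ hR1.le ⟨h1, hu1.2⟩ (by linarith [hv1.1])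
      have h3 := hC (R * U) ⟨by linarith, by linarith [hv1.1]⟩ (-V)
        ⟨by linarith [hv1.2], by linarith [hv1.1]⟩ (by linarith)
      rw [hW.deriv_neg] at h3
      calc _ = (ε ^ 2)⁻¹ * (deriv W V + R * deriv W U) := by ring
        _ ≤ (ε ^ 2)⁻¹ * (C * (V + R * U)) := by gcongr; linarith
        _ = _ := by ring)
  rcases ht₁.1.eq_or_lt with h0 | h0
  · have h1 := hpos t₁ ht₁ x₁ hx₁
    have h0 : t₁ = 0 := h0.symm
    rw [hvt, h0, neg_zero, ← h0] at hzero
    have := mul_pos hR0 h1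
    linarith
  · have h1 := hble t₁ ht₁ x₁ hx₁
    have h2 := hb t₁ ⟨h0, ht₁.2⟩
    simp only [hzero] at h1
    linarith

/-- The reflection argument: a solution that is positive on an arc of length `l < π` after `ζ`, and
at the angle `-l`, does not vanish over `ζ`. Here `z = u + v ≥ 0` with `v` the reflection of `u`
across the slice over `ζ`. The derivative of `z` in the angle vanishes over `ζ`, while it would be
positive at a zero of `z` by the Hopf lemma. -/
theorem IsPhaseTransition.ne_zero_of_reflect (hW : IsDoubleWell W) (hε : 0 < ε)
    (hu : IsPhaseTransition (productMetric circleMetric gM) W ε u) (ζ : Circle) {l : ℝ}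
    (hl : l ∈ Ioo 0 Real.pi) {M₀ : Set M} (hM : IsClopen M₀)
    (hpos : ∀ t ∈ Ioc 0 l, ∀ x ∈ M₀, 0 < u (arcPoint ζ t x))
    (hneg : ∀ x ∈ M₀, 0 < u (arcPoint ζ (-l) x)) {x : M} (hx : x ∈ M₀) : u (ζ, x) ≠ 0 := by
  intro hux
  have hus := hu.smooth
  have cu := hus.continuous
  have carc : ∀ f : ℝ → ℝ, Continuous f → ∀ y, Continuous fun s ↦ u (arcPoint ζ (f s) y) :=
    fun f hf y ↦ cu.comp ((continuous_arcPoint ζ).comp (hf.prodMk continuous_const))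
  obtain ⟨v, hvs, hvt, hv1, hvl⟩ := hu.exists_reflect hW hε ζ
  have cv := hvs.continuous
  -- reflect across the slices at small angles `s > 0`, and let `s → 0`
  have hev : ∀ᶠ s : ℝ in 𝓝 0, ∀ y ∈ M₀, 0 < u (arcPoint ζ (2 * s - l) y) := by
    refine hM.isClosed.isCompact.eventually_forall_of_forall_eventually fun y hy ↦ ?_
    have h1 : Continuous fun q : ℝ × M ↦ u (arcPoint ζ (2 * q.1 - l) q.2) :=
      cu.comp ((continuous_arcPoint ζ).comp (by fun_prop : Continuous fun q : ℝ × M ↦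
        (2 * q.1 - l, q.2)))
    refine h1.continuousAt.eventually (lt_mem_nhds ?_)
    simpa only [mul_zero, zero_sub] using hneg y hy
  have hnn : ∀ t ∈ Icc 0 l, ∀ y ∈ M₀, 0 ≤ u (arcPoint ζ t y) + u (arcPoint ζ (-t) y) := by
    intro t ht y hy
    rcases ht.2.eq_or_lt with rfl | htl
    · exact (add_pos (hpos t ⟨hl.1, le_rfl⟩ y hy) (hneg y hy)).le
    have hlim : Tendsto (fun s ↦ u (arcPoint ζ (t + s) y) + u (arcPoint ζ (-t + s) y)) (𝓝[>] 0)
        (𝓝 (u (arcPoint ζ t y) + u (arcPoint ζ (-t) y))) := by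
      have h1 := ((carc (fun s ↦ t + s) (by fun_prop) y).fun_add
        (carc (fun s ↦ -t + s) (by fun_prop) y)).tendsto 0
      simp only [add_zero] at h1
      exact h1.mono_left nhdsWithin_le_nhds
    refine ge_of_tendsto hlim ?_
    filter_upwards [nhdsWithin_le_nhds hev, self_mem_nhdsWithin,
      nhdsWithin_le_nhds (gt_mem_nhds (sub_pos.2 htl))] with s hs hs0 hst
    have hs0 : 0 < s := hs0
    have h := hu.add_reflect_nonneg hW hε (Circle.exp s * ζ) (l := l - s)
      ⟨by linarith [ht.1], by linarith [hl.2]⟩ hM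
      (fun τ hτ w hw ↦ by
        rw [arcPoint_exp_mul]
        exact hpos _ ⟨by linarith [hτ.1], by linarith [hτ.2]⟩ w hw)
      (fun w hw ↦ by
        rw [arcPoint_exp_mul]
        convert hs w hw using 3
        ring) (t := t) ⟨ht.1, by linarith⟩ hy
    rwa [arcPoint_exp_mul, arcPoint_exp_mul] at h
  have hW' : Continuous (deriv W) := hW.smooth.continuous_deriv (by simp)
  have hul := hu.weakLaplacian hW.smooth hε
  have hlap := hvl.add_const_mul hvs hus (by fun_prop) (by fun_prop) hul 1
  obtain ⟨C, hC0, hC⟩ := hW.exists_lipschitz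
  have hnn' : ∀ t ∈ Icc 0 l, ∀ y ∈ M₀, 0 ≤ v (arcPoint ζ t y) + 1 * u (arcPoint ζ t y) := by
    intro t ht y hy
    have := hnn t ht y hy
    rw [hvt]
    linarith
  obtain ⟨b, hb0, -, ⟨e, he, hbe⟩, hble⟩ := hlap.exists_barrier_le (z := fun p ↦ v p + 1 * u p)
    (hvs.add (contMDiff_const.mul hus)) (by fun_prop) ζ hl hM
    (A := (ε ^ 2)⁻¹ * C) (by positivity) one_pos hnn'
    (fun y hy ↦ by
      have h1 := hpos l ⟨hl.1, le_rfl⟩ y hy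
      have h2 := hneg y hy
      simp only [hvt]
      positivity)
    (fun s hs y hy _ ↦ by
      have h0 := hnn' s (Ioo_subset_Icc_self hs) y hy
      change (ε ^ 2)⁻¹ * deriv W (v (arcPoint ζ s y))
        + 1 * ((ε ^ 2)⁻¹ * deriv W (u (arcPoint ζ s y)))
        ≤ (ε ^ 2)⁻¹ * C * (v (arcPoint ζ s y) + 1 * u (arcPoint ζ s y))
      have hu1 := hu.mem_Icc (arcPoint ζ s y)
      have hv1 := hv1 (arcPoint ζ s y)
      generalize u (arcPoint ζ s y) = U at *
      generalize v (arcPoint ζ s y) = V at *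
      have h3 := hC U ⟨by linarith [hu1.1], by linarith [hu1.2]⟩ (-V)
        ⟨by linarith [hv1.2], by linarith [hv1.1]⟩ (by linarith)
      rw [hW.deriv_neg] at h3
      calc _ = (ε ^ 2)⁻¹ * (deriv W V + deriv W U) := by ring
        _ ≤ (ε ^ 2)⁻¹ * (C * (V + U)) := by gcongr; linarith
        _ = _ := by ring)
  -- the even function `z` of the angle has derivative zero
  have hd : HasDerivAt (fun t : ℝ ↦ u (arcPoint ζ t x)) _ 0 :=
    hasDerivAt_liftedField (hus.mdifferentiable (by simp)) (ζ, x)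
  have hd' := hd.scomp_of_eq 0 (hasDerivAt_neg (0 : ℝ)) (by simp)
  have hder := (hbe.sub (hd.add hd')).congr_deriv (g' := e) (by simp)
  have hsl := hasDerivAt_iff_tendsto_slope.1 hder
  have hsl' := hsl.mono_left (nhdsWithin_mono (0 : ℝ) (fun t (ht : t ∈ Ioi (0 : ℝ)) ↦ ht.ne'))
  refine he.not_ge (le_of_tendsto hsl' ?_)
  filter_upwards [Ioc_mem_nhdsGT hl.1] with t ht
  have h1 := hble t ⟨ht.1.le, ht.2⟩ x hx
  rw [hvt] at h1
  simp only [slope_def_field, Pi.sub_apply, Pi.add_apply, Function.comp_apply, neg_zero,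
    arcPoint_zero, hux, hb0]
  refine div_nonpos_of_nonpos_of_nonneg ?_ (by linarith [ht.1])
  linarith

omit [T2Space M] [CompactSpace M] [ChartedSpace (EuclideanSpace ℝ (Fin d)) M]
  [IsManifold (𝓡 d) ∞ M] in
theorem pos_of_ne_zero (hu : Continuous u) {ζ : Circle} {T : Set ℝ} (hT : T.OrdConnected) {x : M}
    (hne : ∀ t ∈ T, u (arcPoint ζ t x) ≠ 0) {t₀ : ℝ} (ht₀ : t₀ ∈ T)
    (hpos : 0 < u (arcPoint ζ t₀ x)) {t : ℝ} (ht : t ∈ T) : 0 < u (arcPoint ζ t x) := by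
  by_contra! hle
  have hc : Continuous fun s ↦ u (arcPoint ζ s x) :=
    hu.comp ((continuous_arcPoint ζ).comp (Continuous.prodMk_left x))
  obtain ⟨s, hs, h0⟩ := hT.isPreconnected.intermediate_value ht ht₀ hc.continuousOn ⟨hle, hpos.le⟩
  exact hne s hs h0

/-- The reflection argument at a nodal point with the largest angle in `[-δ, δ]`. -/
theorem IsPhaseTransition.ne_zero_of_pos (hW : IsDoubleWell W) (hε : 0 < ε)
    (hu : IsPhaseTransition (productMetric circleMetric gM) W ε u) (ζ : Circle) {l δ : ℝ}
    (hl : l ∈ Ioo 0 Real.pi) {M₀ : Set M} (hM : IsClopen M₀)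
    (hpos : ∀ t ∈ Icc δ (l + δ), ∀ x ∈ M₀, 0 < u (arcPoint ζ t x))
    (hneg : ∀ t ∈ Icc (-l - δ) (-l + δ), ∀ x ∈ M₀, 0 < u (arcPoint ζ t x))
    {t : ℝ} (ht : t ∈ Icc (-δ) δ) {x : M} (hx : x ∈ M₀) : u (arcPoint ζ t x) ≠ 0 := by
  intro h0
  have cu := hu.smooth.continuous
  have carc : Continuous fun q : ℝ × M ↦ u (arcPoint ζ q.1 q.2) := cu.comp (continuous_arcPoint ζ)
  have hcomp : IsCompact ((Icc (-δ) δ ×ˢ M₀) ∩ {q : ℝ × M | u (arcPoint ζ q.1 q.2) = 0}) :=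
    (isCompact_Icc.prod hM.isClosed.isCompact).inter_right (isClosed_eq carc continuous_const)
  obtain ⟨⟨s, y⟩, ⟨⟨hs, hy⟩, hsy⟩, hmax⟩ :=
    hcomp.exists_isMaxOn ⟨(t, x), ⟨ht, hx⟩, h0⟩ continuous_fst.continuousOn
  have hmax' : ∀ τ ∈ Icc (-δ) δ, ∀ w ∈ M₀, u (arcPoint ζ τ w) = 0 → τ ≤ s :=
    fun τ hτ w hw h ↦ hmax (a := (τ, w)) ⟨⟨hτ, hw⟩, h⟩
  have hδ : -δ ≤ δ := ht.1.trans ht.2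
  refine hu.ne_zero_of_reflect hW hε (Circle.exp s * ζ) hl hM (fun τ hτ w hw ↦ ?_)
    (fun w hw ↦ ?_) hy hsy
  · rw [arcPoint_exp_mul]
    refine pos_of_ne_zero cu (T := Ioc s (l + δ)) ordConnected_Ioc (fun σ hσ ↦ ?_)
      (t₀ := l + δ) ⟨by linarith [hs.2, hl.1], le_rfl⟩ (hpos _ ⟨by linarith [hl.1], le_rfl⟩ w hw)
      ⟨by linarith [hτ.1], by linarith [hτ.2, hs.2]⟩
    rcases le_total δ σ with h | h
    · exact (hpos σ ⟨h, hσ.2⟩ w hw).ne'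
    · intro hz
      exact (hmax' σ ⟨by linarith [hσ.1, hs.1], h⟩ w hw hz).not_gt hσ.1
  · rw [arcPoint_exp_mul]
    exact hneg _ ⟨by linarith [hs.1], by linarith [hs.2]⟩ w hw

end Core

/-! ### Nodal sets near two slices -/

section Distance
variable {E : Type*} [NormedAddCommGroup E] [NormedSpace ℝ E]
  {H : Type*} [TopologicalSpace H] {I : ModelWithCorners ℝ E H}
  {N : Type*} [TopologicalSpace N] [ChartedSpace H N] [IsManifold I ∞ N] [T3Space N]
  [CompactSpace N]

/-- On a compact manifold Hausdorff convergence can be tested on neighbourhoods of the diagonal,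
which generate the uniformity of any compatible distance. -/
theorem eventually_mem_of_tendsto_riemannianHausdorffEDist
    {g : ContMDiffRiemannianMetric I ∞ E (fun x : N ↦ TangentSpace I x)} {A : ℕ → Set N} {B : Set N}
    (h : Tendsto (fun i ↦ riemannianHausdorffEDist g (A i) B) atTop (𝓝 0)) {V : Set (N × N)}
    (hV : V ∈ 𝓝ˢ (diagonal N)) :
    ∀ᶠ i in atTop, (∀ p ∈ A i, ∃ q ∈ B, (p, q) ∈ V) ∧ ∀ q ∈ B, ∃ p ∈ A i, (p, q) ∈ V := by
  let _ : RiemannianBundle (fun x : N ↦ TangentSpace I x) :=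
    ⟨g.toContinuousRiemannianMetric.toRiemannianMetric⟩
  let _ : EMetricSpace N := EMetricSpace.ofRiemannianMetric I N
  rw [nhdsSet_diagonal_eq_uniformity, mem_uniformity_edist] at hV
  obtain ⟨r, hr, hrV⟩ := hV
  filter_upwards [h.eventually (gt_mem_nhds hr)] with i hi
  change Metric.hausdorffEDist (A i) B < r at hi
  refine ⟨fun p hp ↦ ?_, fun q hq ↦ ?_⟩
  · obtain ⟨q, hq, hpq⟩ := Metric.exists_edist_lt_of_hausdorffEDist_lt hp hi
    exact ⟨q, hq, hrV hpq⟩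
  · rw [Metric.hausdorffEDist_comm] at hi
    obtain ⟨p, hp, hpq⟩ := Metric.exists_edist_lt_of_hausdorffEDist_lt hq hi
    exact ⟨p, hp, hrV (by rwa [edist_comm])⟩

end Distance

section Angle

theorem exp_arg_div_mul (z ζ : Circle) :
    Circle.exp (((z / ζ : Circle) : ℂ).arg) * ζ = z := by
  rw [Circle.exp_arg, div_mul_cancel]

theorem circle_exp_ne_one {s : ℝ} (hs : s ∈ Ioo 0 (2 * Real.pi)) : Circle.exp s ≠ 1 := by
  intro h
  rw [← Circle.exp_zero, Circle.exp_eq_exp] at h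
  obtain ⟨m, hm⟩ := h
  rw [zero_add] at hm
  have hpi := Real.pi_pos
  have h0 : (0 : ℝ) < m := by
    by_contra! hle
    nlinarith [hs.1]
  have h1 : (m : ℝ) < 1 := by
    by_contra! hle
    nlinarith [hs.2]
  have h0' : 0 < m := by exact_mod_cast h0
  have h1' : m < 1 := by exact_mod_cast h1
  omega

theorem arcPoint_add_two_pi {M : Type*} (ζ : Circle) (t : ℝ) (x : M) :
    arcPoint ζ (t + 2 * Real.pi) x = arcPoint ζ t x := by
  simp [arcPoint, Circle.exp_add]

/-- Nearness in `S¹ × M`: nearby angles, and the same component of `M`. -/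
theorem mem_nhdsSet_diagonal_of_arg {M : Type*} [TopologicalSpace M] [LocallyConnectedSpace M]
    {δ : ℝ} (hδ : 0 < δ) :
    {q : (Circle × M) × (Circle × M) | |((q.1.1 / q.2.1 : Circle) : ℂ).arg| < δ ∧
      q.1.2 ∈ connectedComponent q.2.2} ∈ 𝓝ˢ (diagonal (Circle × M)) := by
  rw [mem_nhdsSet_iff_forall]
  rintro ⟨⟨z, x⟩, ⟨z', x'⟩⟩ h
  obtain ⟨rfl, rfl⟩ : z = z' ∧ x = x' := by simpa using h
  have hx : connectedComponent x ∈ 𝓝 x := isOpen_connectedComponent.mem_nhds mem_connectedComponent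
  have hc : Continuous fun q : (Circle × M) × (Circle × M) ↦ ((q.1.1 / q.2.1 : Circle) : ℂ) := by
    simp only [div_eq_mul_inv]
    exact (continuous_induced_dom : Continuous ((↑) : Circle → ℂ)).comp (by fun_prop)
  have h1 : ContinuousAt (fun q : (Circle × M) × (Circle × M) ↦
      |((q.1.1 / q.2.1 : Circle) : ℂ).arg|) ((z, x), (z, x)) := by
    refine (ContinuousAt.comp (g := Complex.arg) ?_ hc.continuousAt).abs
    exact Complex.continuousAt_arg (by simp)
  have h2 : ∀ᶠ q : (Circle × M) × (Circle × M) in 𝓝 ((z, x), (z, x)),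
      q.1.2 ∈ connectedComponent x :=
    (continuous_snd.comp continuous_fst).continuousAt.eventually hx
  have h3 : ∀ᶠ q : (Circle × M) × (Circle × M) in 𝓝 ((z, x), (z, x)),
      q.2.2 ∈ connectedComponent x :=
    (continuous_snd.comp continuous_snd).continuousAt.eventually hx
  filter_upwards [h1.eventually (gt_mem_nhds (by simpa using hδ)), h2, h3] with q hq1 hq2 hq3
  exact ⟨hq1, connectedComponent_eq hq3 ▸ hq2⟩

/-- All zeros of `u` lie over points of the circle within the angle `δ` of `ζ` or of the point at the
angle `-a` from `ζ`. -/
def NodalNear {M : Type*} (u : Circle × M → ℝ) (ζ : Circle) (a δ : ℝ) : Prop :=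
  ∀ p, u p = 0 → ∃ τ : ℝ, |τ| < δ ∧
    (p.1 = Circle.exp τ * ζ ∨ p.1 = Circle.exp τ * (Circle.exp (-a) * ζ))

variable {M : Type*} {u : Circle × M → ℝ} {ζ : Circle} {a δ : ℝ}

theorem NodalNear.ne_zero_of_pos_angle (h : NodalNear u ζ a δ) (ha : 0 ≤ a) {t : ℝ}
    (ht : t ∈ Icc δ (2 * Real.pi - a - δ)) (x : M) : u (arcPoint ζ t x) ≠ 0 := by
  intro h0
  obtain ⟨τ, hτ, h1 | h1⟩ := h _ h0
  · rw [abs_lt] at hτ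
    refine circle_exp_ne_one (s := t - τ) ⟨by linarith [ht.1], by linarith [ht.2]⟩ ?_
    rw [Circle.exp_sub, mul_right_cancel h1, div_self']
  · rw [abs_lt] at hτ
    refine circle_exp_ne_one (s := t - (τ + -a)) ⟨by linarith [ht.1], by linarith [ht.2]⟩ ?_
    rw [← mul_assoc] at h1
    rw [Circle.exp_sub, Circle.exp_add, mul_right_cancel h1, div_self']

theorem NodalNear.ne_zero_of_neg_angle (h : NodalNear u ζ a δ) (ha : a < 2 * Real.pi) {t : ℝ}
    (ht : t ∈ Icc (-a + δ) (-δ)) (x : M) : u (arcPoint ζ t x) ≠ 0 := by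
  intro h0
  obtain ⟨τ, hτ, h1 | h1⟩ := h _ h0
  · rw [abs_lt] at hτ
    refine circle_exp_ne_one (s := τ - t) ⟨by linarith [ht.2], by linarith [ht.1]⟩ ?_
    rw [Circle.exp_sub, ← mul_right_cancel h1, div_self']
  · rw [abs_lt] at hτ
    refine circle_exp_ne_one (s := t - (τ + -a)) ⟨by linarith [ht.1], by linarith [ht.2]⟩ ?_
    rw [← mul_assoc] at h1
    rw [Circle.exp_sub, Circle.exp_add, mul_right_cancel h1, div_self']

theorem NodalNear.neg (h : NodalNear u ζ a δ) : NodalNear (fun p ↦ -u p) ζ a δ :=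
  fun p hp ↦ h p (neg_eq_zero.1 hp)

theorem continuous_slice [TopologicalSpace M] (hu : Continuous u) (ζ : Circle) (t : ℝ) :
    Continuous fun x ↦ u (arcPoint ζ t x) :=
  hu.comp ((continuous_arcPoint ζ).comp (Continuous.prodMk_right t))

theorem isClopen_setOf_pos [TopologicalSpace M] {f : M → ℝ} (hf : Continuous f)
    (h : ∀ x, f x ≠ 0) : IsClopen {x | 0 < f x} := by
  refine ⟨?_, isOpen_lt continuous_const hf⟩
  have : {x | 0 < f x} = f ⁻¹' Ici 0 := by
    ext x
    exact (h x).symm.le_iff_lt.symm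
  rw [this]
  exact isClosed_Ici.preimage hf

end Angle

section Arcs
variable {d : ℕ} {M : Type*} [TopologicalSpace M] [T2Space M] [CompactSpace M]
  [ChartedSpace (EuclideanSpace ℝ (Fin d)) M] [IsManifold (𝓡 d) ∞ M]
  {gM : ContMDiffRiemannianMetric (𝓡 d) ∞ (EuclideanSpace ℝ (Fin d))
      (fun x : M ↦ TangentSpace (𝓡 d) x)}
  {W : ℝ → ℝ} {ε : ℝ} {u : Circle × M → ℝ} {ζ : Circle} {a δ : ℝ}

/-- The two nodal components cannot be at an angle `a < π`: the reflection argument, on an arc of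
length `(a + π) / 2` inside the long arc, where `u` has a constant sign over each component. -/
theorem IsPhaseTransition.false_of_nodalNear [Nonempty M] (hW : IsDoubleWell W) (hε : 0 < ε)
    (hu : IsPhaseTransition (productMetric circleMetric gM) W ε u)
    (ha : 0 ≤ a) (haδ : 4 * δ ≤ Real.pi - a) (hδ : 0 < δ) (hz : NodalNear u ζ a δ)
    (hn : ∀ x : M, ∃ t ∈ Icc (-δ) δ, ∃ y ∈ connectedComponent x, u (arcPoint ζ t y) = 0) :
    False := by
  have hpi := Real.pi_pos
  inhabit M
  have hδmem : δ ∈ Icc δ (2 * Real.pi - a - δ) := ⟨le_rfl, by linarith⟩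
  wlog hx : 0 < u (arcPoint ζ δ default) generalizing u
  · refine this (hu.neg hW) hz.neg (by simpa using hn) ?_
    have := hz.ne_zero_of_pos_angle ha hδmem default
    exact neg_pos.2 (lt_of_le_of_ne (not_lt.1 hx) this)
  have cu := hu.smooth.continuous
  have hM := isClopen_setOf_pos (continuous_slice cu ζ δ) (hz.ne_zero_of_pos_angle ha hδmem)
  have hpos : ∀ x ∈ {x | 0 < u (arcPoint ζ δ x)}, ∀ t ∈ Icc δ (2 * Real.pi - a - δ),
      0 < u (arcPoint ζ t x) := fun x hx t ht ↦
    pos_of_ne_zero cu ordConnected_Icc (fun s hs ↦ hz.ne_zero_of_pos_angle ha hs x) hδmem hx ht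
  obtain ⟨t, ht, y, hy, h0⟩ := hn default
  refine hu.ne_zero_of_pos hW hε ζ (l := (a + Real.pi) / 2) ⟨by linarith, by linarith⟩ hM
    (fun t ht x hx ↦ hpos x hx t ⟨ht.1, by linarith [ht.2]⟩) (fun t ht x hx ↦ ?_) ht
    (hM.connectedComponent_subset hx hy) h0
  rw [← arcPoint_add_two_pi]
  exact hpos x hx _ ⟨by linarith [ht.1], by linarith [ht.2]⟩

/-- When the nodal components are opposite, `u` has opposite signs on the two arcs. -/
theorem IsPhaseTransition.neg_of_pos (hW : IsDoubleWell W) (hε : 0 < ε)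
    (hu : IsPhaseTransition (productMetric circleMetric gM) W ε u)
    (hδπ : 4 * δ ≤ Real.pi) (hδ : 0 < δ) (hz : NodalNear u ζ Real.pi δ)
    (hn : ∀ x : M, ∃ t ∈ Icc (-δ) δ, ∃ y ∈ connectedComponent x, u (arcPoint ζ t y) = 0)
    {x : M} (hx : 0 < u (arcPoint ζ (Real.pi / 2) x)) : u (arcPoint ζ (-(Real.pi / 2)) x) < 0 := by
  have hpi := Real.pi_pos
  have hm1 : Real.pi / 2 ∈ Icc δ (2 * Real.pi - Real.pi - δ) := ⟨by linarith, by linarith⟩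
  have hm2 : -(Real.pi / 2) ∈ Icc (-Real.pi + δ) (-δ) := ⟨by linarith, by linarith⟩
  have hz1 : ∀ t ∈ Icc δ (2 * Real.pi - Real.pi - δ), ∀ y, u (arcPoint ζ t y) ≠ 0 := fun t ht ↦
    hz.ne_zero_of_pos_angle hpi.le ht
  have hz2 : ∀ t ∈ Icc (-Real.pi + δ) (-δ), ∀ y, u (arcPoint ζ t y) ≠ 0 := fun t ht ↦
    hz.ne_zero_of_neg_angle (by linarith) ht
  by_contra! hx2
  have cu := hu.smooth.continuous
  have hM := (isClopen_setOf_pos (continuous_slice cu ζ _) (hz1 _ hm1)).inter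
    (isClopen_setOf_pos (continuous_slice cu ζ _) (hz2 _ hm2))
  obtain ⟨t, ht, y, hy, h0⟩ := hn x
  refine hu.ne_zero_of_pos hW hε ζ (l := Real.pi / 2) ⟨by linarith, by linarith⟩ hM
    (fun t ht w hw ↦ ?_) (fun t ht w hw ↦ ?_) ht
    (hM.connectedComponent_subset ⟨hx, lt_of_le_of_ne hx2 (hz2 _ hm2 x).symm⟩ hy) h0
  · exact pos_of_ne_zero cu ordConnected_Icc (fun s hs ↦ hz1 s hs w) hm1 hw.1
      ⟨ht.1, by linarith [ht.2]⟩
  · exact pos_of_ne_zero cu ordConnected_Icc (fun s hs ↦ hz2 s hs w) hm2 hw.2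
      ⟨by linarith [ht.1], by linarith [ht.2]⟩

/-- Away from the nodal components, `u` is close to `1` on one arc and to `-1` on the other. -/
theorem IsPhaseTransition.near_one_of_pos (hW : IsDoubleWell W) (hε : 0 < ε)
    (hu : IsPhaseTransition (productMetric circleMetric gM) W ε u)
    (hδπ : 4 * δ ≤ Real.pi) (hδ : 0 < δ) (hz : NodalNear u ζ Real.pi δ)
    (hn : ∀ x : M, ∃ t ∈ Icc (-δ) δ, ∃ y ∈ connectedComponent x, u (arcPoint ζ t y) = 0)
    {k : ℕ} (hk : 0 < k) (hkδ : Real.pi / (2 * k) ≤ δ) {η c : ℝ} (hη1 : η < 1)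
    (hc : ∀ x ∈ Ioc 0 (1 - η), deriv W x ≤ -c * x) (hεk : ε ^ 2 * k ^ 2 < c)
    {x : M} (hx : 0 < u (arcPoint ζ (Real.pi / 2) x)) :
    (∀ t ∈ Icc (2 * δ) (Real.pi - 2 * δ), 1 - η ≤ u (arcPoint ζ t x)) ∧
      ∀ t ∈ Icc (-Real.pi + 2 * δ) (-(2 * δ)), u (arcPoint ζ t x) ≤ -(1 - η) := by
  have hpi := Real.pi_pos
  have hm1 : Real.pi / 2 ∈ Icc δ (2 * Real.pi - Real.pi - δ) := ⟨by linarith, by linarith⟩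
  have hm2 : -(Real.pi / 2) ∈ Icc (-Real.pi + δ) (-δ) := ⟨by linarith, by linarith⟩
  have hz1 : ∀ t ∈ Icc δ (2 * Real.pi - Real.pi - δ), ∀ y, u (arcPoint ζ t y) ≠ 0 := fun t ht ↦
    hz.ne_zero_of_pos_angle hpi.le ht
  have hz2 : ∀ t ∈ Icc (-Real.pi + δ) (-δ), ∀ y, -u (arcPoint ζ t y) ≠ 0 := fun t ht ↦
    hz.neg.ne_zero_of_neg_angle (by linarith) ht
  have hu' := hu.neg hW
  have cu := hu.smooth.continuous
  have cu' := hu'.smooth.continuous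
  have hx2 := neg_pos.2 (hu.neg_of_pos hW hε hδπ hδ hz hn hx)
  refine ⟨fun t ht ↦ ?_, fun t ht ↦ le_neg.1 ?_⟩
  · have h := hu.le_of_pos_slab hW hε
      (isClopen_setOf_pos (continuous_slice cu ζ _) (hz1 _ hm1)) (Circle.exp t * ζ) hk hη1 hc hεk
      (fun s hs y hy ↦ by
        rw [arcPoint_exp_mul]
        exact pos_of_ne_zero cu ordConnected_Icc (fun s hs ↦ hz1 s hs y) hm1 hy
          ⟨by linarith [hs.1, ht.1], by linarith [hs.2, ht.2]⟩) hx
    exact h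
  · have h := hu'.le_of_pos_slab hW hε
      (isClopen_setOf_pos (continuous_slice cu' ζ _) (hz2 _ hm2)) (Circle.exp t * ζ) hk hη1 hc hεk
      (fun s hs y hy ↦ by
        rw [arcPoint_exp_mul]
        exact pos_of_ne_zero cu' ordConnected_Icc (fun s hs ↦ hz2 s hs y) hm2 hy
          ⟨by linarith [hs.1, ht.1], by linarith [hs.2, ht.2]⟩) hx2
    exact h

end Arcs

section SliceSign
variable {M : Type*}

open scoped Classical in
/-- The sign of `u` on the slice over `i ζ`, as a function on `M`; the constant `1` if `u` has a
zero there. -/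
def sliceSign (u : Circle × M → ℝ) (ζ : Circle) (x : M) : ℝ :=
  if (∀ y, u (arcPoint ζ (Real.pi / 2) y) ≠ 0) ∧ u (arcPoint ζ (Real.pi / 2) x) < 0 then -1 else 1

theorem sliceSign_eq_or (u : Circle × M → ℝ) (ζ : Circle) (x : M) :
    sliceSign u ζ x = 1 ∨ sliceSign u ζ x = -1 := by
  unfold sliceSign
  split_ifs <;> simp

theorem isLocallyConstant_sliceSign [TopologicalSpace M] {u : Circle × M → ℝ} (hu : Continuous u)
    (ζ : Circle) : IsLocallyConstant (sliceSign u ζ) := by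
  by_cases h : ∀ y, u (arcPoint ζ (Real.pi / 2) y) ≠ 0
  · have hc := continuous_slice hu ζ (Real.pi / 2)
    refine (IsLocallyConstant.iff_eventually_eq _).2 fun x ↦ ?_
    rcases lt_or_gt_of_ne (h x) with hx | hx
    · filter_upwards [hc.continuousAt.eventually (gt_mem_nhds hx)] with y hy
      rw [sliceSign, sliceSign, if_pos ⟨h, hy⟩, if_pos ⟨h, hx⟩]
    · filter_upwards [hc.continuousAt.eventually (lt_mem_nhds hx)] with y hy
      rw [sliceSign, sliceSign, if_neg fun h' ↦ h'.2.not_gt hy, if_neg fun h' ↦ h'.2.not_gt hx]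
  · have : sliceSign u ζ = fun _ ↦ 1 := funext fun x ↦ if_neg fun h' ↦ h h'.1
    rw [this]
    exact IsLocallyConstant.const 1

end SliceSign

/-! ### The limit -/

section Limit
variable {d : ℕ} {M : Type*} [TopologicalSpace M] [T2Space M] [CompactSpace M]
  [ChartedSpace (EuclideanSpace ℝ (Fin d)) M] [IsManifold (𝓡 d) ∞ M]
  {gM : ContMDiffRiemannianMetric (𝓡 d) ∞ (EuclideanSpace ℝ (Fin d))
      (fun x : M ↦ TangentSpace (𝓡 d) x)}
  {W : ℝ → ℝ} {ζ : Circle} {a δ : ℝ}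

/-- Hausdorff convergence in terms of angles and components. -/
theorem eventually_nodal {u : ℕ → Circle × M → ℝ} {θ₁ θ₂ : Circle}
    (hlim : Tendsto (fun i ↦ riemannianHausdorffEDist (productMetric circleMetric gM)
      {p | u i p = 0} (({θ₁, θ₂} : Set Circle) ×ˢ univ)) atTop (𝓝 0)) (hδ : 0 < δ) :
    ∀ᶠ i in atTop, (∀ p, u i p = 0 → ∃ τ : ℝ, |τ| < δ ∧
        (p.1 = Circle.exp τ * θ₁ ∨ p.1 = Circle.exp τ * θ₂)) ∧
      ∀ θ ∈ ({θ₁, θ₂} : Set Circle), ∀ x : M, ∃ t ∈ Icc (-δ) δ, ∃ y ∈ connectedComponent x,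
        u i (arcPoint θ t y) = 0 := by
  have _ : LocallyConnectedSpace M :=
    ChartedSpace.locallyConnectedSpace (EuclideanSpace ℝ (Fin d)) M
  filter_upwards [eventually_mem_of_tendsto_riemannianHausdorffEDist hlim
    (mem_nhdsSet_diagonal_of_arg hδ)] with i ⟨h1, h2⟩
  refine ⟨fun p hp ↦ ?_, fun θ hθ x ↦ ?_⟩
  · obtain ⟨q, ⟨hq, -⟩, harg, -⟩ := h1 p hp
    refine ⟨_, harg, ?_⟩
    rcases hq with hq | hq
    · exact Or.inl (by rw [← hq, exp_arg_div_mul])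
    · exact Or.inr (by rw [← (hq : q.1 = θ₂), exp_arg_div_mul])
  · obtain ⟨p, hp, harg, hcc⟩ := h2 (θ, x) ⟨hθ, mem_univ _⟩
    refine ⟨_, abs_le.1 harg.le, p.2, hcc, ?_⟩
    rw [arcPoint, exp_arg_div_mul]
    exact hp

/-- The limit slices are opposite: otherwise the oriented angle from one of them to the other lies in
`[0, π)`. -/
theorem arg_eq_pi_of_tendsto [Nonempty M] (hW : IsDoubleWell W) {ε : ℕ → ℝ} (hε : ∀ i, 0 < ε i)
    {u : ℕ → Circle × M → ℝ}
    (hu : ∀ i, IsPhaseTransition (productMetric circleMetric gM) W (ε i) (u i)) {θ₁ θ₂ : Circle}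
    (hlim : Tendsto (fun i ↦ riemannianHausdorffEDist (productMetric circleMetric gM)
      {p | u i p = 0} (({θ₁, θ₂} : Set Circle) ×ˢ univ)) atTop (𝓝 0)) :
    ((θ₂ / θ₁ : Circle) : ℂ).arg = Real.pi := by
  set α := ((θ₂ / θ₁ : Circle) : ℂ).arg with hα
  have hθ : Circle.exp α * θ₁ = θ₂ := exp_arg_div_mul θ₂ θ₁
  have hα1 : -Real.pi < α := Complex.neg_pi_lt_arg _
  refine le_antisymm (Complex.arg_le_pi _) ?_
  by_contra! hα2
  have hδ : 0 < (Real.pi - |α|) / 4 := by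
    have := abs_lt.2 ⟨hα1, hα2⟩
    linarith
  obtain ⟨i, h1, h2⟩ := (eventually_nodal hlim hδ).exists
  rcases le_total 0 α with h0 | h0
  · refine (hu i).false_of_nodalNear hW (hε i) (ζ := θ₂) h0 ?_ hδ (fun p hp ↦ ?_)
      (h2 θ₂ (by simp))
    · rw [abs_of_nonneg h0]
      linarith
    · have h3 : Circle.exp (-α) * θ₂ = θ₁ := by
        rw [← hθ, Circle.exp_neg, inv_mul_cancel_left]
      rw [h3]
      obtain ⟨τ, hτ, h⟩ := h1 p hp
      exact ⟨τ, hτ, h.symm⟩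
  · refine (hu i).false_of_nodalNear hW (hε i) (ζ := θ₁) (a := -α) (by linarith) ?_ hδ
      (fun p hp ↦ ?_) (h2 θ₁ (by simp))
    · rw [abs_of_nonpos h0]
      linarith
    · rw [neg_neg, hθ]
      exact h1 p hp

theorem im_exp_mul_div (t : ℝ) (ζ : Circle) :
    ((Circle.exp t * ζ / ζ : Circle) : ℂ).im = Real.sin t := by
  rw [mul_div_cancel_right, Circle.coe_exp, Complex.exp_ofReal_mul_I_im]

/-- If all zeros of `u` are close to the slices over `ζ` and `-ζ`, then away from them `u` is close,
up to the sign over each component of `M`, to the sign of the sine of the angle. -/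
theorem IsPhaseTransition.abs_sign_sub_le {ε : ℝ} {u : Circle × M → ℝ}
    (hW : IsDoubleWell W) (hε : 0 < ε)
    (hu : IsPhaseTransition (productMetric circleMetric gM) W ε u)
    (hδπ : 4 * δ ≤ Real.pi) (hδ : 0 < δ) (hz : NodalNear u ζ Real.pi δ)
    (hn : ∀ x : M, ∃ t ∈ Icc (-δ) δ, ∃ y ∈ connectedComponent x, u (arcPoint ζ t y) = 0)
    {k : ℕ} (hk : 0 < k) (hkδ : Real.pi / (2 * k) ≤ δ) {η c : ℝ} (hη1 : η < 1)
    (hc : ∀ x ∈ Ioc 0 (1 - η), deriv W x ≤ -c * x) (hεk : ε ^ 2 * k ^ 2 < c) {t : ℝ}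
    (ht1 : 2 * δ ≤ |t|) (ht2 : |t| ≤ Real.pi - 2 * δ) (x : M) :
    |Real.sign ((((arcPoint ζ t x).1 / ζ : Circle) : ℂ).im)
      - sliceSign u ζ x * u (arcPoint ζ t x)| ≤ η := by
  have hpi := Real.pi_pos
  have hne : ∀ y, u (arcPoint ζ (Real.pi / 2) y) ≠ 0 :=
    hz.ne_zero_of_pos_angle hpi.le ⟨by linarith, by linarith⟩
  -- it suffices to treat a solution `w = ± u` that is positive over `i ζ`
  have key : ∀ w : Circle × M → ℝ, IsPhaseTransition (productMetric circleMetric gM) W ε w →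
      NodalNear w ζ Real.pi δ →
      (∀ x : M, ∃ t ∈ Icc (-δ) δ, ∃ y ∈ connectedComponent x, w (arcPoint ζ t y) = 0) →
      0 < w (arcPoint ζ (Real.pi / 2) x) →
      |Real.sign ((((arcPoint ζ t x).1 / ζ : Circle) : ℂ).im) - w (arcPoint ζ t x)| ≤ η := by
    intro w hw hwz hwn hpos
    obtain ⟨h1, h2⟩ := hw.near_one_of_pos hW hε hδπ hδ hwz hwn hk hkδ hη1 hc hεk hpos
    have hb := hw.mem_Icc (arcPoint ζ t x)
    rw [arcPoint, im_exp_mul_div]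
    change |_ - w (arcPoint ζ t x)| ≤ η
    rcases le_total 0 t with h0 | h0
    · rw [abs_of_nonneg h0] at ht1 ht2
      rw [Real.sign_of_pos (Real.sin_pos_of_pos_of_lt_pi (by linarith) (by linarith)), abs_le]
      have := h1 t ⟨ht1, ht2⟩
      constructor <;> linarith [hb.2]
    · rw [abs_of_nonpos h0] at ht1 ht2
      rw [Real.sign_of_neg (Real.sin_neg_of_neg_of_neg_pi_lt (by linarith) (by linarith)), abs_le]
      have := h2 t ⟨by linarith, by linarith⟩
      constructor <;> linarith [hb.1]
  rcases lt_or_gt_of_ne (hne x) with hx | hx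
  · rw [sliceSign, if_pos ⟨hne, hx⟩, neg_one_mul]
    exact key _ (hu.neg hW) hz.neg (by simpa using hn) (neg_pos.2 hx)
  · rw [sliceSign, if_neg fun h ↦ h.2.not_gt hx, one_mul]
    exact key _ hu hz hn hx

theorem tendstoLocallyUniformlyOn_sign (hW : IsDoubleWell W) {ε : ℕ → ℝ} (hε : ∀ i, 0 < ε i)
    (hε0 : Tendsto ε atTop (𝓝 0)) {u : ℕ → Circle × M → ℝ}
    (hu : ∀ i, IsPhaseTransition (productMetric circleMetric gM) W (ε i) (u i)) {θ₁ θ₂ : Circle}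
    (hlim : Tendsto (fun i ↦ riemannianHausdorffEDist (productMetric circleMetric gM)
      {p | u i p = 0} (({θ₁, θ₂} : Set Circle) ×ˢ univ)) atTop (𝓝 0))
    (hθ : ((θ₂ / θ₁ : Circle) : ℂ).arg = Real.pi) :
    TendstoLocallyUniformlyOn (fun i p ↦ sliceSign (u i) θ₁ p.2 * u i p)
      (fun p ↦ Real.sign ((p.1 / θ₁ : Circle) : ℂ).im) atTop
      (({θ₁, θ₂} : Set Circle) ×ˢ univ)ᶜ := by
  have hpi := Real.pi_pos
  rw [Metric.tendstoLocallyUniformlyOn_iff]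
  intro r hr p hp
  have hp' : p.1 ≠ θ₁ ∧ p.1 ≠ θ₂ := by
    simpa only [mem_compl_iff, mem_prod, mem_univ, and_true, mem_insert_iff, mem_singleton_iff,
      not_or] using hp
  have hexp := exp_arg_div_mul p.1 θ₁
  have hθ2 := exp_arg_div_mul θ₂ θ₁
  rw [hθ] at hθ2
  set A : Circle × M → ℝ := fun q ↦ |((q.1 / θ₁ : Circle) : ℂ).arg| with hA
  have hA0 : 0 < A p := by
    refine abs_pos.2 fun h ↦ hp'.1 ?_
    rw [h, Circle.exp_zero, one_mul] at hexp
    exact hexp.symm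
  have hne : ((p.1 / θ₁ : Circle) : ℂ).arg ≠ Real.pi := fun h ↦ by
    rw [h, hθ2] at hexp
    exact hp'.2 hexp.symm
  have hAπ : A p < Real.pi :=
    abs_lt.2 ⟨Complex.neg_pi_lt_arg _, lt_of_le_of_ne (Complex.arg_le_pi _) hne⟩
  have hcA : ContinuousAt A p := by
    have hc : Continuous fun q : Circle × M ↦ ((q.1 / θ₁ : Circle) : ℂ) := by
      simp only [div_eq_mul_inv]
      exact (continuous_induced_dom : Continuous ((↑) : Circle → ℂ)).comp (by fun_prop)
    refine (ContinuousAt.comp (g := Complex.arg) ?_ hc.continuousAt).abs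
    exact Complex.continuousAt_arg (Complex.mem_slitPlane_iff_arg.2 ⟨hne, Circle.coe_ne_zero _⟩)
  set δ := min (A p) (Real.pi - A p) / 4 with hδ
  have hδ0 : 0 < δ := div_pos (lt_min hA0 (sub_pos.2 hAπ)) (by norm_num)
  have hδ1 : 4 * δ ≤ A p := by
    have := min_le_left (A p) (Real.pi - A p)
    linarith
  have hδ2 : 4 * δ ≤ Real.pi - A p := by
    have := min_le_right (A p) (Real.pi - A p)
    linarith
  set η := min (r / 2) (1 / 2) with hη
  have hη0 : 0 < η := by positivity
  have hηr : η < r := (min_le_left _ _).trans_lt (by linarith)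
  have hη1 : η < 1 := (min_le_right _ _).trans_lt (by norm_num)
  obtain ⟨c, hc0, hc⟩ := hW.exists_deriv_le hη0
  obtain ⟨k, hk⟩ := exists_nat_gt (Real.pi / (2 * δ))
  have hk0 : (0 : ℝ) < k := lt_trans (by positivity) hk
  have hkδ : Real.pi / (2 * k) ≤ δ := by
    rw [div_lt_iff₀ (by positivity)] at hk
    rw [div_le_iff₀ (by positivity)]
    linarith
  have hεk : ∀ᶠ i in atTop, ε i ^ 2 * k ^ 2 < c := by
    have h := (hε0.pow 2).mul_const ((k : ℝ) ^ 2)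
    rw [zero_pow two_ne_zero, zero_mul] at h
    exact h.eventually (gt_mem_nhds hc0)
  refine ⟨{q | A q ∈ Ioo (2 * δ) (Real.pi - 2 * δ)}, mem_nhdsWithin_of_mem_nhds
    (hcA.eventually (Ioo_mem_nhds (by linarith) (by linarith))), ?_⟩
  filter_upwards [hεk, eventually_nodal hlim hδ0] with i hi ⟨h1, h2⟩ q hq
  have hz : NodalNear (u i) θ₁ Real.pi δ := fun p hp ↦ by
    have hπ : Circle.exp (-Real.pi) = Circle.exp Real.pi :=
      Circle.exp_eq_exp.2 ⟨-1, by push_cast; ring⟩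
    rw [hπ, hθ2]
    exact h1 p hp
  have hqA : arcPoint θ₁ (((q.1 / θ₁ : Circle) : ℂ).arg) q.2 = q := by
    rw [arcPoint, exp_arg_div_mul]
  have h := (hu i).abs_sign_sub_le hW (hε i) (by linarith) hδ0 hz (h2 θ₁ (by simp))
    (by exact_mod_cast hk0) hkδ hη1 hc hi (le_of_lt hq.1) (le_of_lt hq.2) q.2
  rw [hqA] at h
  exact h.trans_lt hηr

end Limit

end
end PhaseTransition

theorem proposition2 {d : ℕ} {M : Type*} [TopologicalSpace M] [T2Space M] [CompactSpace M]
    [Nonempty M] [ChartedSpace (EuclideanSpace ℝ (Fin d)) M] [IsManifold (𝓡 d) ∞ M]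
    (gM : ContMDiffRiemannianMetric (𝓡 d) ∞ (EuclideanSpace ℝ (Fin d))
      (fun x : M ↦ TangentSpace (𝓡 d) x))
    (W : ℝ → ℝ) (hW : IsDoubleWell W)
    (ε : ℕ → ℝ) (hε : ∀ i, 0 < ε i) (hε0 : Tendsto ε atTop (𝓝 0))
    (u : ℕ → Circle × M → ℝ)
    (hu : ∀ i, IsPhaseTransition (productMetric circleMetric gM) W (ε i) (u i))
    (θ₁ θ₂ : Circle)
    (hlim : Tendsto (fun i ↦ riemannianHausdorffEDist (productMetric circleMetric gM)
      {p | u i p = 0} (({θ₁, θ₂} : Set Circle) ×ˢ univ)) atTop (𝓝 0)) :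
    θ₂ = -θ₁ ∧
    ∃ s : ℕ → M → ℝ, (∀ i x, s i x = 1 ∨ s i x = -1) ∧ (∀ i, IsLocallyConstant (s i)) ∧
      TendstoLocallyUniformlyOn (fun i p ↦ s i p.2 * u i p)
        (fun p ↦ Real.sign ((p.1 / θ₁ : Circle) : ℂ).im) atTop
        (({θ₁, θ₂} : Set Circle) ×ˢ univ)ᶜ := by
  have hθ := arg_eq_pi_of_tendsto hW hε hu hlim
  refine ⟨?_, fun i ↦ sliceSign (u i) θ₁, fun i ↦ sliceSign_eq_or _ _,
    fun i ↦ isLocallyConstant_sliceSign (hu i).smooth.continuous _,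
    tendstoLocallyUniformlyOn_sign hW hε hε0 hu hlim hθ⟩
  have h := exp_arg_div_mul θ₂ θ₁
  rw [hθ] at h
  rw [← h]
  ext
  simp
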